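/- Let $\mathfrak H=\{\tau\in\mathbb C:\operatorname{Im}\tau>0\}$, $\tau=x+iy$, $q^{r}=e^{2\pi i r\tau}$ for $r\in\mathbb Q$, $\zeta_n=e^{2\pi i/n}$, $(q)_\infty=\prod_{n\ge1}(1-q^n)$, $(q^2;q^2)_\infty=\prod_{n\ge 1}(1-q^{2n})$, and let $\eta$ be the Dedekind eta function. For $|q|<1$ define $$f_0(q)=\frac1{(q)_\infty}\sum_{n\ge0}\sum_{|j|\le n}(-1)^jq^{\frac52n^2+\frac12n-j^2}(1-q^{4n+2}),\qquad f_1(q)=\frac1{(q)_\infty}\sum_{n\ge0}\sum_{|j|\le n}(-1)^jq^{\frac52n^2+\frac32n-j^2}(1-q^{2n+1}),$$ $$F_0(q)=\frac1{(q^2;q^2)_\infty}\sum_{n\ge0}\sum_{j=0}^{2n}(-1)^nq^{5n^2+2n-\frac12j^2-\frac12j}(1+q^{6n+3}),\qquad F_1(q)=\frac1{(q^2;q^2)_\infty}\sum_{n\ge0}\sum_{j=0}^{2n}(-1)^nq^{5n^2+4n-\frac12j^2-\frac12j}(1+q^{2n+1}).$$ Put $$F_{5,1}(\tau)=\begin{pmatrix}q^{-1/60}f_0(q)\\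 q^{11/60}f_1(q)\\ q^{-1/240}(-1+F_0(q^{1/2}))\\ q^{71/240}F_1(q^{1/2})\\ q^{-1/240}(-1+F_0(-q^{1/2}))\\ q^{71/240}F_1(-q^{1/2})\end{pmatrix}.$$ Let $E(x)=2\int_0^xe^{-\pi u^2}du$, $A=\begin{pmatrix}5&0\\0&-2\end{pmatrix}$, $B(x,y)=x^tAy$, $Q(x)=\frac12B(x,x)$, $c_1=(2,5)^t$, $c_2=(-2,5)^t$ (so $Q(c_1)=Q(c_2)=-15$), and for $a,b\in\mathbb R^2$ $$\theta_{a,b}(\tau)=\sum_{\nu\in a+\mathbb Z^2}\left\{E\Bigl(\tfrac{B(c_1,\nu)}{\sqrt{-Q(c_1)}}\sqrt y\Bigr)-E\Bigl(\tfrac{B(c_2,\nu)}{\sqrt{-Q(c_2)}}\sqrt y\Bigr)\right\}e^{2\pi iQ(\nu)\tau+2\pi iB(\nu,b)}.$$ Put $$H_{5,1}(\tau)=\frac1{2\eta(\tau)}\begin{pmatrix}\theta_{(1/10,0),(0,1/4)}(\tau)\\ \theta_{(3/10,0),(0,1/4)}(\tau)\\ \theta_{(1/5,1/4),(1/2,1)}(\tau)\\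 \theta_{(2/5,1/4),(1/2,2)}(\tau)\\ \zeta_8\,\theta_{(1/5,1/4),(0,1/4)}(\tau)\\ \zeta_8\,\theta_{(2/5,1/4),(0,1/4)}(\tau)\end{pmatrix}.$$ With $\beta(x)=\int_x^\infty u^{-1/2}e^{-\pi u}du$ let, for $a,b\in\mathbb R$, $$R_{a,b}(\tau)=\sum_{\nu\in a+\mathbb Z}\operatorname{sgn}(\nu)\,\beta(2\nu^2y)\,e^{-\pi i\nu^2\tau-2\pi i\nu b},$$ and put $$G_{5,1}(\tau)=\frac12\begin{pmatrix}2\zeta_{12}R_{\frac1{30},\frac52}+2\zeta_{12}^{-1}R_{\frac{11}{30},\frac52}\\ 2\zeta_{12}R_{\frac{13}{30},\frac52}+2\zeta_{12}^{-1}R_{\frac{23}{30},\frac52}\\ -R_{\frac{19}{60},0}-R_{\frac{29}{60},0}+R_{\frac{49}{60},0}+R_{\frac{59}{60},0}\\ -R_{\frac{13}{60},0}-R_{\frac{23}{60},0}+R_{\frac{43}{60},0}+R_{\frac{53}{60},0}\\ \zeta_{24}^{-5}R_{\frac{19}{60},\frac52}+\zeta_{24}^{5}R_{\frac{29}{60},\frac52}+\zeta_{24}R_{\frac{49}{60},\frac52}+\zeta_{24}^{-1}R_{\frac{59}{60},\frac52}\\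 \zeta_{24}R_{\frac{13}{60},\frac52}+\zeta_{24}^{-1}R_{\frac{23}{60},\frac52}+\zeta_{24}^{-5}R_{\frac{43}{60},\frac52}+\zeta_{24}^{5}R_{\frac{53}{60},\frac52}\end{pmatrix}(30\tau).$$ Let $\Omega_{\frac12}=-4y^2\frac{\partial^2}{\partial\tau\,\partial\overline\tau}+iy\frac{\partial}{\partial\overline\tau}+\frac3{16}$ be the weight $\frac12$ Casimir operator, acting componentwise. A function $f:\mathfrak H\to\mathbb C^n$ is called a vector-valued real-analytic modular form of weight $\frac12$ if it is real-analytic, if for each $\gamma=\begin{pmatrix}a&b\\c&d\end{pmatrix}\in\mathrm{SL}_2(\mathbb Z)$ there is a constant matrix $\rho(\gamma)\in\mathrm{GL}_n(\mathbb C)$ with $f\bigl(\frac{a\tau+b}{c\tau+d}\bigr)=(c\tau+d)^{1/2}\rho(\gamma)f(\tau)$ for all $\tau$ (principal branch), if it is an eigenfunction of $\Omega_{\frac12}$ (not identically zero), and if $|f(\tau)|\le Ce^{Cy}$ for $y\ge1$ and some constant $C$. **Proposition.** On $\mathfrak H$ we have $F_{5,1}=H_{5,1}+G_{5,1}$, where: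 (1) $H_{5,1}$ is a vector-valued real-analytic modular form of weight $\frac12$, satisfying $$H_{5,1}(\tau+1)=\begin{pmatrix}\zeta_{60}^{-1}&0&0&0&0&0\\0&\zeta_{60}^{11}&0&0&0&0\\0&0&0&0&\zeta_{240}^{-1}&0\\0&0&0&0&0&\zeta_{240}^{71}\\0&0&\zeta_{240}^{-1}&0&0&0\\0&0&0&\zeta_{240}^{71}&0&0\end{pmatrix}H_{5,1}(\tau),\qquad H_{5,1}\Bigl(-\frac1\tau\Bigr)=\sqrt{-i\tau}\,\frac2{\sqrt5}\,M_5\,H_{5,1}(\tau),$$ with the principal branch of the square root and $$M_5=\begin{pmatrix}0&0&\sqrt2\sin\frac\pi5&\sqrt2\sin\frac{2\pi}5&0&0\\0&0&\sqrt2\sin\frac{2\pi}5&-\sqrt2\sin\frac\pi5&0&0\\\frac1{\sqrt2}\sin\frac\pi5&\frac1{\sqrt2}\sin\frac{2\pi}5&0&0&0&0\\\frac1{\sqrt2}\sin\frac{2\pi}5&-\frac1{\sqrt2}\sin\frac\pi5&0&0&0&0\\0&0&0&0&\sin\frac{2\pi}5&\sin\frac\pi5\\0&0&0&0&\sin\frac\pi5&-\sin\frac{2\pi}5\end{pmatrix},$$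 and it is an eigenfunction of $\Omega_{\frac12}$ with eigenvalue $\frac3{16}$. (2) For every $\xi\in\mathbb Q$, $G_{5,1}(\xi+iy)$ is bounded as $y\downarrow0$. -/

import Mathlib

open scoped Topology

noncomputable section

namespace MockTheta

open Complex Filter

/-! ### Elementary notation -/

/-- `𝐞(x) = exp(2πi x)`. With `q = 𝐞(τ)`, the power `q^r` (`r` rational) is `𝐞(r τ)`. -/
def e (x : ℂ) : ℂ := Complex.exp (2 * (Real.pi : ℂ) * I * x)

/-- `ζ_n^k = exp(2πi k / n)`. -/
def zeta (n : ℕ) (k : ℤ) : ℂ := e ((k : ℂ) / (n : ℂ))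

/-- `(q)_∞ = ∏_{n ≥ 1} (1 - q^n)`. -/
def qInf (q : ℂ) : ℂ := ∏' n : ℕ, (1 - q ^ (n + 1))

/-! ### Four fifth order mock theta functions, as functions of `q` with `|q| < 1`

All exponents of `q` below are nonnegative integers on the range of summation; the integer
divisions by `2` are exact. -/

/-- `f₀(q) = (q)_∞⁻¹ ∑_{n ≥ 0} ∑_{|j| ≤ n} (-1)^j q^{5n²/2 + n/2 - j²} (1 - q^{4n+2})`. -/
def f0 (q : ℂ) : ℂ :=
  (qInf q)⁻¹ * ∑' n : ℕ, ∑ j ∈ Finset.Icc (-(n : ℤ)) (n : ℤ),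
    (-1 : ℂ) ^ j * q ^ ((5 * (n : ℤ) ^ 2 + n) / 2 - j ^ 2) * (1 - q ^ (4 * n + 2))

/-- `f₁(q) = (q)_∞⁻¹ ∑_{n ≥ 0} ∑_{|j| ≤ n} (-1)^j q^{5n²/2 + 3n/2 - j²} (1 - q^{2n+1})`. -/
def f1 (q : ℂ) : ℂ :=
  (qInf q)⁻¹ * ∑' n : ℕ, ∑ j ∈ Finset.Icc (-(n : ℤ)) (n : ℤ),
    (-1 : ℂ) ^ j * q ^ ((5 * (n : ℤ) ^ 2 + 3 * n) / 2 - j ^ 2) * (1 - q ^ (2 * n + 1))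

/-- `F₀(q) = (q²;q²)_∞⁻¹ ∑_{n ≥ 0} ∑_{0 ≤ j ≤ 2n} (-1)^n q^{5n² + 2n - j(j+1)/2} (1 + q^{6n+3})`. -/
def F0 (q : ℂ) : ℂ :=
  (qInf (q ^ 2))⁻¹ * ∑' n : ℕ, ∑ j ∈ Finset.range (2 * n + 1),
    (-1 : ℂ) ^ n * q ^ (5 * (n : ℤ) ^ 2 + 2 * n - (j : ℤ) * (j + 1) / 2) * (1 + q ^ (6 * n + 3))

/-- `F₁(q) = (q²;q²)_∞⁻¹ ∑_{n ≥ 0} ∑_{0 ≤ j ≤ 2n} (-1)^n q^{5n² + 4n - j(j+1)/2} (1 + q^{2n+1})`. -/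
def F1 (q : ℂ) : ℂ :=
  (qInf (q ^ 2))⁻¹ * ∑' n : ℕ, ∑ j ∈ Finset.range (2 * n + 1),
    (-1 : ℂ) ^ n * q ^ (5 * (n : ℤ) ^ 2 + 4 * n - (j : ℤ) * (j + 1) / 2) * (1 + q ^ (2 * n + 1))

/-- The vector `F_{5,1}(τ)`, with `q^{1/2} = exp(πi τ)`. -/
def F51 (τ : ℂ) : Fin 6 → ℂ :=
  ![e (-τ / 60) * f0 (e τ),
    e (11 * τ / 60) * f1 (e τ),
    e (-τ / 240) * (-1 + F0 (e (τ / 2))),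
    e (71 * τ / 240) * F1 (e (τ / 2)),
    e (-τ / 240) * (-1 + F0 (-e (τ / 2))),
    e (71 * τ / 240) * F1 (-e (τ / 2))]

/-! ### Indefinite theta functions -/

/-- `E(x) = 2 ∫₀ˣ exp(-π u²) du`. -/
def E (x : ℝ) : ℝ := 2 * ∫ u in (0 : ℝ)..x, Real.exp (-Real.pi * u ^ 2)

/-- `B(x, y) = ⟨x, A y⟩`. -/
def bilin {r : ℕ} (A : Matrix (Fin r) (Fin r) ℤ) (x y : Fin r → ℝ) : ℝ :=
  x ⬝ᵥ ((A.map (Int.cast : ℤ → ℝ)).mulVec y)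

/-- `Q(x) = ⟨x, A x⟩ / 2`. -/
def quad {r : ℕ} (A : Matrix (Fin r) (Fin r) ℤ) (x : Fin r → ℝ) : ℝ := bilin A x x / 2

/-- `ρ^c(ν; τ)` as a function of `y = Im τ`: the regularised sign of `B(c, ν)` if `Q(c) < 0`, and
the sign itself if `Q(c) = 0`. -/
def rho {r : ℕ} (A : Matrix (Fin r) (Fin r) ℤ) (c ν : Fin r → ℝ) (y : ℝ) : ℝ :=
  if quad A c < 0 then E (bilin A c ν / Real.sqrt (-quad A c) * Real.sqrt y)
  else Real.sign (bilin A c ν)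

/-- The indefinite theta function `θ_{a,b}^{c₁,c₂}(τ)` of the quadratic form with matrix `A`. -/
def theta {r : ℕ} (A : Matrix (Fin r) (Fin r) ℤ) (c₁ c₂ a b : Fin r → ℝ) (τ : ℂ) : ℂ :=
  ∑' n : Fin r → ℤ,
    ((rho A c₁ (fun i => a i + n i) τ.im - rho A c₂ (fun i => a i + n i) τ.im : ℝ) : ℂ) *
      Complex.exp (2 * (Real.pi : ℂ) * I * (quad A (fun i => a i + n i) : ℂ) * τ +
        2 * (Real.pi : ℂ) * I * (bilin A (fun i => a i + n i) b : ℂ))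

/-- `θ_{a,b}` for `A = diag(5, -2)`, `c₁ = (2, 5)` and `c₂ = (-2, 5)`. -/
def theta5 (a b : Fin 2 → ℝ) (τ : ℂ) : ℂ :=
  theta !![5, 0; 0, -2] ![2, 5] ![-2, 5] a b τ

/-- The vector `H_{5,1}(τ)`. -/
def H51 (τ : ℂ) : Fin 6 → ℂ :=
  (1 / (2 * ModularForm.eta τ)) •
    ![theta5 ![1 / 10, 0] ![0, 1 / 4] τ,
      theta5 ![3 / 10, 0] ![0, 1 / 4] τ,
      theta5 ![1 / 5, 1 / 4] ![1 / 2, 1] τ,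
      theta5 ![2 / 5, 1 / 4] ![1 / 2, 2] τ,
      zeta 8 1 * theta5 ![1 / 5, 1 / 4] ![0, 1 / 4] τ,
      zeta 8 1 * theta5 ![2 / 5, 1 / 4] ![0, 1 / 4] τ]

/-! ### Non-holomorphic unary theta series -/

/-- `β(x) = ∫_x^∞ u^{-1/2} exp(-π u) du`. -/
def beta (x : ℝ) : ℝ := ∫ u in Set.Ioi x, u ^ (-(1 / 2) : ℝ) * Real.exp (-Real.pi * u)

/-- `R_{a,b}(τ) = ∑_{ν ∈ a + ℤ} sgn(ν) β(2 ν² y) exp(-πi ν² τ - 2πi ν b)`, `y = Im τ`. -/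
def R (a b : ℝ) (τ : ℂ) : ℂ :=
  ∑' n : ℤ, ((Real.sign (a + n) * beta (2 * (a + n) ^ 2 * τ.im) : ℝ) : ℂ) *
    Complex.exp (-(Real.pi : ℂ) * I * ((a : ℂ) + n) ^ 2 * τ -
      2 * (Real.pi : ℂ) * I * ((a : ℂ) + n) * (b : ℂ))

/-- The vector whose value at `30 τ` is `G_{5,1}(τ)`. -/
def G51aux (τ : ℂ) : Fin 6 → ℂ :=
  (1 / 2 : ℂ) •
    ![2 * zeta 12 1 * R (1 / 30) (5 / 2) τ + 2 * zeta 12 (-1) * R (11 / 30) (5 / 2) τ,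
      2 * zeta 12 1 * R (13 / 30) (5 / 2) τ + 2 * zeta 12 (-1) * R (23 / 30) (5 / 2) τ,
      -R (19 / 60) 0 τ - R (29 / 60) 0 τ + R (49 / 60) 0 τ + R (59 / 60) 0 τ,
      -R (13 / 60) 0 τ - R (23 / 60) 0 τ + R (43 / 60) 0 τ + R (53 / 60) 0 τ,
      zeta 24 (-5) * R (19 / 60) (5 / 2) τ + zeta 24 5 * R (29 / 60) (5 / 2) τ +
        zeta 24 1 * R (49 / 60) (5 / 2) τ + zeta 24 (-1) * R (59 / 60) (5 / 2) τ,
      zeta 24 1 * R (13 / 60) (5 / 2) τ + zeta 24 (-1) * R (23 / 60) (5 / 2) τ +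
        zeta 24 (-5) * R (43 / 60) (5 / 2) τ + zeta 24 5 * R (53 / 60) (5 / 2) τ]

/-- The vector `G_{5,1}(τ)`. -/
def G51 (τ : ℂ) : Fin 6 → ℂ := G51aux (30 * τ)

/-! ### Real-analytic modular forms of weight `1/2` -/

/-- `∂f/∂τ = (∂f/∂x - i ∂f/∂y) / 2`, componentwise. -/
def dTau {n : ℕ} (f : ℂ → Fin n → ℂ) (τ : ℂ) : Fin n → ℂ :=
  (1 / 2 : ℂ) • (fderiv ℝ f τ 1 - I • fderiv ℝ f τ I)

/-- `∂f/∂τ̄ = (∂f/∂x + i ∂f/∂y) / 2`, componentwise. -/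
def dTauBar {n : ℕ} (f : ℂ → Fin n → ℂ) (τ : ℂ) : Fin n → ℂ :=
  (1 / 2 : ℂ) • (fderiv ℝ f τ 1 + I • fderiv ℝ f τ I)

/-- The weight `1/2` Casimir operator
`Ω_{1/2} = -4 y² ∂²/∂τ∂τ̄ + i y ∂/∂τ̄ + 3/16`, componentwise. -/
def casimir {n : ℕ} (f : ℂ → Fin n → ℂ) (τ : ℂ) : Fin n → ℂ :=
  (-4 * (τ.im : ℂ) ^ 2) • dTau (dTauBar f) τ + (I * (τ.im : ℂ)) • dTauBar f τ +
    (3 / 16 : ℂ) • f τ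

/-- `f` is, on the upper half-plane, an eigenfunction (in particular, not identically zero) of
the Casimir operator `Ω_{1/2}` with eigenvalue `l`. -/
def IsCasimirEigenfunction {n : ℕ} (f : ℂ → Fin n → ℂ) (l : ℂ) : Prop :=
  (∃ τ : ℂ, 0 < τ.im ∧ f τ ≠ 0) ∧ ∀ τ : ℂ, 0 < τ.im → casimir f τ = l • f τ

/-- `f` is a vector-valued real-analytic modular form of weight `1/2` for `SL₂(ℤ)`: it is
real-analytic on the upper half-plane, `f(γτ) = (cτ + d)^{1/2} ρ(γ) f(τ)` with constant
invertible matrices `ρ(γ)`, it is an eigenfunction of the Casimir operator, and it has at most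
exponential growth at `i∞` (hence at every cusp). -/
structure IsRealAnalyticModularForm {n : ℕ} (f : ℂ → Fin n → ℂ) : Prop where
  analytic : AnalyticOnNhd ℝ f {τ : ℂ | 0 < τ.im}
  modular : ∀ γ : Matrix.SpecialLinearGroup (Fin 2) ℤ, ∃ M : GL (Fin n) ℂ,
    ∀ τ : ℂ, 0 < τ.im →
      f (((γ 0 0 : ℤ) * τ + (γ 0 1 : ℤ)) / ((γ 1 0 : ℤ) * τ + (γ 1 1 : ℤ))) =
        (((γ 1 0 : ℤ) * τ + (γ 1 1 : ℤ)) ^ (1 / 2 : ℂ)) •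
          (M : Matrix (Fin n) (Fin n) ℂ).mulVec (f τ)
  eigen : ∃ l : ℂ, IsCasimirEigenfunction f l
  growth : ∃ C : ℝ, ∀ τ : ℂ, 1 ≤ τ.im → ‖f τ‖ ≤ C * Real.exp (C * τ.im)

/-! ### The matrices of `τ ↦ τ + 1` and `τ ↦ -1/τ` -/

/-- The matrix of the translation `τ ↦ τ + 1`. -/
def T5 : Matrix (Fin 6) (Fin 6) ℂ :=
  !![zeta 60 (-1), 0, 0, 0, 0, 0;
     0, zeta 60 11, 0, 0, 0, 0;
     0, 0, 0, 0, zeta 240 (-1), 0;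
     0, 0, 0, 0, 0, zeta 240 71;
     0, 0, zeta 240 (-1), 0, 0, 0;
     0, 0, 0, zeta 240 71, 0, 0]

/-- The real matrix `M₅`. -/
def M5real : Matrix (Fin 6) (Fin 6) ℝ :=
  let s₁ := Real.sin (Real.pi / 5)
  let s₂ := Real.sin (2 * Real.pi / 5)
  !![0, 0, √2 * s₁, √2 * s₂, 0, 0;
     0, 0, √2 * s₂, -(√2 * s₁), 0, 0;
     1 / √2 * s₁, 1 / √2 * s₂, 0, 0, 0, 0;
     1 / √2 * s₂, -(1 / √2 * s₁), 0, 0, 0, 0;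
     0, 0, 0, 0, s₂, s₁;
     0, 0, 0, 0, s₁, -s₂]

/-- The matrix `M₅`, with complex entries. -/
def M5 : Matrix (Fin 6) (Fin 6) ℂ := M5real.map (Complex.ofReal : ℝ → ℂ)

end MockTheta

end

noncomputable section

namespace MockTheta

open Complex Filter

open scoped Topology ComplexConjugate

/-! ### The error functions `E` and `β` -/

/-! For ν = (x, z) put Q(ν) = (5x² - 2z²)/2. Up to the factor 1/(2η), every component of `H51` is a
signed sum over a translate of ℤ² of `W x z τ`, that is, of E(κ(x-z)√y) + E(κ(x+z)√y) times q^Q with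
κ = `kap` (`theta5_eq`, `H51_eq`). Three independent arguments give the theorem.

Decomposition. Since E(u) = sgn(u)(1 - β(u²)) (`E_eq`), `W` splits into a pure sign part `S` and two
error terms `V`, one for each of c₁ and c₂. The sign part is supported on the cone |z| ≤ |x|, with
no boundary point in the sums that occur. Pairing the rows n and -(n+1) turns it into Hecke-type
double sums, hence into 2η times a component of `F51`; for the third component a leftover diagonal
is η by Euler's pentagonal number theorem, and this accounts for the -1 next to F₀. In an error term
the sign and β depend on x - z only. Completing the square, Q = (3/2)(z + (5/3)(x-z))² -
(5/3)(x-z)², so summing along the lines of constant x - z produces a unary theta series, which is ±η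
or 0, again by the pentagonal number theorem. What remains is a combination of the series `R` at 30τ
(`Bt_eq_sum`). Dividing by η gives F = H + G in four components, and τ ↦ τ + 1 carries the third and
fourth identities to the last two.

Modularity. Translation is a matter of phases. For inversion, `W` is written as an integral over
hyperbolic angles between c₂ and c₁ of u·exp(πi(u²τ - v²τ̄)), where (u, v) are rotated coordinates
with u² - v² = 2Q (`W_eq_integral`). For each fixed angle this is an absolutely convergent Siegel
theta kernel to which Poisson summation applies (`tsum_cexp_rotated`, `tsum_gker_mul_uT`).
Integrating gives `tsum_W_neg_one_div`, and splitting the dual lattice into classes mod 5 and mod 2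
gives the matrix M₅. The group generated by the two substitutions is handled by absorbing the sign
ambiguity of the square roots into the matrices.

Analysis. The components of `F51` are holomorphic, and 2∂R/∂τ̄ is y^{-1/2} times a holomorphic
function of τ̄, so H = F - G inherits this shape (`HasShadow`). It yields the Casimir equation by a
direct computation and real-analyticity by solving the ∂̄-equation locally. Since G is bounded for y
≥ 1, growth and nonvanishing of H are read off from F. Near a rational point the phases of `R` are
periodic in the summation index, and on each residue class the positive and negative tails are
monotone and interlace, so their difference stays bounded (`abs_tsum_odd_le`). -/

lemma integrableOn_beta_integrand :
    MeasureTheory.IntegrableOn (fun u : ℝ => u ^ (-(1 / 2) : ℝ) * Real.exp (-Real.pi * u))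
      (Set.Ioi 0) := by
  have := integrableOn_rpow_mul_exp_neg_mul_rpow (p := 1) (s := -(1 / 2)) (b := Real.pi)
    (by norm_num) one_pos Real.pi_pos
  simpa using this

lemma beta_zero : beta 0 = 1 := by
  have := Real.integral_rpow_mul_exp_neg_mul_Ioi (a := 1 / 2) (r := Real.pi) (by norm_num)
    Real.pi_pos
  unfold beta
  rw [show (-(1 / 2) : ℝ) = 1 / 2 - 1 by norm_num]
  simp only [neg_mul]
  rw [this, Real.Gamma_one_half_eq, ← Real.sqrt_eq_rpow, ← Real.sqrt_mul (by positivity)]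
  rw [one_div, inv_mul_cancel₀ Real.pi_pos.ne', Real.sqrt_one]

/-- The shifted integrand decreases in x, so β(x)e^{πx} does too. This gives β(x) ≤ e^{-πx}, used
for convergence, and later the monotonicity of the terms of G near a rational point. -/
lemma beta_mul_exp (x : ℝ) : beta x * Real.exp (Real.pi * x) =
    ∫ u in Set.Ioi (0 : ℝ), (u + x) ^ (-(1 / 2) : ℝ) * Real.exp (-Real.pi * u) := by
  have h := (MeasureTheory.measurePreserving_add_right MeasureTheory.volume x).setIntegral_preimage_emb
    (measurableEmbedding_addRight x)
    (fun u : ℝ => u ^ (-(1 / 2) : ℝ) * Real.exp (-Real.pi * u)) (Set.Ioi x)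
  rw [Set.preimage_add_const_Ioi, sub_self] at h
  rw [beta, ← h, ← MeasureTheory.integral_mul_const]
  refine MeasureTheory.setIntegral_congr_fun measurableSet_Ioi fun u _ => ?_
  simp only [mul_assoc, ← Real.exp_add]
  ring_nf

lemma integrableOn_beta_shift {x : ℝ} (hx : 0 ≤ x) :
    MeasureTheory.IntegrableOn
      (fun u : ℝ => (u + x) ^ (-(1 / 2) : ℝ) * Real.exp (-Real.pi * u)) (Set.Ioi 0) := by
  refine MeasureTheory.Integrable.mono' integrableOn_beta_integrand ?_ ?_
  · exact Measurable.aestronglyMeasurable (by fun_prop)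
  · refine (MeasureTheory.ae_restrict_iff' measurableSet_Ioi).2 (Eventually.of_forall fun u hu => ?_)
    have hu : 0 < u := hu
    rw [Real.norm_of_nonneg (by positivity)]
    gcongr ?_ * _
    exact Real.rpow_le_rpow_of_nonpos hu (by linarith) (by norm_num)

lemma beta_mul_exp_antitoneOn :
    AntitoneOn (fun x => beta x * Real.exp (Real.pi * x)) (Set.Ici 0) := by
  intro x hx y hy hxy
  have hx : 0 ≤ x := hx
  have hy : 0 ≤ y := hy
  simp only
  rw [beta_mul_exp x, beta_mul_exp y]
  refine MeasureTheory.setIntegral_mono_on (integrableOn_beta_shift hy)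
    (integrableOn_beta_shift hx) measurableSet_Ioi fun u hu => ?_
  have hu : 0 < u := hu
  gcongr ?_ * _
  exact Real.rpow_le_rpow_of_nonpos (by linarith) (by linarith) (by norm_num)

lemma beta_nonneg {x : ℝ} (hx : 0 ≤ x) : 0 ≤ beta x := by
  refine MeasureTheory.setIntegral_nonneg measurableSet_Ioi fun u hu => ?_
  have : 0 < u := hx.trans_lt hu
  positivity

lemma beta_le {x : ℝ} (hx : 0 ≤ x) : beta x ≤ Real.exp (-Real.pi * x) := by
  have h := beta_mul_exp_antitoneOn (Set.self_mem_Ici) (Set.mem_Ici.2 hx) hx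
  simp only [beta_zero, mul_zero, Real.exp_zero, mul_one] at h
  rw [neg_mul, Real.exp_neg]
  exact (le_div_iff₀ (Real.exp_pos _)).2 h |>.trans_eq (one_div _)

lemma beta_eq_sub {x : ℝ} (hx : 0 ≤ x) :
    beta x = 1 - ∫ u in (0 : ℝ)..x, u ^ (-(1 / 2) : ℝ) * Real.exp (-Real.pi * u) := by
  have h := beta_zero
  rw [beta, ← Set.Ioc_union_Ioi_eq_Ioi hx,
    MeasureTheory.setIntegral_union (Set.Ioc_disjoint_Ioi le_rfl) measurableSet_Ioi] at h
  · rw [beta, intervalIntegral.integral_of_le hx]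
    exact eq_sub_of_add_eq' h
  · exact integrableOn_beta_integrand.mono_set Set.Ioc_subset_Ioi_self
  · exact integrableOn_beta_integrand.mono_set (Set.Ioi_subset_Ioi hx)

lemma intervalIntegrable_beta_integrand {x : ℝ} (hx : 0 ≤ x) : IntervalIntegrable
    (fun u : ℝ => u ^ (-(1 / 2) : ℝ) * Real.exp (-Real.pi * u)) MeasureTheory.volume 0 x := by
  rw [intervalIntegrable_iff_integrableOn_Ioc_of_le hx]
  exact integrableOn_beta_integrand.mono_set Set.Ioc_subset_Ioi_self

lemma hasDerivAt_beta {x : ℝ} (hx : 0 < x) :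
    HasDerivAt beta (-(x ^ (-(1 / 2) : ℝ) * Real.exp (-Real.pi * x))) x := by
  have hc : ContinuousAt (fun u : ℝ => u ^ (-(1 / 2) : ℝ) * Real.exp (-Real.pi * u)) x :=
    (Real.continuousAt_rpow_const _ _ (Or.inl hx.ne')).mul (by fun_prop)
  have h := intervalIntegral.integral_hasDerivAt_right (intervalIntegrable_beta_integrand hx.le)
    (Measurable.stronglyMeasurable (by fun_prop)).stronglyMeasurableAtFilter hc
  refine (h.const_sub 1).congr_of_eventuallyEq ?_
  filter_upwards [lt_mem_nhds hx] with y hy using beta_eq_sub hy.le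

lemma continuousOn_beta : ContinuousOn beta (Set.Ici 0) := by
  intro x hx
  have hx : 0 ≤ x := hx
  have h := intervalIntegral.continuousOn_primitive_interval'
    (intervalIntegrable_beta_integrand (x := x + 1) (by linarith)) Set.left_mem_uIcc
  have hx1 : x ∈ Set.uIcc 0 (x + 1) := by rw [Set.uIcc_of_le (by linarith)]; exact ⟨hx, by simp⟩
  have h2 := (continuousWithinAt_const (b := (1 : ℝ))).sub (h x hx1)
  rw [Set.uIcc_of_le (by linarith)] at h2
  have h3 : ContinuousWithinAt beta (Set.Icc 0 (x + 1)) x :=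
    h2.congr (fun y hy => beta_eq_sub hy.1) (beta_eq_sub hx)
  exact h3.mono_of_mem_nhdsWithin (by
    rw [← Set.Ici_inter_Iic]
    exact inter_mem_nhdsWithin _ (Iic_mem_nhds (by simp)))

lemma hasDerivAt_E (x : ℝ) : HasDerivAt E (2 * Real.exp (-Real.pi * x ^ 2)) x := by
  have hc : Continuous (fun u : ℝ => Real.exp (-Real.pi * u ^ 2)) := by fun_prop
  exact (hc.integral_hasStrictDerivAt 0 x).hasDerivAt.const_mul 2

lemma E_neg (x : ℝ) : E (-x) = -E x := by
  unfold E
  have := intervalIntegral.integral_comp_neg (a := 0) (b := x)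
    (fun u : ℝ => Real.exp (-Real.pi * u ^ 2))
  simp only [neg_sq, neg_zero] at this
  rw [this, intervalIntegral.integral_symm (-x) 0]
  simp

lemma E_zero : E 0 = 0 := by simp [E]

/-- E(y) + β(y²) has derivative zero for y > 0 and equals 1 at y = 0. The mean value theorem asks
for the derivative in the open interval only, so the singularity of β' at 0 costs no more than
continuity there. -/
lemma E_of_nonneg {x : ℝ} (hx : 0 ≤ x) : E x = 1 - beta (x ^ 2) := by
  rcases hx.eq_or_lt with rfl | hx0
  · simp [E_zero, beta_zero]
  obtain ⟨c, ⟨hc, -⟩, h⟩ := exists_hasDerivAt_eq_slope (fun y => E y + beta (y ^ 2)) (fun _ => 0) hx0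
    (ContinuousOn.add (fun y _ => (hasDerivAt_E y).continuousAt.continuousWithinAt)
      (continuousOn_beta.comp (by fun_prop) fun y _ => sq_nonneg y)) fun y hy => by
        have h1 : HasDerivAt (fun y => beta (y ^ 2)) _ y :=
          HasDerivAt.comp y (h₂ := beta) (h := fun y => y ^ 2)
            (hasDerivAt_beta (pow_pos hy.1 2)) (hasDerivAt_pow 2 y)
        refine ((hasDerivAt_E y).add h1).congr_deriv ?_
        have : (y ^ 2) ^ (-(1 / 2) : ℝ) = y⁻¹ := by
          rw [← Real.rpow_natCast, ← Real.rpow_mul hy.1.le]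
          norm_num [Real.rpow_neg_one]
        rw [this]
        have := hy.1.ne'
        field_simp
        ring
  rw [eq_comm, div_eq_zero_iff, or_iff_left (by linarith)] at h
  simp only [E_zero, ne_eq, OfNat.ofNat_ne_zero, not_false_eq_true, zero_pow, beta_zero] at h
  linarith

/-- The source of the decomposition: the 1 yields the holomorphic part and β the non-holomorphic
part. -/
lemma E_eq (x : ℝ) : E x = Real.sign x * (1 - beta (x ^ 2)) := by
  rcases lt_trichotomy x 0 with h | rfl | h
  · rw [Real.sign_of_neg h, ← neg_neg x, E_neg, E_of_nonneg (by linarith)]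
    ring_nf
  · simp [E_zero]
  · rw [Real.sign_of_pos h, E_of_nonneg h.le]
    ring

/-! ### The exponential `e` -/

lemma e_add (x y : ℂ) : e (x + y) = e x * e y := by
  simp only [e, mul_add, Complex.exp_add]

lemma e_zero : e 0 = 1 := by simp [e]

lemma e_neg (x : ℂ) : e (-x) = (e x)⁻¹ := by
  simp only [e, mul_neg, Complex.exp_neg]

lemma e_ne_zero (x : ℂ) : e x ≠ 0 := Complex.exp_ne_zero _

lemma e_int (n : ℤ) : e n = 1 := by
  rw [e, mul_comm]; exact Complex.exp_int_mul_two_pi_mul_I n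

lemma e_half : e (1 / 2) = -1 := by
  rw [e, ← Complex.exp_pi_mul_I]; ring_nf

lemma e_zpow (x : ℂ) (n : ℤ) : e x ^ n = e (n * x) := by
  rw [e, e, ← Complex.exp_int_mul]; ring_nf

lemma e_pow (x : ℂ) (n : ℕ) : e x ^ n = e (n * x) := by
  exact_mod_cast e_zpow x n

lemma e_int_half (n : ℤ) : e (n / 2) = (-1) ^ n := by
  rw [← e_half, e_zpow]; ring_nf

lemma e_eq_of_eq_add_int {x y : ℂ} (n : ℤ) (h : x = y + n) : e x = e y := by
  rw [h, e_add, e_int, mul_one]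

lemma norm_e (x : ℂ) : ‖e x‖ = Real.exp (-2 * Real.pi * x.im) := by
  rw [e, Complex.norm_exp]
  simp

lemma norm_e_real (x : ℝ) : ‖e x‖ = 1 := by simp [norm_e]

lemma norm_e_lt_one {τ : ℂ} (hτ : 0 < τ.im) : ‖e τ‖ < 1 := by
  rw [norm_e, Real.exp_lt_one_iff]
  nlinarith [Real.pi_pos]

lemma norm_neg_one_zpow (n : ℤ) : ‖(-1 : ℂ) ^ n‖ = 1 := by simp

lemma neg_one_zpow_even_add (m n : ℤ) : (-1 : ℂ) ^ (2 * m + n) = (-1) ^ n := by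
  rw [zpow_add₀ (by simp), zpow_mul]; simp

/-! ### Euler's pentagonal number theorem and the Dedekind eta function -/

lemma le_pentagonal_neg (k : ℕ) : k ≤ pentagonal (-(k : ℤ)) := by
  have := two_mul_natCast_pentagonal_neg k
  zify
  nlinarith

lemma le_pentagonal_succ (k : ℕ) : k ≤ pentagonal ((k : ℤ) + 1) := by
  have := two_mul_natCast_pentagonal ((k : ℤ) + 1)
  zify
  nlinarith

lemma summable_neg_one_pow_mul_pow {q : ℂ} (hq : ‖q‖ < 1) {N : ℕ → ℕ} (hN : ∀ k, k ≤ N k)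
    (m : ℕ) : Summable fun k : ℕ => (-1 : ℂ) ^ (k + m) * q ^ N k := by
  refine Summable.of_norm_bounded (summable_geometric_of_lt_one (norm_nonneg q) hq) fun k => ?_
  simpa using pow_le_pow_of_le_one (norm_nonneg q) hq.le (hN k)

lemma norm_prod_one_sub_pow_le {q : ℂ} (hq : ‖q‖ < 1) (k n : ℕ) :
    ‖∏ i ∈ Finset.range n, (1 - q ^ (k + i + 1))‖ ≤ Real.exp (1 / (1 - ‖q‖)) := by
  have h := Finset.norm_prod_one_add_sub_one_le (Finset.range n) fun i => -q ^ (k + i + 1)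
  have h2 : ∑ i ∈ Finset.range n, ‖-q ^ (k + i + 1)‖ ≤ 1 / (1 - ‖q‖) := by
    calc ∑ i ∈ Finset.range n, ‖-q ^ (k + i + 1)‖ ≤ ∑ i ∈ Finset.range n, ‖q‖ ^ i := by
          refine Finset.sum_le_sum fun i _ => ?_
          rw [norm_neg, norm_pow]
          exact pow_le_pow_of_le_one (norm_nonneg q) hq.le (by omega)
      _ ≤ ∑' i : ℕ, ‖q‖ ^ i := Summable.sum_le_tsum _ (fun i _ => by positivity)
          (summable_geometric_of_lt_one (norm_nonneg q) hq)
      _ = 1 / (1 - ‖q‖) := by rw [tsum_geometric_of_lt_one (norm_nonneg q) hq, one_div]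
  simp only [← sub_eq_add_neg] at h
  calc ‖∏ i ∈ Finset.range n, (1 - q ^ (k + i + 1))‖
      = ‖(∏ i ∈ Finset.range n, (1 - q ^ (k + i + 1)) - 1) + 1‖ := by rw [sub_add_cancel]
    _ ≤ _ := norm_add_le _ _
    _ ≤ Real.exp (∑ i ∈ Finset.range n, ‖-q ^ (k + i + 1)‖) := by
        rw [norm_one]; linarith
    _ ≤ _ := Real.exp_le_exp.2 h2

/-- The algebraic identity is `Pentagonal.tprod_one_sub_pow`; its analytic hypotheses hold because
all partial products are bounded by one constant M, which makes every auxiliary series geometric.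
The one-sided sum is then unfolded: k ≥ 0 gives `pentagonal (-k)` and -(k+1) gives `pentagonal (k +
1)`. -/
lemma hasSum_pentagonal {q : ℂ} (hq : ‖q‖ < 1) :
    HasSum (fun k : ℤ => (-1 : ℂ) ^ k * q ^ pentagonal (-k)) (qInf q) := by
  set M := Real.exp (1 / (1 - ‖q‖))
  have h1q : 0 < 1 - ‖q‖ := by linarith
  have hb (k n : ℕ) : ‖q ^ ((k + 1) * n) * ∏ i ∈ Finset.range (n + 1), (1 - q ^ (k + i + 1))‖ ≤
      M * ‖q‖ ^ n := by
    rw [norm_mul, mul_comm, norm_pow]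
    exact mul_le_mul (norm_prod_one_sub_pow_le hq k (n + 1))
      (pow_le_pow_of_le_one (norm_nonneg q) hq.le (Nat.le_mul_of_pos_left n k.succ_pos))
      (by positivity) (Real.exp_pos _).le
  have hg := (summable_geometric_of_lt_one (norm_nonneg q) hq).mul_left M
  have hs0 := summable_neg_one_pow_mul_pow hq le_pentagonal_neg 0
  have hs1 := summable_neg_one_pow_mul_pow hq le_pentagonal_succ 1
  have hE : (fun k : ℕ => (-1 : ℂ) ^ k * (q ^ pentagonal (-k) - q ^ pentagonal (k + 1))) =
      fun k : ℕ => (-1) ^ (k + 0) * q ^ pentagonal (-k) +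
        (-1) ^ (k + 1) * q ^ pentagonal (k + 1) := by
    ext k; ring
  have key : qInf q = ∑' k : ℕ, (-1 : ℂ) ^ k * (q ^ pentagonal (-k) - q ^ pentagonal (k + 1)) := by
    refine Pentagonal.tprod_one_sub_pow ?_ (fun k => Summable.of_norm_bounded hg (hb k))
      (fun k => ?_) ?_ ?_
    · exact tendsto_pow_atTop_nhds_zero_of_norm_lt_one hq
    · have := multipliable_one_add_of_summable (f := fun n => -q ^ (n + k + 1)) (by
        simpa [add_assoc] using
          (summable_nat_add_iff (k + 1)).mpr (summable_geometric_of_lt_one (norm_nonneg q) hq))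
      simpa [sub_eq_add_neg] using this
    · rw [hE]; exact hs0.add hs1
    -- The remainder is a power of q with exponent at least k times a series bounded independently
    -- of k.
    · refine squeeze_zero_norm (a := fun k : ℕ => ‖q‖ ^ k * (M * (1 - ‖q‖)⁻¹)) (fun k => ?_) ?_
      · rw [norm_mul, norm_mul, norm_pow, norm_neg, norm_one, one_pow, one_mul, norm_pow]
        refine mul_le_mul ?_ ?_ (norm_nonneg _) (by positivity)
        · refine pow_le_pow_of_le_one (norm_nonneg q) hq.le ?_
          rw [Nat.le_div_iff_mul_le two_pos]
          nlinarith
        · refine (tsum_of_norm_bounded hg.hasSum (hb k)).trans_eq ?_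
          rw [tsum_mul_left, tsum_geometric_of_lt_one (norm_nonneg q) hq]
      · simpa using (tendsto_pow_atTop_nhds_zero_of_lt_one (norm_nonneg q) hq).mul_const
          (M * (1 - ‖q‖)⁻¹)
  rw [key, hE, hs0.tsum_add hs1]
  refine HasSum.of_nat_of_neg_add_one ?_ ?_
  · simpa using hs0.hasSum
  · convert hs1.hasSum using 2 with k
    rw [neg_neg, zpow_neg, ← inv_zpow, inv_neg, inv_one]
    norm_cast

lemma eta_eq (τ : ℂ) : ModularForm.eta τ = e (τ / 24) * qInf (e τ) := by
  simp only [ModularForm.eta, qInf, e, ModularForm.eta_q, Function.Periodic.qParam]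
  congr 2
  · push_cast; ring_nf
  · simp

lemma eta_ne_zero {τ : ℂ} (hτ : 0 < τ.im) : ModularForm.eta τ ≠ 0 :=
  ModularForm.eta_ne_zero hτ

lemma qInf_ne_zero {q : ℂ} (hq : ‖q‖ < 1) : qInf q ≠ 0 := by
  have := tprod_one_add_ne_zero_of_summable (f := fun n : ℕ => -q ^ (n + 1)) (fun n h => ?_) ?_
  · simpa [qInf, sub_eq_add_neg] using this
  · have h2 : q ^ (n + 1) = 1 := by linear_combination -h
    have h3 : ‖q‖ ^ (n + 1) = 1 := by rw [← norm_pow, h2, norm_one]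
    exact (pow_lt_one₀ (norm_nonneg q) hq (by simp)).ne h3
  · simpa using
      (summable_nat_add_iff 1).mpr (summable_geometric_of_lt_one (norm_nonneg q) hq)

/-- The pentagonal number theorem in terms of the Dedekind eta function. -/
lemma hasSum_eta {τ : ℂ} (hτ : 0 < τ.im) :
    HasSum (fun k : ℤ => (-1 : ℂ) ^ k * e (3 / 2 * ((k : ℂ) + 1 / 6) ^ 2 * τ))
      (ModularForm.eta τ) := by
  rw [eta_eq]
  refine ((hasSum_pentagonal (norm_e_lt_one hτ)).mul_left (e (τ / 24))).congr_fun fun k => ?_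
  have h : (2 * (pentagonal (-k) : ℂ)) = k * (3 * k + 1) := by
    exact_mod_cast two_mul_natCast_pentagonal_neg k
  rw [e_pow, mul_left_comm, ← e_add]
  congr 2
  linear_combination -(τ / 2) * h

lemma eta_add_one (τ : ℂ) : ModularForm.eta (τ + 1) = zeta 24 1 * ModularForm.eta τ := by
  have : e (τ + 1) = e τ := e_eq_of_eq_add_int 1 (by simp)
  rw [eta_eq, eta_eq, this, zeta, ← mul_assoc, ← e_add]
  congr 2
  push_cast; ring

/-- The inversion law with (√I)⁻¹√τ becomes the one with √(-Iτ) because arg τ lies in [0, π] and arg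
I = π/2, so log τ - log I stays in the principal strip. -/
lemma eta_neg_one_div {τ : ℂ} (hτ : 0 < τ.im) :
    ModularForm.eta (-1 / τ) = (-I * τ) ^ (1 / 2 : ℂ) * ModularForm.eta τ := by
  have h := ModularForm.eta_comp_eq_csqrt_I_inv (x := τ) hτ
  simp only [Function.comp_apply, Pi.smul_apply, Pi.mul_apply, smul_eq_mul, Complex.sqrt] at h
  rw [h, ← mul_assoc]
  congr 1
  have h0 : τ ≠ 0 := by rintro rfl; simp at hτ
  rw [show -I * τ = τ / I by rw [div_I]; ring, one_div, inv_mul_eq_div]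
  have hI : arg I = Real.pi / 2 := arg_I
  have hp := arg_nonneg_iff.2 hτ.le
  have hle := arg_le_pi τ
  have hlog : log (τ / I) = log τ - log I := by
    rw [div_eq_mul_inv, log_mul_eq_add_log_iff h0 (by simp) |>.2, log_inv _ (by
      rw [hI]; linarith [Real.pi_pos]), sub_eq_add_neg]
    rw [arg_inv, hI, if_neg (by linarith [Real.pi_pos])]
    constructor <;> linarith [Real.pi_pos]
  rw [cpow_def_of_ne_zero h0, cpow_def_of_ne_zero I_ne_zero,
    cpow_def_of_ne_zero (div_ne_zero h0 I_ne_zero), ← Complex.exp_sub, hlog]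
  ring_nf

/-! ### Summability of two-dimensional Gaussians -/

lemma summable_exp_neg_sq_add_abs {c : ℝ} (hc : 0 < c) (L : ℝ) :
    Summable fun n : ℤ => Real.exp (-c * (n : ℝ) ^ 2 + L * |(n : ℝ)|) := by
  have := summable_pow_mul_jacobiTheta₂_term_bound (L / (2 * Real.pi))
    (T := c / Real.pi) (by positivity) 0
  refine this.congr fun n => ?_
  have := Real.pi_ne_zero
  rw [pow_zero, one_mul]
  congr 1
  push_cast
  field_simp
  ring

lemma summable_exp_neg_sq_add_abs_prod {c : ℝ} (hc : 0 < c) (L : ℝ) :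
    Summable fun p : ℤ × ℤ => Real.exp (-c * ((p.1 : ℝ) ^ 2 + (p.2 : ℝ) ^ 2) +
      L * (|(p.1 : ℝ)| + |(p.2 : ℝ)|)) := by
  have h := summable_exp_neg_sq_add_abs hc L
  refine (h.mul_of_nonneg h (fun _ => (Real.exp_pos _).le) fun _ => (Real.exp_pos _).le).congr
    fun p => ?_
  rw [← Real.exp_add]
  ring_nf

lemma sq_sub_le_sq_add (a x : ℝ) : x ^ 2 - 2 * |a| * |x| ≤ (a + x) ^ 2 := by
  have := neg_abs_le (a * x)
  rw [abs_mul] at this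
  nlinarith [sq_nonneg a]

lemma summable_exp_neg_sq_shift {c : ℝ} (hc : 0 < c) (a b : ℝ) :
    Summable fun p : ℤ × ℤ => Real.exp (-c * ((a + p.1) ^ 2 + (b + p.2) ^ 2)) := by
  refine Summable.of_nonneg_of_le (fun _ => (Real.exp_pos _).le) (fun p => Real.exp_le_exp.2 ?_)
    (summable_exp_neg_sq_add_abs_prod hc (2 * c * (|a| + |b|)))
  have h1 := sq_sub_le_sq_add a p.1
  have h2 := sq_sub_le_sq_add b p.2
  have h3 : 0 ≤ |a| * |(p.2 : ℝ)| := by positivity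
  have h4 : 0 ≤ |b| * |(p.1 : ℝ)| := by positivity
  nlinarith [mul_nonneg hc.le (sub_nonneg.2 h1), mul_nonneg hc.le (sub_nonneg.2 h2),
    mul_nonneg hc.le h3, mul_nonneg hc.le h4]

lemma one_add_le_mul_exp {c : ℝ} (hc : 0 < c) {s : ℝ} (hs : 0 ≤ s) :
    1 + s ≤ (1 + 1 / c) * Real.exp (c * s) := by
  have h := Real.add_one_le_exp (c * s)
  calc 1 + s ≤ (1 + 1 / c) * (c * s + 1) := by
        have : (1 + 1 / c) * (c * s + 1) = 1 + s + (c * s + 1 / c) := by field_simp; ring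
        have : 0 ≤ c * s + 1 / c := by positivity
        linarith
    _ ≤ _ := by gcongr

/-- The family of points `(x p, z p)` of the plane is spread out enough for all Gaussian sums over
it to converge. -/
def GaussSummable {ι : Type*} (x z : ι → ℝ) : Prop :=
  ∀ c : ℝ, 0 < c → Summable fun p => Real.exp (-c * (x p ^ 2 + z p ^ 2))

lemma gaussSummable_shift (a b : ℝ) :
    GaussSummable (fun p : ℤ × ℤ => a + p.1) (fun p : ℤ × ℤ => b + p.2) :=
  fun _ hc => summable_exp_neg_sq_shift hc a b

lemma GaussSummable.one_add {ι : Type*} {x z : ι → ℝ} (h : GaussSummable x z) {c : ℝ}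
    (hc : 0 < c) :
    Summable fun p => (1 + (x p ^ 2 + z p ^ 2)) * Real.exp (-c * (x p ^ 2 + z p ^ 2)) := by
  refine Summable.of_nonneg_of_le (fun _ => by positivity) (fun p => ?_)
    ((h _ (half_pos hc)).mul_left (1 + 1 / (c / 2)))
  set s := x p ^ 2 + z p ^ 2
  have hs : 0 ≤ s := by positivity
  calc (1 + s) * Real.exp (-c * s)
      ≤ ((1 + 1 / (c / 2)) * Real.exp (c / 2 * s)) * Real.exp (-c * s) := by
        gcongr; exact one_add_le_mul_exp (half_pos hc) hs
    _ = _ := by rw [mul_assoc, ← Real.exp_add]; ring_nf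

/-! ### Hyperbolic rotations and the summands of the indefinite theta functions -/

/-- First coordinate, rotated by the hyperbolic angle `t`. -/
def uT (t x z : ℝ) : ℝ := √5 * Real.cosh t * x - √2 * Real.sinh t * z

/-- Second coordinate, rotated by the hyperbolic angle `t`. -/
def vT (t x z : ℝ) : ℝ := √2 * Real.cosh t * z - √5 * Real.sinh t * x

lemma uT_sq_sub_vT_sq (t x z : ℝ) : uT t x z ^ 2 - vT t x z ^ 2 = 5 * x ^ 2 - 2 * z ^ 2 := by
  have h5 : √5 ^ 2 = 5 := Real.sq_sqrt (by norm_num)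
  have h2 : √2 ^ 2 = 2 := Real.sq_sqrt (by norm_num)
  have h := Real.cosh_sq t
  unfold uT vT
  linear_combination (x ^ 2 * (Real.cosh t ^ 2 - Real.sinh t ^ 2)) * h5 -
    (z ^ 2 * (Real.cosh t ^ 2 - Real.sinh t ^ 2)) * h2 + (5 * x ^ 2 - 2 * z ^ 2) * h

/-- A hyperbolic rotation by t has eigenvalues e^{±t}, so it shrinks 5x² + 2z² by at most e^{-2|t|};
the difference is a nonnegative multiple of the square of a null coordinate √5x ∓ √2z. -/
lemma le_uT_sq_add_vT_sq {t T : ℝ} (ht : |t| ≤ T) (x z : ℝ) :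
    Real.exp (-2 * T) * (x ^ 2 + z ^ 2) ≤ uT t x z ^ 2 + vT t x z ^ 2 := by
  have h5 : √5 ^ 2 = 5 := Real.sq_sqrt (by norm_num)
  have h2 : √2 ^ 2 = 2 := Real.sq_sqrt (by norm_num)
  have key : Real.exp (-2 * |t|) * (5 * x ^ 2 + 2 * z ^ 2) ≤ uT t x z ^ 2 + vT t x z ^ 2 := by
    rcases abs_cases t with ⟨h, -⟩ | ⟨h, -⟩ <;> rw [h]
    · have e1 : Real.exp (-2 * t) = (Real.cosh t - Real.sinh t) ^ 2 := by
        rw [Real.cosh_sub_sinh, ← Real.exp_nat_mul]; ring_nf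
      have e2 : 0 ≤ Real.cosh t * Real.sinh t := by
        have : 0 ≤ Real.sinh t := Real.sinh_nonneg_iff.2 (h ▸ abs_nonneg t)
        have := Real.cosh_pos t
        positivity
      have e3 : uT t x z ^ 2 + vT t x z ^ 2 - (Real.cosh t - Real.sinh t) ^ 2 *
          (5 * x ^ 2 + 2 * z ^ 2) = 2 * (Real.cosh t * Real.sinh t) * (√5 * x - √2 * z) ^ 2 := by
        unfold uT vT
        linear_combination x ^ 2 * (Real.cosh t - Real.sinh t) ^ 2 * h5 +
          z ^ 2 * (Real.cosh t - Real.sinh t) ^ 2 * h2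
      rw [e1]
      have : 0 ≤ 2 * (Real.cosh t * Real.sinh t) * (√5 * x - √2 * z) ^ 2 := by positivity
      linarith
    · have e1 : Real.exp (-2 * -t) = (Real.cosh t + Real.sinh t) ^ 2 := by
        rw [Real.cosh_add_sinh, ← Real.exp_nat_mul]; ring_nf
      have e2 : 0 ≤ Real.cosh t * -Real.sinh t := by
        have : Real.sinh t ≤ 0 := Real.sinh_nonpos_iff.2 (by linarith [abs_nonneg t])
        have := Real.cosh_pos t
        exact mul_nonneg this.le (by linarith)
      have e3 : uT t x z ^ 2 + vT t x z ^ 2 - (Real.cosh t + Real.sinh t) ^ 2 *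
          (5 * x ^ 2 + 2 * z ^ 2) = 2 * (Real.cosh t * -Real.sinh t) * (√5 * x + √2 * z) ^ 2 := by
        unfold uT vT
        linear_combination x ^ 2 * (Real.cosh t + Real.sinh t) ^ 2 * h5 +
          z ^ 2 * (Real.cosh t + Real.sinh t) ^ 2 * h2
      rw [e1]
      have : 0 ≤ 2 * (Real.cosh t * -Real.sinh t) * (√5 * x + √2 * z) ^ 2 := by positivity
      linarith
  refine le_trans ?_ key
  have : Real.exp (-2 * T) ≤ Real.exp (-2 * |t|) := Real.exp_le_exp.2 (by linarith)
  refine mul_le_mul this ?_ (by positivity) (Real.exp_pos _).le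
  nlinarith [sq_nonneg x, sq_nonneg z]

/-- The majorant Gaussian `exp(πi (u² τ - v² τ̄))` in rotated coordinates. -/
def gker (t x z : ℝ) (τ : ℂ) : ℂ :=
  Complex.exp (Real.pi * I * ((uT t x z : ℂ) ^ 2 * τ - (vT t x z : ℂ) ^ 2 * conj τ))

lemma norm_gker (t x z : ℝ) (τ : ℂ) :
    ‖gker t x z τ‖ = Real.exp (-Real.pi * τ.im * (uT t x z ^ 2 + vT t x z ^ 2)) := by
  rw [gker, Complex.norm_exp]
  congr 1
  simp [← ofReal_pow]
  ring

lemma norm_gker_le {t T : ℝ} (ht : |t| ≤ T) (x z : ℝ) {τ : ℂ} (hτ : 0 < τ.im) :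
    ‖gker t x z τ‖ ≤ Real.exp (-(Real.pi * τ.im * Real.exp (-2 * T)) * (x ^ 2 + z ^ 2)) := by
  rw [norm_gker, Real.exp_le_exp]
  have := mul_le_mul_of_nonneg_left (le_uT_sq_add_vT_sq ht x z)
    (mul_pos Real.pi_pos hτ).le
  linarith

lemma abs_uT_le {t T : ℝ} (ht : |t| ≤ T) (x z : ℝ) :
    |uT t x z| ≤ 6 * Real.cosh T * (1 + (x ^ 2 + z ^ 2)) := by
  have h5 : √5 ≤ 3 := by rw [Real.sqrt_le_left (by norm_num)]; norm_num
  have h2 : √2 ≤ 3 := by rw [Real.sqrt_le_left (by norm_num)]; norm_num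
  have hc : Real.cosh t ≤ Real.cosh T := by
    rw [Real.cosh_le_cosh]; exact ht.trans (le_abs_self T)
  have hs : |Real.sinh t| ≤ Real.cosh T := by
    refine le_trans ?_ hc
    rw [abs_le]
    constructor
    · have := Real.exp_pos t; rw [← Real.cosh_add_sinh] at this; linarith
    · have := Real.exp_pos (-t); rw [← Real.cosh_sub_sinh] at this; linarith
  have hx : |x| ≤ 1 + x ^ 2 := by nlinarith [sq_abs x, sq_nonneg (|x| - 1), abs_nonneg x]
  have hz : |z| ≤ 1 + z ^ 2 := by nlinarith [sq_abs z, sq_nonneg (|z| - 1), abs_nonneg z]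
  have hC := Real.cosh_pos T
  calc |uT t x z| ≤ |√5 * Real.cosh t * x| + |√2 * Real.sinh t * z| := abs_sub _ _
    _ = √5 * Real.cosh t * |x| + √2 * |Real.sinh t| * |z| := by
        simp [abs_mul, abs_of_nonneg, Real.cosh_pos t |>.le]
    _ ≤ 3 * Real.cosh T * |x| + 3 * Real.cosh T * |z| := by gcongr
    _ ≤ 3 * Real.cosh T * (1 + x ^ 2) + 3 * Real.cosh T * (1 + z ^ 2) := by gcongr
    _ ≤ _ := by nlinarith [sq_nonneg x, sq_nonneg z, mul_nonneg hC.le (sq_nonneg x),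
        mul_nonneg hC.le (sq_nonneg z)]

/-! ### The hyperbolic angle of c₁ and c₂, and the summand of the theta series as an integral. -/

/-- `B(c₁, c₁)`-normalisation constant `10 / √15`. -/
def kap : ℝ := 10 / √15

lemma kap_sq : kap ^ 2 = 20 / 3 := by
  rw [kap, div_pow, Real.sq_sqrt (by norm_num)]; norm_num

lemma kap_pos : 0 < kap := by unfold kap; positivity

/-- The hyperbolic angle of `c₁`. -/
def tc : ℝ := Real.arsinh (kap / √10)

lemma sinh_tc : Real.sinh tc = kap / √10 := Real.sinh_arsinh _

lemma cosh_tc : Real.cosh tc = kap / 2 := by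
  rw [tc, Real.cosh_arsinh, div_pow, kap_sq, Real.sq_sqrt (by norm_num),
    Real.sqrt_eq_iff_mul_self_eq (by norm_num) (by linarith [kap_pos])]
  linarith [kap_sq]

lemma tc_nonneg : 0 ≤ tc := by
  rw [tc, Real.arsinh_nonneg_iff]; have := kap_pos; positivity

/-- This is what determines `tc`: at the angles ±tc the coordinate v is proportional to B(c₁, ν) and
B(c₂, ν), so the two error functions in `W` become boundary values of one function of t. -/
lemma sqrt_two_mul_vT_tc (x z : ℝ) : √2 * vT tc x z = kap * (z - x) := by
  have h10 : √2 * √5 = √10 := by rw [← Real.sqrt_mul (by norm_num)]; norm_num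
  have h2 : √2 ^ 2 = 2 := Real.sq_sqrt (by norm_num)
  have h : √10 ≠ 0 := by positivity
  rw [vT, cosh_tc, sinh_tc]
  field_simp
  linear_combination (kap * √10 * z) * h2 - 2 * kap * x * h10

lemma sqrt_two_mul_vT_neg_tc (x z : ℝ) : √2 * vT (-tc) x z = kap * (z + x) := by
  rw [show vT (-tc) x z = vT tc (-x) z by simp [vT], sqrt_two_mul_vT_tc]; ring

/-- The summand of the indefinite theta functions at the vector `(x, z)`. -/
def W (x z : ℝ) (τ : ℂ) : ℂ :=
  ((E (kap * (x - z) * √τ.im) + E (kap * (x + z) * √τ.im) : ℝ) : ℂ) *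
    Complex.exp (Real.pi * I * (5 * (x : ℂ) ^ 2 - 2 * (z : ℂ) ^ 2) * τ)

lemma W_neg_left (x z : ℝ) (τ : ℂ) : W (-x) z τ = -W x z τ := by
  unfold W
  rw [show kap * (-x - z) * √τ.im = -(kap * (x + z) * √τ.im) by ring,
    show kap * (-x + z) * √τ.im = -(kap * (x - z) * √τ.im) by ring, E_neg, E_neg]
  push_cast
  ring_nf

lemma W_neg_right (x z : ℝ) (τ : ℂ) : W x (-z) τ = W x z τ := by
  unfold W
  rw [sub_neg_eq_add, ← sub_eq_add_neg]
  push_cast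
  ring_nf

lemma hasDerivAt_E_vT (x z s t : ℝ) :
    HasDerivAt (fun t => -E (√2 * vT t x z * s))
      (2 * √2 * s * (uT t x z * Real.exp (-Real.pi * (√2 * vT t x z * s) ^ 2))) t := by
  have hv : HasDerivAt (fun t => vT t x z) (-uT t x z) t := by
    have h1 := ((Real.hasDerivAt_cosh t).const_mul (√2)).mul_const z
    have h2 := ((Real.hasDerivAt_sinh t).const_mul (√5)).mul_const x
    exact (h1.sub h2).congr_deriv (by unfold uT; ring)
  have h := (hasDerivAt_E (√2 * vT t x z * s)).comp t ((hv.const_mul (√2)).mul_const s)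
  exact h.neg.congr_deriv (by ring)

lemma continuous_uT (x z : ℝ) : Continuous fun t => uT t x z := by
  unfold uT
  exact ((continuous_const.mul Real.continuous_cosh).mul continuous_const).sub
    ((continuous_const.mul Real.continuous_sinh).mul continuous_const)

lemma continuous_vT (x z : ℝ) : Continuous fun t => vT t x z := by
  unfold vT
  exact ((continuous_const.mul Real.continuous_cosh).mul continuous_const).sub
    ((continuous_const.mul Real.continuous_sinh).mul continuous_const)

lemma continuous_gker (x z : ℝ) (τ : ℂ) : Continuous fun t => gker t x z τ := by
  have h1 := continuous_uT x z
  have h2 := continuous_vT x z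
  unfold gker
  fun_prop

/-- As dv/dt = -u, the fundamental theorem of calculus writes the sum of the two values of E as the
integral of 2√2√y·u·exp(-2πv²y) over [-tc, tc]. The factor exp(-2πv²y) changes exp(πi(u² - v²)τ)
into exp(πi(u²τ - v²τ̄)), replacing the indefinite exponent by a majorant. -/
lemma W_eq_integral (x z : ℝ) {τ : ℂ} (hτ : 0 < τ.im) :
    W x z τ = 2 * √2 * √τ.im * ∫ t in (-tc)..tc, (uT t x z : ℂ) * gker t x z τ := by
  have h1 := continuous_uT x z
  have h2 := continuous_vT x z
  have hint := intervalIntegral.integral_eq_sub_of_hasDerivAt (a := -tc) (b := tc)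
    (fun t _ => hasDerivAt_E_vT x z (√τ.im) t) (Continuous.intervalIntegrable (by fun_prop) _ _)
  rw [sqrt_two_mul_vT_tc, sqrt_two_mul_vT_neg_tc, show kap * (z - x) * √τ.im =
    -(kap * (x - z) * √τ.im) by ring, E_neg, neg_neg, sub_neg_eq_add, add_comm z x,
    intervalIntegral.integral_const_mul] at hint
  rw [W, ← hint]
  push_cast
  rw [mul_assoc, ← intervalIntegral.integral_ofReal, ← intervalIntegral.integral_mul_const]
  congr 2
  ext t
  push_cast
  rw [mul_assoc, ← Complex.exp_add, gker]
  congr 2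
  have h3 : (uT t x z : ℂ) ^ 2 - (vT t x z : ℂ) ^ 2 = 5 * (x : ℂ) ^ 2 - 2 * (z : ℂ) ^ 2 := by
    exact_mod_cast congrArg (fun r : ℝ => (r : ℂ)) (uT_sq_sub_vT_sq t x z)
  have h4 : conj τ = τ - 2 * τ.im * I := by
    apply Complex.ext <;> simp; ring
  have h5 : (√2 : ℂ) ^ 2 = 2 := by exact_mod_cast Real.sq_sqrt (show (0 : ℝ) ≤ 2 by norm_num)
  have h6 : (√τ.im : ℂ) ^ 2 = τ.im := by exact_mod_cast Real.sq_sqrt hτ.le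
  rw [h4, ← h3, mul_pow, mul_pow, h5, h6]
  linear_combination (-2 * Real.pi * (vT t x z : ℂ) ^ 2 * τ.im) * I_sq

/-- A constant in the Gaussian bound of the summands. -/
def cW (y : ℝ) : ℝ := Real.pi * y * Real.exp (-2 * tc)

lemma cW_pos {y : ℝ} (hy : 0 < y) : 0 < cW y := by unfold cW; positivity

lemma norm_uT_mul_gker_le {t : ℝ} (ht : t ∈ Set.Icc (-tc) tc) (x z : ℝ) {τ : ℂ}
    (hτ : 0 < τ.im) :
    ‖(uT t x z : ℂ) * gker t x z τ‖ ≤ 6 * Real.cosh tc * ((1 + (x ^ 2 + z ^ 2)) *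
      Real.exp (-cW τ.im * (x ^ 2 + z ^ 2))) := by
  have ht : |t| ≤ tc := abs_le.2 ht
  rw [norm_mul, norm_real, Real.norm_eq_abs, ← mul_assoc]
  exact mul_le_mul (abs_uT_le ht x z) (norm_gker_le ht x z hτ) (norm_nonneg _) (by
    have := Real.cosh_pos tc; positivity)

lemma norm_W_le (x z : ℝ) {τ : ℂ} (hτ : 0 < τ.im) :
    ‖W x z τ‖ ≤ 2 * √2 * √τ.im * (6 * Real.cosh tc * ((1 + (x ^ 2 + z ^ 2)) *
      Real.exp (-cW τ.im * (x ^ 2 + z ^ 2))) * (2 * tc)) := by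
  rw [W_eq_integral x z hτ, norm_mul]
  have h := intervalIntegral.norm_integral_le_of_norm_le_const (a := -tc) (b := tc)
    (f := fun t => (uT t x z : ℂ) * gker t x z τ) fun t ht => norm_uT_mul_gker_le (by
      rw [Set.uIoc_of_le (by linarith [tc_nonneg])] at ht; exact ⟨ht.1.le, ht.2⟩) x z hτ
  rw [sub_neg_eq_add, ← two_mul, abs_of_nonneg (by linarith [tc_nonneg])] at h
  have h2 : ‖(2 * √2 * √τ.im : ℂ)‖ = 2 * √2 * √τ.im := by
    rw [norm_mul, norm_mul, norm_real, norm_real]; simp [abs_of_nonneg]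
  rw [h2]
  gcongr

lemma GaussSummable.norm_W {ι : Type*} {x z : ι → ℝ} (h : GaussSummable x z) {τ : ℂ}
    (hτ : 0 < τ.im) : Summable fun p => ‖W (x p) (z p) τ‖ := by
  refine Summable.of_nonneg_of_le (fun _ => norm_nonneg _) (fun p => norm_W_le _ _ hτ) ?_
  exact (((h.one_add (cW_pos hτ)).mul_left _).mul_right _).mul_left _

lemma GaussSummable.W_mul {ι : Type*} {x z : ι → ℝ} (h : GaussSummable x z) {τ : ℂ}
    (hτ : 0 < τ.im) {χ : ι → ℂ} (hχ : ∀ p, ‖χ p‖ ≤ 1) :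
    Summable fun p => W (x p) (z p) τ * χ p := by
  refine Summable.of_norm_bounded (h.norm_W hτ) fun p => ?_
  rw [norm_mul]
  exact mul_le_of_le_one_right (norm_nonneg _) (hχ p)

lemma theta5_eq (a₁ a₂ b₁ b₂ : ℝ) (τ : ℂ) :
    theta5 ![a₁, a₂] ![b₁, b₂] τ = ∑' p : ℤ × ℤ, W (a₁ + p.1) (a₂ + p.2) τ *
      e (5 * (a₁ + p.1) * b₁ - 2 * (a₂ + p.2) * b₂) := by
  rw [theta5, theta, ← (finTwoArrowEquiv ℤ).symm.tsum_eq]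
  refine tsum_congr fun p => ?_
  have q1 : quad !![5, 0; 0, -2] ![2, 5] = -15 := by
    simp [quad, bilin, Matrix.mulVec, dotProduct, Fin.sum_univ_two]; norm_num
  have q2 : quad !![5, 0; 0, -2] ![-2, 5] = -15 := by
    simp [quad, bilin, Matrix.mulVec, dotProduct, Fin.sum_univ_two]; norm_num
  have hv : (fun i => ![a₁, a₂] i + (((finTwoArrowEquiv ℤ).symm p i : ℤ) : ℝ)) =
      ![a₁ + p.1, a₂ + p.2] := by
    ext i; fin_cases i <;> simp
  rw [hv, rho, rho, q1, q2, if_pos (by norm_num), if_pos (by norm_num), W, e, neg_neg]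
  conv_rhs => rw [mul_assoc, ← Complex.exp_add]
  congr 2
  -- B(c₂, ν) = -10(x + z), so oddness of E turns the difference into the sum in `W`.
  · rw [sub_eq_add_neg, ← E_neg]
    congr 2
    · simp [bilin, Matrix.mulVec, dotProduct, Fin.sum_univ_two, kap]; left; ring
    · simp [bilin, Matrix.mulVec, dotProduct, Fin.sum_univ_two, kap]; ring
  · simp [quad, bilin, Matrix.mulVec, dotProduct, Fin.sum_univ_two]; ring

/-! ### Two-dimensional theta series: the inversion formula -/

/-- The witness is determinant over trace, a lower bound for the smaller eigenvalue. -/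
lemma le_quadratic_form {A F D : ℝ} (hD : 0 < D) (hdet : F ^ 2 < A * D) :
    ∃ c > 0, ∀ x z : ℝ, c * (x ^ 2 + z ^ 2) ≤ A * x ^ 2 + 2 * F * x * z + D * z ^ 2 := by
  have hA : 0 < A := by
    by_contra h
    nlinarith [sq_nonneg F]
  refine ⟨(A * D - F ^ 2) / (A + D), div_pos (by linarith) (by linarith), fun x z => ?_⟩
  set c := (A * D - F ^ 2) / (A + D)
  have hc : c * (A + D) = A * D - F ^ 2 := div_mul_cancel₀ _ (by linarith)
  have hAc : 0 < A - c := by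
    have : c * (A + D) < A * (A + D) := by nlinarith [sq_nonneg F]
    have := lt_of_mul_lt_mul_right this (by linarith)
    linarith
  have h : 0 ≤ (A - c) * ((A - c) * x ^ 2 + 2 * F * x * z + (D - c) * z ^ 2) := by
    have : (A - c) * ((A - c) * x ^ 2 + 2 * F * x * z + (D - c) * z ^ 2) =
        ((A - c) * x + F * z) ^ 2 + c ^ 2 * z ^ 2 := by linear_combination -(z ^ 2) * hc
    rw [this]; positivity
  have := nonneg_of_mul_nonneg_right h hAc
  linarith

lemma summable_cexp_quadratic {α β δ : ℂ} (hδ : 0 < δ.im) (hdet : β.im ^ 2 < α.im * δ.im)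
    (z₁ z₂ : ℂ) :
    Summable fun p : ℤ × ℤ => Complex.exp (Real.pi * I * (α * (p.1 : ℂ) ^ 2 +
      2 * β * p.1 * p.2 + δ * (p.2 : ℂ) ^ 2) + 2 * Real.pi * I * (p.1 * z₁ + p.2 * z₂)) := by
  obtain ⟨c, hc, h⟩ := le_quadratic_form hδ hdet
  refine Summable.of_norm_bounded (summable_exp_neg_sq_add_abs_prod (mul_pos Real.pi_pos hc)
    (2 * Real.pi * (|z₁.im| + |z₂.im|))) fun p => ?_
  rw [Complex.norm_exp, Real.exp_le_exp]
  have hre : (Real.pi * I * (α * (p.1 : ℂ) ^ 2 + 2 * β * p.1 * p.2 + δ * (p.2 : ℂ) ^ 2) +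
      2 * Real.pi * I * (p.1 * z₁ + p.2 * z₂)).re = -Real.pi * (α.im * (p.1 : ℝ) ^ 2 +
      2 * β.im * p.1 * p.2 + δ.im * (p.2 : ℝ) ^ 2) +
      2 * Real.pi * (-(p.1 * z₁.im) + -(p.2 * z₂.im)) := by
    simp [pow_two]
    ring
  rw [hre]
  have h1 := h p.1 p.2
  have h2 : -((p.1 : ℝ) * z₁.im) ≤ |(p.1 : ℝ)| * |z₁.im| := by
    rw [← abs_mul]; exact neg_le_abs _
  have h3 : -((p.2 : ℝ) * z₂.im) ≤ |(p.2 : ℝ)| * |z₂.im| := by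
    rw [← abs_mul]; exact neg_le_abs _
  have h4 : 0 ≤ |(p.1 : ℝ)| * |z₂.im| := by positivity
  have h5 : 0 ≤ |(p.2 : ℝ)| * |z₁.im| := by positivity
  have h6 : -((p.1 : ℝ) * z₁.im) + -((p.2 : ℝ) * z₂.im) ≤
      (|z₁.im| + |z₂.im|) * (|(p.1 : ℝ)| + |(p.2 : ℝ)|) := by nlinarith
  have h7 := mul_le_mul_of_nonneg_left h1 Real.pi_pos.le
  have h8 := mul_le_mul_of_nonneg_left h6 Real.pi_pos.le
  linarith

lemma tsum_cexp_quadratic {δ : ℂ} (hδ : 0 < δ.im) (w : ℂ) :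
    ∑' m : ℤ, Complex.exp (Real.pi * I * δ * (m : ℂ) ^ 2 + 2 * Real.pi * I * m * w) =
      1 / (-I * δ) ^ (1 / 2 : ℂ) *
        ∑' m : ℤ, Complex.exp (-(Real.pi * I * (w + m) ^ 2 / δ)) := by
  have hδ0 : δ ≠ 0 := by rintro rfl; simp at hδ
  have h := Complex.tsum_exp_neg_quadratic (a := -I * δ) (by simpa using hδ) (I * w)
  rw [← (Equiv.neg ℤ).tsum_eq fun m : ℤ => Complex.exp (-(Real.pi * I * (w + m) ^ 2 / δ))]
  convert h using 3 with m
  · congr 1; ring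
  · ext m
    congr 1
    simp only [Equiv.neg_apply, Int.cast_neg]
    have h1 : I * (I * w) = -w := by rw [← mul_assoc, I_mul_I]; ring
    have h2 : -(Real.pi : ℂ) / (-I * δ) = -(Real.pi * I / δ) := by
      field_simp
      rw [I_sq, neg_neg]
    rw [h1, h2]
    ring

/-- Poisson summation one variable at a time. The inner sum over the second index inverts δ and
leaves α - β²/δ as the quadratic coefficient of the first; the sums are exchanged and the first
index is inverted. -/
lemma tsum_cexp_quadratic_prod {α β δ : ℂ} (hδ : 0 < δ.im) (hdet : β.im ^ 2 < α.im * δ.im)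
    (z₁ z₂ : ℂ) :
    ∑' p : ℤ × ℤ, Complex.exp (Real.pi * I * (α * (p.1 : ℂ) ^ 2 +
      2 * β * p.1 * p.2 + δ * (p.2 : ℂ) ^ 2) + 2 * Real.pi * I * (p.1 * z₁ + p.2 * z₂)) =
    1 / (-I * δ) ^ (1 / 2 : ℂ) * (1 / (-I * (α - β ^ 2 / δ)) ^ (1 / 2 : ℂ)) *
      ∑' m₂ : ℤ, ∑' m₁ : ℤ, Complex.exp (-(Real.pi * I * ((z₂ + m₂) ^ 2 / δ +
        (z₁ - β * (z₂ + m₂) / δ + m₁) ^ 2 / (α - β ^ 2 / δ)))) := by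
  have hδ0 : δ ≠ 0 := by rintro rfl; simp at hδ
  have hn : 0 < normSq δ := normSq_pos.2 hδ0
  -- The half-inverted double series has the coefficients (α - β²/δ, -β/δ, -1/δ). The determinant of
  -- their imaginary part is the old one divided by |δ|², hence positive; this is the absolute
  -- convergence behind the exchange of sums.
  have hdet' : (β / δ).im ^ 2 + (α.im * δ.im - β.im ^ 2) / normSq δ =
      (α - β ^ 2 / δ).im * (-1 / δ).im := by
    have h1 : (-1 / δ).im = δ.im / normSq δ := by simp [div_im]; ring
    have h2 : (β / δ).im = (β.im * δ.re - β.re * δ.im) / normSq δ := by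
      simp [div_im]; ring
    have h3 : (α - β ^ 2 / δ).im = α.im - (2 * β.re * β.im * δ.re -
        (β.re ^ 2 - β.im ^ 2) * δ.im) / normSq δ := by
      simp [div_im, pow_two]; ring
    rw [h1, h2, h3]
    have : normSq δ = δ.re ^ 2 + δ.im ^ 2 := by rw [normSq_apply]; ring
    field_simp
    rw [this]
    ring
  have hδ' : 0 < (-1 / δ).im := by
    have h1 : (-1 / δ).im = δ.im / normSq δ := by simp [div_im]; ring
    rw [h1]; positivity
  have hdet'' : (β / δ).im ^ 2 < (α - β ^ 2 / δ).im * (-1 / δ).im := by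
    rw [← hdet']
    have : 0 < (α.im * δ.im - β.im ^ 2) / normSq δ := div_pos (by linarith) hn
    linarith
  have hα' : 0 < (α - β ^ 2 / δ).im := by
    by_contra h
    nlinarith [sq_nonneg (β / δ).im]
  have hs := summable_cexp_quadratic (α := α - β ^ 2 / δ) (β := -(β / δ)) (δ := -1 / δ)
    hδ' (by rwa [neg_im, neg_sq]) (z₁ - β * z₂ / δ) (-z₂ / δ)
  have hterm (n m : ℤ) : Complex.exp (Real.pi * I * α * (n : ℂ) ^ 2 + 2 * Real.pi * I * n * z₁) *
      Complex.exp (-(Real.pi * I * (z₂ + β * n + m) ^ 2 / δ)) =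
      Complex.exp (-(Real.pi * I * ((z₂ + m) ^ 2 / δ))) *
        Complex.exp (Real.pi * I * (α - β ^ 2 / δ) * (n : ℂ) ^ 2 +
          2 * Real.pi * I * n * (z₁ - β * (z₂ + m) / δ)) := by
    rw [← Complex.exp_add, ← Complex.exp_add]
    congr 1
    field_simp
    ring
  have hs2 : Summable (Function.uncurry fun n m : ℤ =>
      Complex.exp (-(Real.pi * I * ((z₂ + m) ^ 2 / δ))) *
        Complex.exp (Real.pi * I * (α - β ^ 2 / δ) * (n : ℂ) ^ 2 +
          2 * Real.pi * I * n * (z₁ - β * (z₂ + m) / δ))) := by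
    refine (hs.mul_left (Complex.exp (-(Real.pi * I * (z₂ ^ 2 / δ))))).congr fun p => ?_
    simp only [Function.uncurry]
    rw [← Complex.exp_add, ← Complex.exp_add]
    congr 1
    field_simp
    ring
  rw [(summable_cexp_quadratic hδ hdet z₁ z₂).tsum_prod]
  calc _ = ∑' n : ℤ, 1 / (-I * δ) ^ (1 / 2 : ℂ) * ∑' m : ℤ,
        Complex.exp (-(Real.pi * I * ((z₂ + m) ^ 2 / δ))) *
        Complex.exp (Real.pi * I * (α - β ^ 2 / δ) * (n : ℂ) ^ 2 +
          2 * Real.pi * I * n * (z₁ - β * (z₂ + m) / δ)) := by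
        refine tsum_congr fun n => ?_
        simp only [← hterm]
        rw [tsum_mul_left, mul_left_comm, ← tsum_cexp_quadratic hδ, ← tsum_mul_left]
        refine tsum_congr fun m => ?_
        rw [← Complex.exp_add]
        congr 1
        ring
    _ = _ := by
        rw [tsum_mul_left, ← hs2.tsum_comm, mul_assoc (1 / (-I * δ) ^ (1 / 2 : ℂ))]
        congr 1
        rw [← tsum_mul_left]
        refine tsum_congr fun m => ?_
        rw [tsum_mul_left, tsum_cexp_quadratic hα', mul_left_comm, ← tsum_mul_left]
        congr 1
        refine tsum_congr fun n => ?_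
        rw [← Complex.exp_add]
        congr 1
        ring

/-- Both arguments lie in (-π/2, π/2), so their sum does not reach the cut and principal roots
multiply. This evaluates the two roots left over from Poisson summation without a sign ambiguity. -/
lemma cpow_half_mul_cpow_half {a b : ℂ} (ha : 0 < a.re) (hb : 0 < b.re) {r : ℝ} (hr : 0 < r)
    (h : a * b = (r : ℂ) ^ 2) : a ^ (1 / 2 : ℂ) * b ^ (1 / 2 : ℂ) = r := by
  have ha0 : a ≠ 0 := by rintro rfl; simp at ha
  have hb0 : b ≠ 0 := by rintro rfl; simp at hb
  have h1 := abs_lt.1 (abs_arg_lt_pi_div_two_iff.2 (Or.inl ha))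
  have h2 := abs_lt.1 (abs_arg_lt_pi_div_two_iff.2 (Or.inl hb))
  have hl : log (a * b) = log a + log b :=
    (log_mul_eq_add_log_iff ha0 hb0).2 ⟨by linarith, by linarith⟩
  rw [cpow_def_of_ne_zero ha0, cpow_def_of_ne_zero hb0, ← Complex.exp_add, ← add_mul, ← hl,
    ← cpow_def_of_ne_zero (mul_ne_zero ha0 hb0), h, ← ofReal_pow,
    show (1 / 2 : ℂ) = ((1 / 2 : ℝ) : ℂ) by push_cast; rfl, ← ofReal_cpow (by positivity),
    ← Real.sqrt_eq_rpow, Real.sqrt_sq hr.le]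

lemma sub_sq_div_im_pos {α β δ : ℂ} (hδ : 0 < δ.im) (hdet : β.im ^ 2 < α.im * δ.im) {d : ℝ}
    (hd : 0 < d) (hD : α * δ - β ^ 2 = -(d : ℂ) ^ 2) : 0 < (α - β ^ 2 / δ).im := by
  have hδ0 : δ ≠ 0 := by rintro rfl; simp at hδ
  have h : α - β ^ 2 / δ = -(d : ℂ) ^ 2 / δ := by
    rw [← hD]; field_simp
  have hn : 0 < normSq δ := normSq_pos.2 hδ0
  rw [h, show (-(d : ℂ) ^ 2 / δ).im = d ^ 2 * δ.im / normSq δ by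
    rw [← ofReal_pow, ← ofReal_neg, div_eq_mul_inv, im_ofReal_mul, inv_im]; ring]
  positivity

/-- Inversion formula for two-dimensional theta series with characteristics. -/
lemma tsum_cexp_quadratic_char {α β δ : ℂ} (hδ : 0 < δ.im) (hdet : β.im ^ 2 < α.im * δ.im) {d : ℝ}
    (hd : 0 < d) (hD : α * δ - β ^ 2 = -(d : ℂ) ^ 2) (a₁ a₂ w₁ w₂ : ℂ) :
    ∑' p : ℤ × ℤ, Complex.exp (Real.pi * I * (α * (a₁ + p.1) ^ 2 +
      2 * β * (a₁ + p.1) * (a₂ + p.2) + δ * (a₂ + p.2) ^ 2) +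
        2 * Real.pi * I * ((a₁ + p.1) * w₁ + (a₂ + p.2) * w₂)) =
    1 / d * ∑' p : ℤ × ℤ, Complex.exp (Real.pi * I * ((δ * (w₁ + p.1) ^ 2 -
      2 * β * (w₁ + p.1) * (w₂ + p.2) + α * (w₂ + p.2) ^ 2) / (d : ℂ) ^ 2) -
        2 * Real.pi * I * (a₁ * p.1 + a₂ * p.2)) := by
  have hδ0 : δ ≠ 0 := by rintro rfl; simp at hδ
  have hd0 : (d : ℂ) ≠ 0 := ofReal_ne_zero.2 hd.ne'
  have hα' := sub_sq_div_im_pos hδ hdet hd hD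
  have h' : α - β ^ 2 / δ = -(d : ℂ) ^ 2 / δ := by
    rw [← hD]; field_simp
  set c := Complex.exp (Real.pi * I * (α * a₁ ^ 2 + 2 * β * a₁ * a₂ + δ * a₂ ^ 2) +
    2 * Real.pi * I * (a₁ * w₁ + a₂ * w₂)) with hc
  have h := tsum_cexp_quadratic_prod hδ hdet (α * a₁ + β * a₂ + w₁) (β * a₁ + δ * a₂ + w₂)
  have hroot : (1 / (-I * δ) ^ (1 / 2 : ℂ)) * (1 / (-I * (α - β ^ 2 / δ)) ^ (1 / 2 : ℂ)) = 1 / d := by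
    rw [one_div_mul_one_div, cpow_half_mul_cpow_half (by simpa using hδ) (by simpa using hα') hd]
    rw [h']
    field_simp
    rw [I_sq]; ring
  rw [hroot] at h
  have hL : ∀ p : ℤ × ℤ, Complex.exp (Real.pi * I * (α * (a₁ + p.1) ^ 2 +
      2 * β * (a₁ + p.1) * (a₂ + p.2) + δ * (a₂ + p.2) ^ 2) +
        2 * Real.pi * I * ((a₁ + p.1) * w₁ + (a₂ + p.2) * w₂)) =
      c * Complex.exp (Real.pi * I * (α * (p.1 : ℂ) ^ 2 +
      2 * β * p.1 * p.2 + δ * (p.2 : ℂ) ^ 2) + 2 * Real.pi * I *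
        (p.1 * (α * a₁ + β * a₂ + w₁) + p.2 * (β * a₁ + δ * a₂ + w₂))) := fun p => by
    rw [hc, ← Complex.exp_add]
    congr 1
    ring
  have hsum : Summable fun p : ℤ × ℤ => Complex.exp (Real.pi * I * ((δ * (w₁ + p.1) ^ 2 -
      2 * β * (w₁ + p.1) * (w₂ + p.2) + α * (w₂ + p.2) ^ 2) / (d : ℂ) ^ 2) -
        2 * Real.pi * I * (a₁ * p.1 + a₂ * p.2)) := by
    have him (w : ℂ) : (w / (d : ℂ) ^ 2).im = w.im / d ^ 2 := by
      rw [← ofReal_pow, div_ofReal_im]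
    have hα : 0 < α.im := by
      by_contra h
      nlinarith [sq_nonneg β.im]
    have hs := summable_cexp_quadratic (α := δ / (d : ℂ) ^ 2) (β := -β / (d : ℂ) ^ 2)
      (δ := α / (d : ℂ) ^ 2) (by rw [him]; positivity) (by
        rw [him, him, him, neg_im, div_pow, div_mul_div_comm, neg_sq, ← pow_two]
        gcongr ?_ / _
        linarith) ((δ * w₁ - β * w₂) / (d : ℂ) ^ 2 - a₁) ((-β * w₁ + α * w₂) / (d : ℂ) ^ 2 - a₂)
    refine (hs.mul_left (Complex.exp (Real.pi * I * ((δ * w₁ ^ 2 - 2 * β * w₁ * w₂ + α * w₂ ^ 2) /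
      (d : ℂ) ^ 2)))).congr fun p => ?_
    rw [← Complex.exp_add]
    congr 1
    field_simp
    ring
  simp_rw [hL]
  rw [tsum_mul_left, h, mul_left_comm]
  congr 1
  have hsum' := (Equiv.prodComm ℤ ℤ).summable_iff.2 hsum
  rw [← (Equiv.prodComm ℤ ℤ).tsum_eq]
  refine Eq.trans ?_ hsum'.tsum_prod.symm
  rw [← tsum_mul_left]
  refine tsum_congr fun m₂ => ?_
  rw [← tsum_mul_left]
  refine tsum_congr fun m₁ => ?_
  simp only [Function.comp_apply, Equiv.prodComm_apply, Prod.swap_prod_mk]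
  rw [hc, ← Complex.exp_add, h']
  congr 1
  have hα : α = (β ^ 2 - (d : ℂ) ^ 2) / δ := by
    field_simp; linear_combination hD
  rw [hα]
  field_simp
  ring

/-! ### Rotated coordinates -/

/-- `uT` with complex arguments. -/
def uC (t : ℝ) (x z : ℂ) : ℂ := √5 * Real.cosh t * x - √2 * Real.sinh t * z

/-- `vT` with complex arguments. -/
def vC (t : ℝ) (x z : ℂ) : ℂ := √2 * Real.cosh t * z - √5 * Real.sinh t * x

lemma ofReal_uT (t x z : ℝ) : (uT t x z : ℂ) = uC t x z := by
  simp only [uT, uC]; push_cast; rfl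

lemma ofReal_vT (t x z : ℝ) : (vT t x z : ℂ) = vC t x z := by
  simp only [vT, vC]; push_cast; rfl

/-- Rotation by t has determinant one, so the discriminant of u²τ - v²τ̄ is -10|τ|² for every t. The
inverse of the Gram matrix diag(5, -2) sends (w₁, w₂) to (w₁/5, -w₂/2), and in these coordinates the
dual form is the same rotated form at -1/τ. -/
lemma tsum_cexp_rotated (t : ℝ) {τ : ℂ} (hτ : 0 < τ.im) (a₁ a₂ w₁ w₂ : ℂ) :
    ∑' p : ℤ × ℤ, Complex.exp (Real.pi * I * (uC t (a₁ + p.1) (a₂ + p.2) ^ 2 * τ -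
      vC t (a₁ + p.1) (a₂ + p.2) ^ 2 * conj τ) +
        2 * Real.pi * I * ((a₁ + p.1) * w₁ + (a₂ + p.2) * w₂)) =
    1 / (√10 * ‖τ‖ : ℝ) * ∑' p : ℤ × ℤ, Complex.exp (Real.pi * I *
      (uC t ((w₁ + p.1) / 5) (-(w₂ + p.2) / 2) ^ 2 * (-1 / τ) -
        vC t ((w₁ + p.1) / 5) (-(w₂ + p.2) / 2) ^ 2 * conj (-1 / τ)) -
        2 * Real.pi * I * (a₁ * p.1 + a₂ * p.2)) := by
  have h0 : τ ≠ 0 := by rintro rfl; simp at hτ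
  have h0' : conj τ ≠ 0 := (map_ne_zero _).2 h0
  have h5 : (√5 : ℂ) ^ 2 = 5 := by exact_mod_cast Real.sq_sqrt (show (0 : ℝ) ≤ 5 by norm_num)
  have h2 : (√2 : ℂ) ^ 2 = 2 := by exact_mod_cast Real.sq_sqrt (show (0 : ℝ) ≤ 2 by norm_num)
  have h10 : (√10 : ℂ) ^ 2 = 10 := by exact_mod_cast Real.sq_sqrt (show (0 : ℝ) ≤ 10 by norm_num)
  have hn : (‖τ‖ : ℂ) ^ 2 = τ * conj τ := by rw [mul_conj, ← ofReal_pow, normSq_eq_norm_sq]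
  set ch := Real.cosh t with hch
  set sh := Real.sinh t with hsh
  have hcs : ch ^ 2 = sh ^ 2 + 1 := Real.cosh_sq t
  have hcsC : (ch : ℂ) ^ 2 = (sh : ℂ) ^ 2 + 1 := by exact_mod_cast congrArg (fun r : ℝ => (r : ℂ)) hcs
  set α : ℂ := 5 * ((ch ^ 2 : ℝ) * τ - (sh ^ 2 : ℝ) * conj τ) with hα
  set β : ℂ := (√5 * √2 * ch * sh : ℝ) * (conj τ - τ) with hβ
  set δ : ℂ := 2 * ((sh ^ 2 : ℝ) * τ - (ch ^ 2 : ℝ) * conj τ) with hδ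
  have iα : α.im = 5 * ((ch ^ 2 + sh ^ 2) * τ.im) := by
    simp only [hα, mul_im, sub_im, sub_re, mul_re, ofReal_re, ofReal_im, conj_im, conj_re, re_ofNat, im_ofNat]; ring
  have iβ : β.im = -2 * (√5 * √2 * ch * sh) * τ.im := by
    simp only [hβ, mul_im, sub_im, sub_re, ofReal_re, ofReal_im, conj_im, conj_re]; ring
  have iδ : δ.im = 2 * ((ch ^ 2 + sh ^ 2) * τ.im) := by
    simp only [hδ, mul_im, sub_im, sub_re, mul_re, ofReal_re, ofReal_im, conj_im, conj_re, re_ofNat, im_ofNat]; ring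
  have hδp : 0 < δ.im := by
    rw [iδ, hcs]; positivity
  have hdet : β.im ^ 2 < α.im * δ.im := by
    have h5 : √5 ^ 2 = 5 := Real.sq_sqrt (by norm_num)
    have h2 : √2 ^ 2 = 2 := Real.sq_sqrt (by norm_num)
    rw [iα, iβ, iδ, ← sub_pos]
    have : 5 * ((ch ^ 2 + sh ^ 2) * τ.im) * (2 * ((ch ^ 2 + sh ^ 2) * τ.im)) -
        (-2 * (√5 * √2 * ch * sh) * τ.im) ^ 2 = 10 * τ.im ^ 2 := by
      have e1 : (√5 * √2 * ch * sh) ^ 2 = 10 * (ch ^ 2 * sh ^ 2) := by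
        rw [mul_pow, mul_pow, mul_pow, h5, h2]; ring
      have e2 : (-2 * (√5 * √2 * ch * sh) * τ.im) ^ 2 =
          4 * (√5 * √2 * ch * sh) ^ 2 * τ.im ^ 2 := by ring
      rw [e2, e1, hcs]; ring
    rw [this]; positivity
  have hD : α * δ - β ^ 2 = -((√10 * ‖τ‖ : ℝ) : ℂ) ^ 2 := by
    rw [hα, hβ, hδ]
    push_cast
    rw [mul_pow (√10 : ℂ), h10, hn]
    have e1 : ((√5 : ℂ) * √2 * ch * sh * (conj τ - τ)) ^ 2 =
        10 * ((ch : ℂ) ^ 2 * (sh : ℂ) ^ 2) * (conj τ - τ) ^ 2 := by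
      rw [mul_pow, mul_pow, mul_pow, mul_pow, h5, h2]; ring
    rw [e1, hcsC]; ring
  have key := tsum_cexp_quadratic_char hδp hdet (d := √10 * ‖τ‖)
    (mul_pos (by positivity) (norm_pos_iff.2 h0)) hD a₁ a₂ w₁ w₂
  have hq (x z : ℂ) : uC t x z ^ 2 * τ - vC t x z ^ 2 * conj τ =
      α * x ^ 2 + 2 * β * x * z + δ * z ^ 2 := by
    simp only [uC, vC, hα, hβ, hδ, ← hch, ← hsh]
    push_cast
    linear_combination (x ^ 2 * (ch ^ 2 * τ - sh ^ 2 * conj τ)) * h5 +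
      (z ^ 2 * (sh ^ 2 * τ - ch ^ 2 * conj τ)) * h2
  have hq' (x z : ℂ) : uC t (x / 5) (-z / 2) ^ 2 * (-1 / τ) - vC t (x / 5) (-z / 2) ^ 2 * conj (-1 / τ) =
      (δ * x ^ 2 - 2 * β * x * z + α * z ^ 2) / (((√10 * ‖τ‖ : ℝ) : ℂ) ^ 2) := by
    push_cast
    rw [mul_pow (√10 : ℂ), h10, hn, map_div₀, map_neg, map_one]
    simp only [uC, vC, hα, hβ, hδ, ← hch, ← hsh]
    push_cast
    field_simp
    linear_combination (-8 * x ^ 2 * (5 * ch ^ 2 * conj τ - 5 * sh ^ 2 * τ)) * h5 -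
      (25 * z ^ 2 * (10 * sh ^ 2 * conj τ - 10 * ch ^ 2 * τ)) * h2
  simp only [hq, hq']
  exact key

/-! ### The inversion formula for the indefinite theta functions -/

lemma norm_gker_mul_cexp_le (t x z : ℝ) {τ : ℂ} (hτ : 0 < τ.im) (K : ℂ) {s : ℂ} (hs : ‖s‖ ≤ 1) :
    ‖gker t x z τ * Complex.exp (s * (K * uT t x z))‖ ≤
      Real.exp (‖K‖ ^ 2 / (2 * (Real.pi * τ.im))) *
        Real.exp (-(Real.pi * τ.im / 2 * Real.exp (-2 * |t|)) * (x ^ 2 + z ^ 2)) := by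
  have hc : 0 < Real.pi * τ.im := by positivity
  set c := Real.pi * τ.im
  have h1 : ‖Complex.exp (s * (K * uT t x z))‖ ≤ Real.exp (‖K‖ * |uT t x z|) := by
    refine (Complex.norm_exp_le_exp_norm _).trans (Real.exp_le_exp.2 ?_)
    rw [norm_mul, norm_mul, norm_real, Real.norm_eq_abs]
    exact mul_le_of_le_one_left (by positivity) hs
  rw [norm_mul, norm_gker]
  refine (mul_le_mul_of_nonneg_left h1 (Real.exp_pos _).le).trans ?_
  rw [← Real.exp_add, ← Real.exp_add, Real.exp_le_exp]
  have h2 := mul_le_mul_of_nonneg_left (le_uT_sq_add_vT_sq (le_refl |t|) x z) (half_pos hc).le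
  have h3 : ‖K‖ * |uT t x z| ≤ c / 2 * uT t x z ^ 2 + ‖K‖ ^ 2 / (2 * c) := by
    have h4 : c / 2 * uT t x z ^ 2 + ‖K‖ ^ 2 / (2 * c) - ‖K‖ * |uT t x z| =
        (c * |uT t x z| - ‖K‖) ^ 2 / (2 * c) := by
      rw [← sq_abs (uT t x z)]; field_simp; ring
    have : 0 ≤ (c * |uT t x z| - ‖K‖) ^ 2 / (2 * c) := by positivity
    linarith
  have h5 : 0 ≤ c / 2 * vT t x z ^ 2 := by positivity
  have h6 : -Real.pi * τ.im = -c := by simp [c]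
  rw [h6]
  linarith

lemma GaussSummable.hasDerivAt_tsum_gker {ι : Type*} {x z : ι → ℝ} (h : GaussSummable x z) (t : ℝ)
    {τ : ℂ} (hτ : 0 < τ.im) {χ : ι → ℂ} (hχ : ∀ p, ‖χ p‖ ≤ 1) (K : ℂ) :
    HasDerivAt (fun s : ℂ => ∑' p, χ p * (gker t (x p) (z p) τ *
        Complex.exp (s * (K * uT t (x p) (z p)))))
      (∑' p, χ p * (gker t (x p) (z p) τ * (K * uT t (x p) (z p)))) 0 := by
  have hu := (h (Real.pi * τ.im / 2 * Real.exp (-2 * |t|)) (by positivity)).mul_left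
    (Real.exp (‖K‖ ^ 2 / (2 * (Real.pi * τ.im))))
  have hle (p : ι) (s : ℂ) (hs : s ∈ Metric.ball (0 : ℂ) 1) : ‖χ p * (gker t (x p) (z p) τ *
        Complex.exp (s * (K * uT t (x p) (z p))))‖ ≤
      Real.exp (‖K‖ ^ 2 / (2 * (Real.pi * τ.im))) *
        Real.exp (-(Real.pi * τ.im / 2 * Real.exp (-2 * |t|)) * (x p ^ 2 + z p ^ 2)) := by
    rw [norm_mul]
    exact (mul_le_of_le_one_left (norm_nonneg _) (hχ p)).trans
      (norm_gker_mul_cexp_le t (x p) (z p) hτ K (mem_ball_zero_iff.1 hs).le)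
  have hd (p : ι) : DifferentiableOn ℂ (fun s : ℂ => χ p * (gker t (x p) (z p) τ *
        Complex.exp (s * (K * uT t (x p) (z p))))) (Metric.ball (0 : ℂ) 1) := by fun_prop
  have h0 : (0 : ℂ) ∈ Metric.ball (0 : ℂ) 1 := by simp
  have h1 := hasSum_deriv_of_summable_norm hu hd Metric.isOpen_ball hle h0
  have h2 := (differentiableOn_tsum_of_summable_norm hu hd Metric.isOpen_ball hle).differentiableAt
    (Metric.isOpen_ball.mem_nhds h0) |>.hasDerivAt
  rw [← h1.tsum_eq] at h2
  refine h2.congr_deriv (tsum_congr fun p => ?_)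
  have h3 : HasDerivAt (fun s : ℂ => χ p * (gker t (x p) (z p) τ *
      Complex.exp (s * (K * uT t (x p) (z p))))) _ 0 :=
    ((((hasDerivAt_id (0 : ℂ)).mul_const (K * uT t (x p) (z p))).cexp).const_mul _).const_mul _
  rw [h3.deriv]
  simp

lemma gaussSummable_dual (w₁ w₂ : ℝ) :
    GaussSummable (fun p : ℤ × ℤ => (w₁ + p.1) / 5) (fun p : ℤ × ℤ => -(w₂ + p.2) / 2) := by
  intro c hc
  refine Summable.of_nonneg_of_le (fun _ => (Real.exp_pos _).le) (fun p => Real.exp_le_exp.2 ?_)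
    (summable_exp_neg_sq_shift (c := c / 25) (by positivity) w₁ w₂)
  have : 0 ≤ c * (w₂ + p.2) ^ 2 := by positivity
  ring_nf at this ⊢
  linarith

/-- The Gaussian inversion formula is differentiated at s = 0 along a one-parameter family of
characteristics. On the left the derivative brings down 2πi·u, on the right 2πi·(-1/τ)·u; this is
where the weight is raised by one. -/
lemma tsum_gker_mul_uT (t : ℝ) {τ : ℂ} (hτ : 0 < τ.im) (a₁ a₂ w₁ w₂ : ℝ) :
    ∑' p : ℤ × ℤ, e ((a₁ + p.1) * w₁ + (a₂ + p.2) * w₂) *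
      (gker t (a₁ + p.1) (a₂ + p.2) τ * uT t (a₁ + p.1) (a₂ + p.2)) =
    -1 / τ * (1 / (√10 * ‖τ‖ : ℝ)) * ∑' p : ℤ × ℤ, e (-(a₁ * p.1 + a₂ * p.2)) *
      (gker t ((w₁ + p.1) / 5) (-(w₂ + p.2) / 2) (-1 / τ) *
        uT t ((w₁ + p.1) / 5) (-(w₂ + p.2) / 2)) := by
  have hτ' : 0 < (-1 / τ).im := by
    have h0 : τ ≠ 0 := by rintro rfl; simp at hτ
    have : (-1 / τ).im = τ.im / normSq τ := by simp [div_im]; ring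
    rw [this]
    have := normSq_pos.2 h0
    positivity
  have hχ (p : ℤ × ℤ) : ‖e (((a₁ : ℂ) + p.1) * w₁ + (a₂ + p.2) * w₂)‖ ≤ 1 := by
    exact_mod_cast (norm_e_real ((a₁ + p.1) * w₁ + (a₂ + p.2) * w₂)).le
  have hχ' (p : ℤ × ℤ) : ‖e (-((a₁ : ℂ) * p.1 + a₂ * p.2))‖ ≤ 1 := by
    exact_mod_cast (norm_e_real (-(a₁ * p.1 + a₂ * p.2))).le
  have hL := (gaussSummable_shift a₁ a₂).hasDerivAt_tsum_gker t hτ hχ (2 * Real.pi * I)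
  have hR := (gaussSummable_dual w₁ w₂).hasDerivAt_tsum_gker t hτ' hχ' (2 * Real.pi * I * (-1 / τ))
  have hpre : HasDerivAt (fun s : ℂ => (1 / (√10 * ‖τ‖ : ℝ)) *
      Complex.exp (Real.pi * I * (-1 / τ) * s ^ 2)) 0 0 := by
    have : HasDerivAt (fun s : ℂ => (1 / ((√10 * ‖τ‖ : ℝ) : ℂ)) *
      Complex.exp (Real.pi * I * (-1 / τ) * s ^ 2)) _ 0 :=
      ((((hasDerivAt_id (0 : ℂ)).pow 2).const_mul _).cexp).const_mul _
    exact this.congr_deriv (by simp)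
  have hR' := hpre.mul hR
  have heq : (fun s : ℂ => ∑' p : ℤ × ℤ, e (((a₁ : ℂ) + p.1) * w₁ + (a₂ + p.2) * w₂) *
      (gker t (a₁ + p.1) (a₂ + p.2) τ *
        Complex.exp (s * (2 * Real.pi * I * uT t (a₁ + p.1) (a₂ + p.2))))) =
      fun s : ℂ => (1 / (√10 * ‖τ‖ : ℝ)) * Complex.exp (Real.pi * I * (-1 / τ) * s ^ 2) *
        ∑' p : ℤ × ℤ, e (-((a₁ : ℂ) * p.1 + a₂ * p.2)) *
      (gker t ((w₁ + p.1) / 5) (-(w₂ + p.2) / 2) (-1 / τ) *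
        Complex.exp (s * (2 * Real.pi * I * (-1 / τ) *
          uT t ((w₁ + p.1) / 5) (-(w₂ + p.2) / 2)))) := by
    ext s
    -- The shift of w is chosen so that its pairing with ν is s·u(ν). On the dual side it then adds
    -- s to u and leaves v fixed, so the only additional factor is exp(πi(-1/τ)s²), whose derivative
    -- at 0 vanishes.
    have key := tsum_cexp_rotated t hτ a₁ a₂ (w₁ + s * (√5 * Real.cosh t))
      (w₂ - s * (√2 * Real.sinh t))
    have h5 : (√5 : ℂ) ^ 2 = 5 := by exact_mod_cast Real.sq_sqrt (show (0 : ℝ) ≤ 5 by norm_num)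
    have h2 : (√2 : ℂ) ^ 2 = 2 := by exact_mod_cast Real.sq_sqrt (show (0 : ℝ) ≤ 2 by norm_num)
    have hcs : (Real.cosh t : ℂ) ^ 2 = (Real.sinh t : ℂ) ^ 2 + 1 := by
      exact_mod_cast congrArg (fun r : ℝ => (r : ℂ)) (Real.cosh_sq t)
    have hu (p : ℤ × ℤ) : uC t ((w₁ + s * (√5 * Real.cosh t) + p.1) / 5)
        (-(w₂ - s * (√2 * Real.sinh t) + p.2) / 2) =
        uC t ((w₁ + p.1) / 5) (-(w₂ + p.2) / 2) + s := by
      unfold uC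
      linear_combination (s * Real.cosh t ^ 2 / 5) * h5 - (s * Real.sinh t ^ 2 / 2) * h2 + s * hcs
    have hv (p : ℤ × ℤ) : vC t ((w₁ + s * (√5 * Real.cosh t) + p.1) / 5)
        (-(w₂ - s * (√2 * Real.sinh t) + p.2) / 2) =
        vC t ((w₁ + p.1) / 5) (-(w₂ + p.2) / 2) := by
      unfold vC
      linear_combination (-s * Real.cosh t * Real.sinh t / 5) * h5 +
        (s * Real.sinh t * Real.cosh t / 2) * h2
    simp only [hu, hv] at key
    refine Eq.trans (tsum_congr fun p => ?_) (key.trans ?_)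
    · rw [e, gker, ← Complex.exp_add, ← Complex.exp_add, ofReal_uT, ofReal_vT]
      congr 1
      unfold uC
      push_cast
      ring
    · rw [← tsum_mul_left, ← tsum_mul_left]
      refine tsum_congr fun p => ?_
      rw [mul_assoc (1 / ((√10 * ‖τ‖ : ℝ) : ℂ)), e, gker, ← Complex.exp_add, ← Complex.exp_add,
        ← Complex.exp_add, ofReal_uT, ofReal_vT]
      congr 2
      push_cast
      ring
  rw [heq] at hL
  have h := hL.unique hR'
  simp only [zero_mul, zero_add, ne_eq, OfNat.ofNat_ne_zero, not_false_eq_true, zero_pow, mul_zero,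
    Complex.exp_zero, mul_one] at h
  have hpi : (2 * Real.pi * I : ℂ) ≠ 0 := two_pi_I_ne_zero
  have h3 : ∀ c : ℂ, ∀ (A B : ℤ × ℤ → ℂ) (C : ℤ × ℤ → ℝ), ∑' p, A p * (B p * (c * C p)) =
      c * ∑' p, A p * (B p * C p) := fun c A B C => by
    rw [← tsum_mul_left]; exact tsum_congr fun p => by ring
  rw [h3, h3] at h
  refine mul_left_cancel₀ hpi (h.trans ?_)
  ring

lemma GaussSummable.tsum_W_mul {ι : Type*} [Countable ι] {x z : ι → ℝ} (h : GaussSummable x z)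
    {τ : ℂ} (hτ : 0 < τ.im) {χ : ι → ℂ} (hχ : ∀ p, ‖χ p‖ ≤ 1) :
    ∑' p, W (x p) (z p) τ * χ p = 2 * √2 * √τ.im *
      ∫ t in (-tc)..tc, ∑' p, χ p * (gker t (x p) (z p) τ * uT t (x p) (z p)) := by
  have hI : Set.uIoc (-tc) tc = Set.Ioc (-tc) tc := Set.uIoc_of_le (by linarith [tc_nonneg])
  set bound : ι → ℝ := fun p => 6 * Real.cosh tc * ((1 + (x p ^ 2 + z p ^ 2)) *
      Real.exp (-cW τ.im * (x p ^ 2 + z p ^ 2))) with hbound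
  have hb : Summable bound := (h.one_add (cW_pos hτ)).mul_left _
  have hle (p : ι) (t : ℝ) (ht : t ∈ Set.uIoc (-tc) tc) :
      ‖χ p * (gker t (x p) (z p) τ * uT t (x p) (z p))‖ ≤ bound p := by
    rw [hI] at ht
    rw [norm_mul, mul_comm (gker _ _ _ _)]
    exact (mul_le_of_le_one_left (norm_nonneg _) (hχ p)).trans
      (norm_uT_mul_gker_le ⟨ht.1.le, ht.2⟩ _ _ hτ)
  have hsum := intervalIntegral.hasSum_integral_of_dominated_convergence
    (μ := MeasureTheory.volume) (a := -tc) (b := tc)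
    (F := fun p t => χ p * (gker t (x p) (z p) τ * uT t (x p) (z p)))
    (f := fun t => ∑' p, χ p * (gker t (x p) (z p) τ * uT t (x p) (z p)))
    (fun p _ => bound p) (fun p => ?_) (fun p => Eventually.of_forall (hle p))
    (Eventually.of_forall fun _ _ => hb) (by simp) (Eventually.of_forall fun t ht =>
      (Summable.of_norm_bounded hb fun p => hle p t ht).hasSum)
  · rw [← hsum.tsum_eq, ← tsum_mul_left]
    refine tsum_congr fun p => ?_
    rw [intervalIntegral.integral_const_mul, W_eq_integral _ _ hτ]
    simp only [mul_comm (gker _ _ _ _)]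
    ring
  · refine Continuous.aestronglyMeasurable ?_
    have h1 := continuous_uT (x p) (z p)
    have h2 := continuous_gker (x p) (z p) τ
    fun_prop

lemma im_neg_one_div (τ : ℂ) : (-1 / τ).im = τ.im / ‖τ‖ ^ 2 := by
  rw [← normSq_eq_norm_sq]; simp [div_im]; ring

lemma im_neg_one_div_pos {τ : ℂ} (hτ : 0 < τ.im) : 0 < (-1 / τ).im := by
  have h0 : τ ≠ 0 := by rintro rfl; simp at hτ
  rw [im_neg_one_div]
  have := norm_pos_iff.2 h0
  positivity

/-- Inversion formula for indefinite theta series. -/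
lemma tsum_W_neg_one_div {τ : ℂ} (hτ : 0 < τ.im) (a₁ a₂ w₁ w₂ : ℝ) :
    ∑' p : ℤ × ℤ, W (a₁ + p.1) (a₂ + p.2) (-1 / τ) * e ((a₁ + p.1) * w₁ + (a₂ + p.2) * w₂) =
      τ / √10 * ∑' p : ℤ × ℤ, W ((w₁ + p.1) / 5) ((w₂ + p.2) / 2) τ *
        e (-(a₁ * p.1 + a₂ * p.2)) := by
  have h0 : τ ≠ 0 := by rintro rfl; simp at hτ
  have hn := norm_pos_iff.2 h0
  have hτ' := im_neg_one_div_pos hτ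
  have hχ (p : ℤ × ℤ) : ‖e (((a₁ : ℂ) + p.1) * w₁ + (a₂ + p.2) * w₂)‖ ≤ 1 := by
    exact_mod_cast (norm_e_real ((a₁ + p.1) * w₁ + (a₂ + p.2) * w₂)).le
  have hχ' (p : ℤ × ℤ) : ‖e (-((a₁ : ℂ) * p.1 + a₂ * p.2))‖ ≤ 1 := by
    exact_mod_cast (norm_e_real (-(a₁ * p.1 + a₂ * p.2))).le
  have hW (p : ℤ × ℤ) : W ((w₁ + p.1) / 5) ((w₂ + p.2) / 2) τ =
      W ((w₁ + p.1) / 5) (-(w₂ + p.2) / 2) τ := by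
    rw [neg_div, W_neg_right]
  simp only [hW]
  rw [(gaussSummable_shift a₁ a₂).tsum_W_mul hτ' hχ, (gaussSummable_dual w₁ w₂).tsum_W_mul hτ hχ']
  have hinv : -1 / (-1 / τ) = τ := by field_simp
  -- The powers of |τ| cancel: √Im(-1/τ) = √y/|τ|, while inversion applied at -1/τ contributes
  -- τ|τ|/√10.
  simp only [tsum_gker_mul_uT _ hτ', hinv]
  rw [intervalIntegral.integral_const_mul, im_neg_one_div, Real.sqrt_div hτ.le, Real.sqrt_sq hn.le,
    norm_div, norm_neg, norm_one]
  have h1 : (‖τ‖ : ℂ) ≠ 0 := ofReal_ne_zero.2 hn.ne'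
  have h2 : (√10 : ℂ) ≠ 0 := ofReal_ne_zero.2 (by positivity)
  push_cast
  field_simp

/-! ### The components of `H_{5,1}` and their transformation under the modular group -/

/-- The indefinite theta series with characteristic `(a, b)` and signs `(-1)^{k m + l n}`. -/
def Th (a b : ℝ) (k l : ℕ) (τ : ℂ) : ℂ :=
  ∑' p : ℤ × ℤ, W (a + p.1) (b + p.2) τ * (-1) ^ ((k : ℤ) * p.1 + (l : ℤ) * p.2)

lemma neg_one_zpow_eq_e (n : ℤ) : (-1 : ℂ) ^ n = e (n / 2) := (e_int_half n).symm

lemma neg_one_zpow_congr {m n j : ℤ} (h : m = n + 2 * j) : (-1 : ℂ) ^ m = (-1) ^ n := by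
  rw [h, add_comm, neg_one_zpow_even_add]

lemma summable_Th (a b : ℝ) (k l : ℕ) {τ : ℂ} (hτ : 0 < τ.im) : Summable fun p : ℤ × ℤ =>
    W (a + p.1) (b + p.2) τ * (-1) ^ ((k : ℤ) * p.1 + (l : ℤ) * p.2) :=
  (gaussSummable_shift a b).W_mul hτ fun _ => (norm_neg_one_zpow _).le

/-- Reflection of the lattice by m ↦ -1 - m, under which `W` is odd in the first coordinate.
Together with evenness in the second, such symmetries cut the residue classes after inversion down
to the components of `H51`. -/
lemma Th_one_sub_left (a b : ℝ) (k l : ℕ) (τ : ℂ) :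
    Th (1 - a) b k l τ = -(-1) ^ k * Th a b k l τ := by
  rw [Th, ← ((Equiv.subLeft (-1 : ℤ)).prodCongr (Equiv.refl ℤ)).tsum_eq, Th, ← tsum_mul_left]
  refine tsum_congr fun p => ?_
  simp only [Equiv.prodCongr_apply, Prod.map_fst, Prod.map_snd, Equiv.subLeft_apply,
    Equiv.refl_apply]
  rw [show (1 - a + ((-1 - p.1 : ℤ) : ℝ)) = -(a + p.1) by push_cast; ring, W_neg_left]
  have : (-1 : ℂ) ^ ((k : ℤ) * (-1 - p.1) + l * p.2) =
      (-1) ^ k * (-1) ^ ((k : ℤ) * p.1 + l * p.2) := by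
    rw [← zpow_natCast, ← zpow_add₀ (by simp)]
    exact neg_one_zpow_congr (j := -k * (1 + p.1)) (by ring)
  rw [this]
  ring

lemma Th_one_sub_right (a b : ℝ) (k l : ℕ) (τ : ℂ) :
    Th a (1 - b) k l τ = (-1) ^ l * Th a b k l τ := by
  rw [Th, ← ((Equiv.refl ℤ).prodCongr (Equiv.subLeft (-1 : ℤ))).tsum_eq, Th, ← tsum_mul_left]
  refine tsum_congr fun p => ?_
  simp only [Equiv.prodCongr_apply, Prod.map_fst, Prod.map_snd, Equiv.subLeft_apply,
    Equiv.refl_apply]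
  rw [show (1 - b + ((-1 - p.2 : ℤ) : ℝ)) = -(b + p.2) by push_cast; ring, W_neg_right]
  have : (-1 : ℂ) ^ ((k : ℤ) * p.1 + l * (-1 - p.2)) =
      (-1) ^ l * (-1) ^ ((k : ℤ) * p.1 + l * p.2) := by
    rw [← zpow_natCast, ← zpow_add₀ (by simp)]
    exact neg_one_zpow_congr (j := -l * (1 + p.2)) (by ring)
  rw [this]
  ring

lemma Th_zero_left (b : ℝ) (k l : ℕ) (τ : ℂ) : Th 0 b k l τ = 0 := by
  have : Th 0 b k l τ = -Th 0 b k l τ := by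
    nth_rw 1 [Th]
    rw [← ((Equiv.neg ℤ).prodCongr (Equiv.refl ℤ)).tsum_eq, Th, ← tsum_neg]
    refine tsum_congr fun p => ?_
    simp only [Equiv.prodCongr_apply, Prod.map_fst, Prod.map_snd, Equiv.neg_apply, Equiv.refl_apply]
    rw [show (0 + ((-p.1 : ℤ) : ℝ)) = -(0 + p.1) by push_cast; ring, W_neg_left,
      neg_one_zpow_congr (n := (k : ℤ) * p.1 + l * p.2) (j := -k * p.1) (by ring)]
    ring
  exact self_eq_neg.1 this

lemma Th_add_two_left (a b : ℝ) (k l : ℕ) (τ : ℂ) : Th a b (k + 2) l τ = Th a b k l τ := by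
  refine tsum_congr fun p => ?_
  rw [neg_one_zpow_congr (j := p.1)]
  push_cast; ring

lemma theta5_eq_Th {a₁ a₂ b₁ b₂ : ℝ} {k l : ℕ} (c : ℂ) (τ : ℂ)
    (h : ∀ p : ℤ × ℤ, e (5 * (a₁ + p.1) * b₁ - 2 * (a₂ + p.2) * b₂) =
      c * (-1) ^ ((k : ℤ) * p.1 + (l : ℤ) * p.2)) :
    theta5 ![a₁, a₂] ![b₁, b₂] τ = c * Th a₁ a₂ k l τ := by
  rw [theta5_eq, Th, ← tsum_mul_left]
  refine tsum_congr fun p => ?_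
  rw [h]; ring

/-- On each translated lattice the character e(B(ν, b)) is a sign times a constant. The second
entries 1 and 2 of b make this constant 1 in the third and fourth components; in the last two it is
ζ₈⁻¹, cancelled by the prefactor ζ₈. -/
lemma H51_eq (τ : ℂ) : H51 τ = (1 / (2 * ModularForm.eta τ)) •
    ![Th (1 / 10) 0 0 1 τ, Th (3 / 10) 0 0 1 τ, Th (1 / 5) (1 / 4) 1 0 τ, Th (2 / 5) (1 / 4) 1 0 τ,
      Th (1 / 5) (1 / 4) 0 1 τ, Th (2 / 5) (1 / 4) 0 1 τ] := by
  have h₁ (a : ℝ) : theta5 ![a, 0] ![0, 1 / 4] τ = 1 * Th a 0 0 1 τ := by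
    refine theta5_eq_Th 1 τ fun p => ?_
    rw [neg_one_zpow_eq_e, one_mul]
    refine e_eq_of_eq_add_int (-p.2) ?_
    push_cast; ring
  have h₃ : theta5 ![1 / 5, 1 / 4] ![1 / 2, 1] τ = 1 * Th (1 / 5) (1 / 4) 1 0 τ := by
    refine theta5_eq_Th 1 τ fun p => ?_
    rw [neg_one_zpow_eq_e, one_mul]
    refine e_eq_of_eq_add_int (2 * p.1 - 2 * p.2) ?_
    push_cast; ring
  have h₄ : theta5 ![2 / 5, 1 / 4] ![1 / 2, 2] τ = 1 * Th (2 / 5) (1 / 4) 1 0 τ := by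
    refine theta5_eq_Th 1 τ fun p => ?_
    rw [neg_one_zpow_eq_e, one_mul]
    refine e_eq_of_eq_add_int (2 * p.1 - 4 * p.2) ?_
    push_cast; ring
  have h₅ (a : ℝ) : theta5 ![a, 1 / 4] ![0, 1 / 4] τ = e (-1 / 8) * Th a (1 / 4) 0 1 τ := by
    refine theta5_eq_Th _ τ fun p => ?_
    rw [neg_one_zpow_eq_e, ← e_add]
    refine e_eq_of_eq_add_int (-p.2) ?_
    push_cast; ring
  have hz : zeta 8 1 * e (-1 / 8) = 1 := by
    rw [zeta, ← e_add]
    exact (congrArg e (by push_cast; ring)).trans e_zero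
  rw [H51, h₁, h₁, h₃, h₄, h₅, h₅, ← mul_assoc, ← mul_assoc, hz]
  simp only [one_mul]

/-! ### Behaviour under τ ↦ τ + 1. -/

lemma W_add_one (x z : ℝ) (τ : ℂ) :
    W x z (τ + 1) = e ((5 * (x : ℂ) ^ 2 - 2 * (z : ℂ) ^ 2) / 2) * W x z τ := by
  unfold W
  rw [mul_left_comm, e, ← Complex.exp_add]
  simp only [add_im, one_im, add_zero]
  congr 2
  ring

/-- The phase contains 5m²/2, which is 5j - 5m/2 with j = m(m+1)/2. Supplying j makes the congruence
modulo ℤ linear in m; a leftover half-integer multiple of m or n is what changes the sign pattern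
(k, l) to (k', l'). -/
lemma Th_add_one {a b : ℝ} {k l k' l' : ℕ} (c : ℂ) (τ : ℂ)
    (h : ∀ m n j : ℤ, m * (m + 1) = 2 * j →
      ∃ i : ℤ, (5 * ((a : ℂ) + m) ^ 2 - 2 * (b + n) ^ 2) / 2 + (k * m + l * n) / 2 =
        c + (k' * m + l' * n) / 2 + i) :
    Th a b k l (τ + 1) = e c * Th a b k' l' τ := by
  rw [Th, Th, ← tsum_mul_left]
  refine tsum_congr fun p => ?_
  obtain ⟨j, hj⟩ := Int.even_mul_succ_self p.1
  obtain ⟨i, hi⟩ := h p.1 p.2 j (by rw [hj]; ring)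
  have := e_eq_of_eq_add_int i hi
  rw [e_add, e_add] at this
  rw [W_add_one, neg_one_zpow_eq_e, neg_one_zpow_eq_e]
  push_cast
  linear_combination W (a + p.1) (b + p.2) τ * this

lemma zeta_mul_e_div (n : ℕ) (k : ℤ) (c : ℂ) (h : c = k / n + 1 / 24) (η x : ℂ) :
    1 / (2 * (zeta 24 1 * η)) * (e c * x) = zeta n k * (1 / (2 * η) * x) := by
  have : e c = zeta n k * zeta 24 1 := by
    rw [zeta, zeta, ← e_add, h]; push_cast; rfl
  rw [this]
  have h0 : zeta 24 1 ≠ 0 := e_ne_zero _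
  field_simp

lemma H51_add_one (τ : ℂ) : H51 (τ + 1) = T5.mulVec (H51 τ) := by
  have t₁ : Th (1 / 10) 0 0 1 (τ + 1) = e (1 / 40) * Th (1 / 10) 0 0 1 τ := by
    refine Th_add_one _ τ fun m n j hj => ⟨5 * j - 2 * m - n ^ 2, ?_⟩
    have : (m * (m + 1) : ℂ) = 2 * j := by exact_mod_cast hj
    push_cast; linear_combination (5 / 2) * this
  have t₂ : Th (3 / 10) 0 0 1 (τ + 1) = e (9 / 40) * Th (3 / 10) 0 0 1 τ := by
    refine Th_add_one _ τ fun m n j hj => ⟨5 * j - m - n ^ 2, ?_⟩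
    have : (m * (m + 1) : ℂ) = 2 * j := by exact_mod_cast hj
    push_cast; linear_combination (5 / 2) * this
  have t₃ : Th (1 / 5) (1 / 4) 1 0 (τ + 1) = e (3 / 80) * Th (1 / 5) (1 / 4) 0 1 τ := by
    refine Th_add_one _ τ fun m n j hj => ⟨5 * j - m - n ^ 2 - n, ?_⟩
    have : (m * (m + 1) : ℂ) = 2 * j := by exact_mod_cast hj
    push_cast; linear_combination (5 / 2) * this
  have t₄ : Th (2 / 5) (1 / 4) 1 0 (τ + 1) = e (27 / 80) * Th (2 / 5) (1 / 4) 0 1 τ := by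
    refine Th_add_one _ τ fun m n j hj => ⟨5 * j - n ^ 2 - n, ?_⟩
    have : (m * (m + 1) : ℂ) = 2 * j := by exact_mod_cast hj
    push_cast; linear_combination (5 / 2) * this
  have t₅ : Th (1 / 5) (1 / 4) 0 1 (τ + 1) = e (3 / 80) * Th (1 / 5) (1 / 4) 1 0 τ := by
    refine Th_add_one _ τ fun m n j hj => ⟨5 * j - 2 * m - n ^ 2, ?_⟩
    have : (m * (m + 1) : ℂ) = 2 * j := by exact_mod_cast hj
    push_cast; linear_combination (5 / 2) * this
  have t₆ : Th (2 / 5) (1 / 4) 0 1 (τ + 1) = e (27 / 80) * Th (2 / 5) (1 / 4) 1 0 τ := by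
    refine Th_add_one _ τ fun m n j hj => ⟨5 * j - m - n ^ 2, ?_⟩
    have : (m * (m + 1) : ℂ) = 2 * j := by exact_mod_cast hj
    push_cast; linear_combination (5 / 2) * this
  rw [H51_eq, H51_eq, eta_add_one, t₁, t₂, t₃, t₄, t₅, t₆]
  ext i
  fin_cases i <;>
    simp only [T5, Matrix.mulVec, dotProduct, Fin.sum_univ_six, Pi.smul_apply, smul_eq_mul,
      Matrix.of_apply, Matrix.cons_val', Matrix.cons_val, Fin.reduceFinMk, Fin.isValue,
      Fin.zero_eta, Fin.mk_one, zero_mul, add_zero, zero_add] <;>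
    exact zeta_mul_e_div _ _ _ (by push_cast; norm_num) _ _

/-! ### Behaviour under τ ↦ -1/τ. -/

lemma tsum_prod_int_eq_sum_mod (m n : ℕ) [NeZero m] [NeZero n] {f : ℤ × ℤ → ℂ}
    (hf : Summable f) :
    ∑' p : ℤ × ℤ, f p = ∑ r : Fin m, ∑ s : Fin n, ∑' q : ℤ × ℤ, f (m * q.1 + r, n * q.2 + s) := by
  let φ : (Fin m × Fin n) × (ℤ × ℤ) ≃ ℤ × ℤ :=
    (Equiv.prodComm _ _).trans ((Equiv.prodProdProdComm ℤ ℤ (Fin m) (Fin n)).trans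
      ((Int.divModEquiv m).prodCongr (Int.divModEquiv n)).symm)
  have hφ (x : (Fin m × Fin n) × (ℤ × ℤ)) :
      φ x = (m * x.2.1 + (x.1.1 : ℕ), n * x.2.2 + (x.1.2 : ℕ)) := by
    simp [φ, Int.divModEquiv, mul_comm]
  have hs : Summable fun x => f (φ x) := φ.summable_iff.2 hf
  rw [← φ.tsum_eq, hs.tsum_prod, tsum_fintype, Fintype.sum_prod_type]
  simp only [hφ]

/-- The dual points (w₁ + p₁)/5 and (w₂ + p₂)/2 fall back into translates of ℤ² once p is split
modulo 5 and 2. Inversion exchanges characteristics and signs: w = (k'/2, l'/2) becomes the new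
translate, and on p = (5q₁ + r, 2q₂ + s) the dual character is a constant times (-1)^{kq₁ + lq₂}. -/
lemma Th_neg_one_div {τ : ℂ} (hτ : 0 < τ.im) (k l k' l' : ℕ) :
    Th (k / 10) (l / 4) k' l' (-1 / τ) = e (-(k * k' / 20 + l * l' / 8)) * (τ / √10) *
      ∑ r : Fin 5, ∑ s : Fin 2, e (-1 / 10) ^ (k * (r : ℕ)) * e (-1 / 4) ^ (l * (s : ℕ)) *
        Th ((k' / 2 + (r : ℕ)) / 5) ((l' / 2 + (s : ℕ)) / 2) k l τ := by
  have h := tsum_W_neg_one_div hτ (k / 10) (l / 4) (k' / 2) (l' / 2)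
  have hs : Summable fun p : ℤ × ℤ => W ((((k' / 2 : ℝ)) + p.1) / 5) ((((l' / 2 : ℝ)) + p.2) / 2) τ *
        e (-(((k / 10 : ℝ) : ℂ) * p.1 + ((l / 4 : ℝ) : ℂ) * p.2)) := by
    have h1 := (gaussSummable_dual (k' / 2) (l' / 2)).W_mul hτ
      (χ := fun p : ℤ × ℤ => e (-(((k / 10 : ℝ) : ℂ) * p.1 + ((l / 4 : ℝ) : ℂ) * p.2)))
      fun p => by exact_mod_cast (norm_e_real (-((k / 10) * p.1 + (l / 4) * p.2))).le
    refine h1.congr fun p => ?_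
    rw [neg_div, W_neg_right]
  rw [tsum_prod_int_eq_sum_mod 5 2 hs] at h
  have hL : ∑' p : ℤ × ℤ, W ((k / 10 : ℝ) + p.1) ((l / 4 : ℝ) + p.2) (-1 / τ) *
      e ((((k / 10 : ℝ) : ℂ) + p.1) * ((k' / 2 : ℝ) : ℂ) +
        (((l / 4 : ℝ) : ℂ) + p.2) * ((l' / 2 : ℝ) : ℂ)) =
      e (k * k' / 20 + l * l' / 8) * Th (k / 10) (l / 4) k' l' (-1 / τ) := by
    rw [Th, ← tsum_mul_left]
    refine tsum_congr fun p => ?_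
    rw [mul_left_comm, neg_one_zpow_eq_e, ← e_add]
    congr 2
    push_cast; ring
  rw [hL] at h
  rw [e_neg, mul_assoc, eq_inv_mul_iff_mul_eq₀ (e_ne_zero _), h]
  congr 1
  refine Finset.sum_congr rfl fun r _ => Finset.sum_congr rfl fun s _ => ?_
  rw [Th, ← tsum_mul_left]
  refine tsum_congr fun q => ?_
  rw [mul_left_comm, neg_one_zpow_eq_e, e_pow, e_pow, ← e_add, ← e_add]
  congr 1
  · congr 1 <;> (push_cast; ring)
  · refine e_eq_of_eq_add_int (-(k * q.1 + l * q.2)) ?_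
    push_cast; ring

lemma e_add_half (x : ℂ) : e (x + 1 / 2) = -e x := by
  rw [e_add, e_half, mul_neg_one]

lemma e_neg_tenth_pow_five : e (-1 / 10) ^ 5 = -1 := by
  rw [e_pow]
  refine Eq.trans ?_ e_half
  refine e_eq_of_eq_add_int (-1) ?_
  push_cast; ring

lemma e_neg_quarter : e (-1 / 4) = -I := by
  rw [e, show (2 * Real.pi * I * (-1 / 4) : ℂ) = -(Real.pi / 2 * I) by ring, Complex.exp_neg,
    Complex.exp_pi_div_two_mul_I, inv_I]

lemma e_neg_sub_e (x : ℝ) : e (-x) - e x = -2 * I * (Real.sin (2 * Real.pi * x) : ℂ) := by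
  rw [ofReal_sin, Complex.sin, e, e]
  push_cast
  rw [show 2 * Real.pi * I * -x = -(2 * Real.pi * x) * I by ring,
    show 2 * Real.pi * I * x = 2 * Real.pi * x * I by ring]
  linear_combination (Complex.exp (-(2 * Real.pi * x) * I) -
    Complex.exp (2 * Real.pi * x * I)) * I_sq

lemma e_neg_tenth_add : e (-1 / 10) + e (-1 / 10) ^ 4 = -2 * I * (Real.sin (Real.pi / 5) : ℂ) := by
  have h := e_neg_sub_e (1 / 10)
  rw [show 2 * Real.pi * (1 / 10) = Real.pi / 5 by ring] at h
  rw [← h, e_pow, sub_eq_add_neg, ← e_add_half]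
  congr 1
  · congr 1; push_cast; ring
  · refine e_eq_of_eq_add_int (-1) ?_
    push_cast; ring

lemma e_neg_tenth_sq_add :
    e (-1 / 10) ^ 2 + e (-1 / 10) ^ 3 = -2 * I * (Real.sin (2 * Real.pi / 5) : ℂ) := by
  have h := e_neg_sub_e (1 / 5)
  rw [show 2 * Real.pi * (1 / 5) = 2 * Real.pi / 5 by ring] at h
  rw [← h, e_pow, e_pow, sub_eq_add_neg, ← e_add_half]
  congr 1
  · congr 1; push_cast; ring
  · refine e_eq_of_eq_add_int (-1) ?_
    push_cast; ring

lemma e_neg_eighth_mul : e (-1 / 8) * (1 + I) = √2 := by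
  have h : e (-1 / 8) = Real.cos (Real.pi / 4) - Real.sin (Real.pi / 4) * I := by
    rw [ofReal_cos, ofReal_sin, Complex.cos_sub_sin_I, e]
    congr 1; push_cast; ring
  have h2 : (√2 : ℂ) ^ 2 = 2 := by exact_mod_cast Real.sq_sqrt (show (0 : ℝ) ≤ 2 by norm_num)
  rw [h, Real.cos_pi_div_four, Real.sin_pi_div_four]
  push_cast
  linear_combination (-√2 / 2 : ℂ) * I_sq

/-- The class r = 0 vanishes by oddness, and r and 5 - r are exchanged by reflection. -/
lemma sum_Th_fifth (c : ℂ) (b : ℝ) (k l : ℕ) (τ : ℂ) :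
    ∑ r : Fin 5, c ^ (k * (r : ℕ)) * Th ((((0 : ℕ) : ℝ) / 2 + (r : ℕ)) / 5) b k l τ =
      (c ^ k - (-1) ^ k * c ^ (4 * k)) * Th (1 / 5) b k l τ +
      (c ^ (2 * k) - (-1) ^ k * c ^ (3 * k)) * Th (2 / 5) b k l τ := by
  rw [Fin.sum_univ_five,
    show ((((0 : ℕ) : ℝ) / 2 + ((0 : Fin 5) : ℕ)) / 5) = 0 by norm_num,
    show ((((0 : ℕ) : ℝ) / 2 + ((1 : Fin 5) : ℕ)) / 5) = 1 / 5 by norm_num,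
    show ((((0 : ℕ) : ℝ) / 2 + ((2 : Fin 5) : ℕ)) / 5) = 2 / 5 by norm_num,
    show ((((0 : ℕ) : ℝ) / 2 + ((3 : Fin 5) : ℕ)) / 5) = 1 - 2 / 5 by norm_num,
    show ((((0 : ℕ) : ℝ) / 2 + ((4 : Fin 5) : ℕ)) / 5) = 1 - 1 / 5 by norm_num,
    Th_zero_left, Th_one_sub_left, Th_one_sub_left]
  norm_num [mul_comm k]
  ring

/-- Here the translates are 1/10, 3/10, ..., 9/10. The middle one, 1/2, is fixed by the reflection
and killed by its sign; evenness of k is needed for that sign to be -1. -/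
lemma sum_Th_tenth (c : ℂ) (b : ℝ) {k : ℕ} (hk : Even k) (l : ℕ) (τ : ℂ) :
    ∑ r : Fin 5, c ^ (k * (r : ℕ)) * Th ((((1 : ℕ) : ℝ) / 2 + (r : ℕ)) / 5) b k l τ =
      (1 - c ^ (4 * k)) * Th (1 / 10) b k l τ +
      (c ^ k - c ^ (3 * k)) * Th (3 / 10) b k l τ := by
  have h := Th_one_sub_left (1 / 2) b k l τ
  rw [hk.neg_one_pow, show (1 - 1 / 2 : ℝ) = 1 / 2 by norm_num, neg_one_mul, self_eq_neg] at h
  rw [Fin.sum_univ_five,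
    show ((((1 : ℕ) : ℝ) / 2 + ((0 : Fin 5) : ℕ)) / 5) = 1 / 10 by norm_num,
    show ((((1 : ℕ) : ℝ) / 2 + ((1 : Fin 5) : ℕ)) / 5) = 3 / 10 by norm_num,
    show ((((1 : ℕ) : ℝ) / 2 + ((2 : Fin 5) : ℕ)) / 5) = 1 / 2 by norm_num,
    show ((((1 : ℕ) : ℝ) / 2 + ((3 : Fin 5) : ℕ)) / 5) = 1 - 3 / 10 by norm_num,
    show ((((1 : ℕ) : ℝ) / 2 + ((4 : Fin 5) : ℕ)) / 5) = 1 - 1 / 10 by norm_num,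
    h, Th_one_sub_left, Th_one_sub_left, hk.neg_one_pow]
  norm_num [mul_comm k]
  ring

lemma sum_Th_quarter (a : ℝ) (k l : ℕ) (τ : ℂ) :
    ∑ s : Fin 2, e (-1 / 4) ^ (l * (s : ℕ)) * Th a ((((1 : ℕ) : ℝ) / 2 + (s : ℕ)) / 2) k l τ =
      (1 + I ^ l) * Th a (1 / 4) k l τ := by
  rw [Fin.sum_univ_two,
    show ((((1 : ℕ) : ℝ) / 2 + ((0 : Fin 2) : ℕ)) / 2) = 1 / 4 by norm_num,
    show ((((1 : ℕ) : ℝ) / 2 + ((1 : Fin 2) : ℕ)) / 2) = 1 - 1 / 4 by norm_num,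
    Th_one_sub_right, e_neg_quarter]
  have : (I : ℂ) ^ l = (-I) ^ l * (-1) ^ l := by rw [← mul_pow]; simp
  rw [this]
  norm_num
  ring

lemma sum_Th_half (a : ℝ) (k : ℕ) {l : ℕ} (hl : Odd l) (τ : ℂ) :
    ∑ s : Fin 2, e (-1 / 4) ^ (l * (s : ℕ)) * Th a ((((0 : ℕ) : ℝ) / 2 + (s : ℕ)) / 2) k l τ =
      Th a 0 k l τ := by
  have h := Th_one_sub_right a (1 / 2) k l τ
  rw [hl.neg_one_pow, show (1 - 1 / 2 : ℝ) = 1 / 2 by norm_num, neg_one_mul, self_eq_neg] at h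
  rw [Fin.sum_univ_two,
    show ((((0 : ℕ) : ℝ) / 2 + ((0 : Fin 2) : ℕ)) / 2) = 0 by norm_num,
    show ((((0 : ℕ) : ℝ) / 2 + ((1 : Fin 2) : ℕ)) / 2) = 1 / 2 by norm_num, h]
  simp

lemma Th_neg_one_div' {τ : ℂ} (hτ : 0 < τ.im) {a b : ℝ} {k l : ℕ} (k' l' : ℕ) (ha : a = k / 10)
    (hb : b = l / 4) :
    Th a b k' l' (-1 / τ) = e (-(k * k' / 20 + l * l' / 8)) * (τ / √10) *
      ∑ r : Fin 5, e (-1 / 10) ^ (k * (r : ℕ)) * ∑ s : Fin 2, e (-1 / 4) ^ (l * (s : ℕ)) *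
        Th ((k' / 2 + (r : ℕ)) / 5) ((l' / 2 + (s : ℕ)) / 2) k l τ := by
  rw [ha, hb, Th_neg_one_div hτ]
  simp only [Finset.mul_sum, mul_assoc]

lemma Th_neg_one_div_of_odd {τ : ℂ} (hτ : 0 < τ.im) {a : ℝ} {k : ℕ} (hk : Odd k)
    (ha : a = k / 10) :
    Th a 0 0 1 (-1 / τ) = 2 * (τ / √10) *
      ((e (-1 / 10) ^ k + e (-1 / 10) ^ (4 * k)) * Th (1 / 5) (1 / 4) 1 0 τ +
      (e (-1 / 10) ^ (2 * k) + e (-1 / 10) ^ (3 * k)) * Th (2 / 5) (1 / 4) 1 0 τ) := by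
  have h (a b : ℝ) : Th a b k 0 τ = Th a b 1 0 τ := by
    clear ha
    obtain ⟨m, rfl⟩ := hk
    induction m with
    | zero => rfl
    | succ m ih => rw [← ih, show 2 * (m + 1) + 1 = 2 * m + 1 + 2 by ring, Th_add_two_left]
  rw [Th_neg_one_div' hτ (k := k) (l := 0) 0 1 ha (by simp)]
  simp only [sum_Th_quarter]
  have := sum_Th_fifth (e (-1 / 10)) (1 / 4) k 0 τ
  rw [hk.neg_one_pow] at this
  simp only [mul_left_comm (_ ^ _) (1 + I ^ 0)]
  rw [← Finset.mul_sum, this, h, h]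
  simp only [Nat.cast_zero, mul_zero, zero_mul, zero_div, add_zero, neg_zero, e_zero]
  ring

lemma Th_add_even_left (a b : ℝ) (m l : ℕ) (τ : ℂ) : Th a b (2 * m) l τ = Th a b 0 l τ := by
  induction m with
  | zero => rfl
  | succ m ih => rw [← ih, show 2 * (m + 1) = 2 * m + 2 by ring, Th_add_two_left]

lemma Th_neg_one_div_of_even {τ : ℂ} (hτ : 0 < τ.im) {a : ℝ} (m : ℕ) (ha : a = m / 5) :
    Th a (1 / 4) 1 0 (-1 / τ) = (τ / √10) *
      ((e (-1 / 10) ^ m - e (-1 / 10) ^ (9 * m)) * Th (1 / 10) 0 0 1 τ +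
      (e (-1 / 10) ^ (3 * m) - e (-1 / 10) ^ (7 * m)) * Th (3 / 10) 0 0 1 τ) := by
  rw [Th_neg_one_div' hτ (k := 2 * m) (l := 1) 1 0 (by rw [ha]; push_cast; ring) (by simp)]
  simp only [sum_Th_half _ _ odd_one]
  rw [sum_Th_tenth _ _ (even_two_mul m), Th_add_even_left, Th_add_even_left,
    show e (-(((2 * m : ℕ) : ℂ) * (1 : ℕ) / 20 + (1 : ℕ) * (0 : ℕ) / 8)) = e (-1 / 10) ^ m by
      rw [e_pow]; congr 1; push_cast; ring]
  ring

lemma Th_neg_one_div_of_even' {τ : ℂ} (hτ : 0 < τ.im) {a : ℝ} (m : ℕ) (ha : a = m / 5) :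
    Th a (1 / 4) 0 1 (-1 / τ) = √2 * (τ / √10) *
      ((e (-1 / 10) ^ (2 * m) - e (-1 / 10) ^ (8 * m)) * Th (1 / 5) (1 / 4) 0 1 τ +
      (e (-1 / 10) ^ (4 * m) - e (-1 / 10) ^ (6 * m)) * Th (2 / 5) (1 / 4) 0 1 τ) := by
  rw [Th_neg_one_div' hτ (k := 2 * m) (l := 1) 0 1 (by rw [ha]; push_cast; ring) (by simp)]
  simp only [sum_Th_quarter]
  have := sum_Th_fifth (e (-1 / 10)) (1 / 4) (2 * m) 1 τ
  rw [(even_two_mul m).neg_one_pow] at this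
  simp only [mul_left_comm (_ ^ _) (1 + I ^ 1)]
  rw [← Finset.mul_sum, this, Th_add_even_left, Th_add_even_left, ← e_neg_eighth_mul,
    show e (-(((2 * m : ℕ) : ℂ) * (0 : ℕ) / 20 + (1 : ℕ) * (1 : ℕ) / 8)) = e (-1 / 8) by
      congr 1; push_cast; ring]
  ring

lemma H51_neg_one_div {τ : ℂ} (hτ : 0 < τ.im) :
    H51 (-1 / τ) = ((-I * τ) ^ (1 / 2 : ℂ) * (2 / (√5 : ℝ) : ℂ)) • M5.mulVec (H51 τ) := by
  have hA := e_neg_tenth_pow_five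
  have s₁ := e_neg_tenth_add
  have s₂ := e_neg_tenth_sq_add
  have t₁ := Th_neg_one_div_of_odd hτ (a := 1 / 10) (k := 1) (by decide) (by norm_num)
  have t₂ := Th_neg_one_div_of_odd hτ (a := 3 / 10) (k := 3) (by decide) (by norm_num)
  have t₃ := Th_neg_one_div_of_even hτ (a := 1 / 5) 1 (by norm_num)
  have t₄ := Th_neg_one_div_of_even hτ (a := 2 / 5) 2 (by norm_num)
  have t₅ := Th_neg_one_div_of_even' hτ (a := 1 / 5) 1 (by norm_num)
  have t₆ := Th_neg_one_div_of_even' hτ (a := 2 / 5) 2 (by norm_num)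
  -- From here on A is an arbitrary number with A⁵ = -1 and the two relations that express A + A⁴
  -- and A² + A³ by sines; high powers are reduced with A⁵ = -1.
  generalize e (-1 / 10) = A at *
  have hτ0 : τ ≠ 0 := by rintro rfl; simp at hτ
  have hη := eta_ne_zero hτ
  have hsq : ((-I * τ) ^ (1 / 2 : ℂ)) ^ 2 = -I * τ := by
    rw [← cpow_nat_mul]; norm_num
  have hc : (-I * τ) ^ (1 / 2 : ℂ) ≠ 0 := fun h => by
    rw [h] at hsq
    simp [hτ0] at hsq
  rw [H51_eq, H51_eq, eta_neg_one_div hτ, Matrix.mulVec_smul, smul_smul, t₁, t₂, t₃, t₄, t₅, t₆]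
  clear t₁ t₂ t₃ t₄ t₅ t₆
  generalize (-I * τ) ^ (1 / 2 : ℂ) = c at *
  have hA2 : (√2 : ℂ) ^ 2 = 2 := by exact_mod_cast Real.sq_sqrt (show (0 : ℝ) ≤ 2 by norm_num)
  have hA5 : (√5 : ℂ) ^ 2 = 5 := by exact_mod_cast Real.sq_sqrt (show (0 : ℝ) ≤ 5 by norm_num)
  have h10 : (√10 : ℂ) = √2 * √5 := by
    rw [← ofReal_mul, ← Real.sqrt_mul (by norm_num)]; norm_num
  have n2 : (√2 : ℂ) ≠ 0 := by intro h; simp [h] at hA2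
  have n5 : (√5 : ℂ) ≠ 0 := by intro h; simp [h] at hA5
  -- With c = √(-Iτ), the theta series contribute τ = Ic² and η contributes 1/c, so one factor c is
  -- left. The remaining I cancels the factor I in the sine relations.
  have hτc : τ = I * c ^ 2 := by rw [hsq]; linear_combination τ * I_sq
  generalize hS₁ : ((Real.sin (Real.pi / 5) : ℝ) : ℂ) = S₁ at *
  generalize hS₂ : ((Real.sin (2 * Real.pi / 5) : ℝ) : ℂ) = S₂ at *
  have p6 : A ^ 6 = -A := by linear_combination A * hA
  have p7 : A ^ 7 = -A ^ 2 := by linear_combination A ^ 2 * hA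
  have p8 : A ^ 8 = -A ^ 3 := by linear_combination A ^ 3 * hA
  have p9 : A ^ 9 = -A ^ 4 := by linear_combination A ^ 4 * hA
  have p12 : A ^ 12 = A ^ 2 := by linear_combination (A ^ 7 - A ^ 2) * hA
  have p14 : A ^ 14 = A ^ 4 := by linear_combination (A ^ 9 - A ^ 4) * hA
  have p16 : A ^ 16 = -A := by linear_combination (A ^ 11 - A ^ 6 + A) * hA
  have p18 : A ^ 18 = -A ^ 3 := by linear_combination (A ^ 13 - A ^ 8 + A ^ 3) * hA
  have key (x y : ℂ) (h : x * I = 2 * √2 * y) :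
      1 / (2 * (c * ModularForm.eta τ)) * (τ / √10 * x) =
        c * (2 / √5) * (1 / (2 * ModularForm.eta τ)) * y := by
    rw [h10]
    have h2 : τ * x = c ^ 2 * (2 * √2 * y) := by rw [← h]; linear_combination x * hτc
    field_simp
    linear_combination h2
  have hm : (√2 : ℂ) * (1 / √2) = 1 := mul_one_div_cancel n2
  funext i
  fin_cases i
  all_goals
    simp only [M5, M5real, Matrix.mulVec, dotProduct, Fin.sum_univ_six, Pi.smul_apply, smul_eq_mul,
      Matrix.map_apply, Matrix.of_apply]
    simp [-one_div, -ofReal_sin, hS₁, hS₂]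
  · rw [s₁, s₂]
    set Y := S₁ * Th (1 / 5) (1 / 4) 1 0 τ + S₂ * Th (2 / 5) (1 / 4) 1 0 τ with hY
    linear_combination key (-4 * I * Y) (√2 * Y) (by
      linear_combination -4 * Y * I_sq - 2 * Y * hA2)
  · rw [p12, p6, p9, add_comm (A ^ 3), s₂, ← neg_add, s₁]
    set Y := S₂ * Th (1 / 5) (1 / 4) 1 0 τ - S₁ * Th (2 / 5) (1 / 4) 1 0 τ with hY
    linear_combination key (-4 * I * Y) (√2 * Y) (by
      linear_combination -4 * Y * I_sq - 2 * Y * hA2)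
  · rw [p9, p7, sub_neg_eq_add, sub_neg_eq_add, add_comm (A ^ 3), s₂, s₁]
    set Y := S₁ * Th (1 / 10) 0 0 1 τ + S₂ * Th (3 / 10) 0 0 1 τ with hY
    linear_combination key (-2 * I * Y) (1 / √2 * Y) (by
      linear_combination -2 * Y * I_sq - 2 * Y * hm)
  · rw [p18, p6, p14, sub_neg_eq_add, ← neg_add', s₂, s₁]
    set Y := S₂ * Th (1 / 10) 0 0 1 τ - S₁ * Th (3 / 10) 0 0 1 τ with hY
    linear_combination key (-2 * I * Y) (1 / √2 * Y) (by
      linear_combination -2 * Y * I_sq - 2 * Y * hm)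
  · rw [p8, p6, sub_neg_eq_add, sub_neg_eq_add, add_comm (A ^ 4), s₂, s₁]
    set Y := S₂ * Th (1 / 5) (1 / 4) 0 1 τ + S₁ * Th (2 / 5) (1 / 4) 0 1 τ with hY
    linear_combination key (-2 * √2 * I * Y) Y (by
      linear_combination -2 * √2 * Y * I_sq)
  · rw [p16, p8, p12, sub_neg_eq_add, add_comm (A ^ 4), ← neg_add', add_comm (A ^ 3), s₂, s₁]
    set Y := S₁ * Th (1 / 5) (1 / 4) 0 1 τ - S₂ * Th (2 / 5) (1 / 4) 0 1 τ with hY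
    linear_combination key (-2 * √2 * I * Y) Y (by
      linear_combination -2 * √2 * Y * I_sq)

/-! ### The holomorphic and the non-holomorphic part of the indefinite theta functions -/

/-- The summand of the non-holomorphic part attached to `c₁`. -/
def V (x z : ℝ) (τ : ℂ) : ℂ :=
  ((Real.sign (x - z) * beta (20 / 3 * (x - z) ^ 2 * τ.im) : ℝ) : ℂ) *
    e ((5 * (x : ℂ) ^ 2 - 2 * (z : ℂ) ^ 2) / 2 * τ)

/-- The summand of the holomorphic part. -/
def S (x z : ℝ) (τ : ℂ) : ℂ :=
  ((Real.sign (x - z) + Real.sign (x + z) : ℝ) : ℂ) *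
    e ((5 * (x : ℂ) ^ 2 - 2 * (z : ℂ) ^ 2) / 2 * τ)

lemma sign_mul_of_pos (x : ℝ) {c : ℝ} (hc : 0 < c) : Real.sign (c * x) = Real.sign x := by
  rcases lt_trichotomy x 0 with h | rfl | h
  · rw [Real.sign_of_neg h, Real.sign_of_neg (mul_neg_of_pos_of_neg hc h)]
  · simp
  · rw [Real.sign_of_pos h, Real.sign_of_pos (mul_pos hc h)]

lemma W_eq_sub (x z : ℝ) {τ : ℂ} (hτ : 0 < τ.im) :
    W x z τ = S x z τ - V x z τ - V x (-z) τ := by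
  have h (u : ℝ) : E (kap * u * √τ.im) =
      Real.sign u * (1 - beta (20 / 3 * u ^ 2 * τ.im)) := by
    rw [E_eq, mul_pow, mul_pow, kap_sq, Real.sq_sqrt hτ.le, mul_comm kap, mul_assoc, mul_comm u,
      sign_mul_of_pos _ (mul_pos kap_pos (Real.sqrt_pos.2 hτ))]
  rw [W, S, V, V, h, h, sub_neg_eq_add]
  push_cast
  rw [neg_sq, e, show 2 * Real.pi * I * ((5 * (x : ℂ) ^ 2 - 2 * (z : ℂ) ^ 2) / 2 * τ) =
    Real.pi * I * (5 * (x : ℂ) ^ 2 - 2 * (z : ℂ) ^ 2) * τ by ring]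
  ring

lemma abs_sign_le (x : ℝ) : |Real.sign x| ≤ 1 := by
  rcases Real.sign_apply_eq x with h | h | h <;> simp [h]

lemma GaussSummable.V_mul {ι : Type*} {x z : ι → ℝ} (h : GaussSummable x z) {τ : ℂ}
    (hτ : 0 < τ.im) {χ : ι → ℂ} (hχ : ∀ p, ‖χ p‖ ≤ 1) :
    Summable fun p => V (x p) (z p) τ * χ p := by
  -- The bound β(x) ≤ e^{-πx} adds (20/3)(x-z)² to 5x² - 2z². The sum (35/3)x² - (40/3)xz + (14/3)z²
  -- is positive definite, of determinant 10.
  obtain ⟨c, hc, hq⟩ := le_quadratic_form (A := 35 / 3) (F := -20 / 3) (D := 14 / 3)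
    (by norm_num) (by norm_num)
  refine Summable.of_norm_bounded (h (Real.pi * τ.im * c)
    (mul_pos (mul_pos Real.pi_pos hτ) hc)) fun p => ?_
  rw [norm_mul, V, norm_mul, norm_real, Real.norm_eq_abs, abs_mul, norm_e]
  have him : ((5 * (x p : ℂ) ^ 2 - 2 * (z p : ℂ) ^ 2) / 2 * τ).im =
      (5 * x p ^ 2 - 2 * z p ^ 2) / 2 * τ.im := by
    rw [← im_ofReal_mul]; push_cast; rfl
  have hb0 : 0 ≤ 20 / 3 * (x p - z p) ^ 2 * τ.im := by positivity
  rw [him, abs_of_nonneg (beta_nonneg hb0)]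
  calc _ ≤ 1 * Real.exp (-Real.pi * (20 / 3 * (x p - z p) ^ 2 * τ.im)) *
        Real.exp (-2 * Real.pi * ((5 * x p ^ 2 - 2 * z p ^ 2) / 2 * τ.im)) * 1 := by
        have := beta_nonneg hb0
        gcongr
        · exact abs_sign_le _
        · exact beta_le hb0
        · exact hχ p
    _ ≤ _ := by
        rw [one_mul, mul_one, ← Real.exp_add, Real.exp_le_exp]
        have := mul_le_mul_of_nonneg_left (hq (x p) (z p)) (mul_pos Real.pi_pos hτ).le
        linarith

/-- The non-holomorphic part of `Th` attached to `c₁`. -/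
def Bt (a b : ℝ) (k l : ℕ) (τ : ℂ) : ℂ :=
  ∑' p : ℤ × ℤ, V (a + p.1) (b + p.2) τ * (-1) ^ ((k : ℤ) * p.1 + (l : ℤ) * p.2)

lemma summable_Bt (a b : ℝ) (k l : ℕ) {τ : ℂ} (hτ : 0 < τ.im) : Summable fun p : ℤ × ℤ =>
    V (a + p.1) (b + p.2) τ * (-1) ^ ((k : ℤ) * p.1 + (l : ℤ) * p.2) :=
  (gaussSummable_shift a b).V_mul hτ fun _ => (norm_neg_one_zpow _).le

/-- The c₂ error is the c₁ error with z replaced by -z; reflecting the second index makes it `Bt` at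
the characteristic -b, so only c₁ has to be analysed. -/
lemma hasSum_Bt_neg (a b : ℝ) (k l : ℕ) {τ : ℂ} (hτ : 0 < τ.im) : HasSum (fun p : ℤ × ℤ =>
    V (a + p.1) (-(b + p.2)) τ * (-1) ^ ((k : ℤ) * p.1 + (l : ℤ) * p.2)) (Bt a (-b) k l τ) := by
  refine (((Equiv.refl ℤ).prodCongr (Equiv.neg ℤ)).hasSum_iff.2
    (summable_Bt a (-b) k l hτ).hasSum).congr_fun fun p => ?_
  simp only [Function.comp, Equiv.prodCongr_apply, Prod.map_fst, Prod.map_snd, Equiv.neg_apply,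
    Equiv.refl_apply]
  rw [neg_one_zpow_congr (m := (k : ℤ) * p.1 + (l : ℤ) * p.2)
    (n := (k : ℤ) * p.1 + (l : ℤ) * (-p.2)) (j := l * p.2) (by ring)]
  congr 2
  push_cast; ring

lemma hasSum_S (a b : ℝ) (k l : ℕ) {τ : ℂ} (hτ : 0 < τ.im) : HasSum (fun p : ℤ × ℤ =>
    S (a + p.1) (b + p.2) τ * (-1) ^ ((k : ℤ) * p.1 + (l : ℤ) * p.2))
    (Th a b k l τ + Bt a b k l τ + Bt a (-b) k l τ) := by
  refine (((summable_Th a b k l hτ).hasSum.add (summable_Bt a b k l hτ).hasSum).add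
    (hasSum_Bt_neg a b k l hτ)).congr_fun fun p => ?_
  rw [W_eq_sub _ _ hτ]
  ring

/-! ### Unary theta series and the factorisation of the non-holomorphic part. -/

/-- The unary theta series of the form `3/2 (c + j)²`. -/
def Phi (c : ℂ) (τ : ℂ) : ℂ := ∑' j : ℤ, (-1) ^ j * e (3 / 2 * (c + j) ^ 2 * τ)

lemma Phi_add_int (c : ℂ) (n : ℤ) (τ : ℂ) : Phi (c + n) τ = (-1) ^ n * Phi c τ := by
  conv_rhs => rw [Phi, ← (Equiv.addRight n).tsum_eq]
  rw [Phi, ← tsum_mul_left]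
  refine tsum_congr fun j => ?_
  rw [Equiv.coe_addRight, ← mul_assoc, ← zpow_add₀ (by simp), neg_one_zpow_congr (m := n + (j + n))
    (n := j) (j := n) (by ring)]
  push_cast; ring_nf

lemma Phi_neg (c : ℂ) (τ : ℂ) : Phi (-c) τ = Phi c τ := by
  rw [Phi, Phi, ← (Equiv.neg ℤ).tsum_eq]
  refine tsum_congr fun j => ?_
  rw [Equiv.neg_apply, neg_one_zpow_congr (m := -j) (n := j) (j := -j) (by ring)]
  push_cast; ring_nf

lemma Phi_one_sixth {τ : ℂ} (hτ : 0 < τ.im) : Phi (1 / 6) τ = ModularForm.eta τ := by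
  rw [← (hasSum_eta hτ).tsum_eq]
  exact tsum_congr fun j => by rw [add_comm (j : ℂ)]

/-- The terms cancel in pairs. Modulo 1 only the shifts ±1/6 and 1/2 occur below, so each unary
factor is ±η or 0. -/
lemma Phi_half (τ : ℂ) : Phi (1 / 2) τ = 0 := by
  have h := Phi_add_int (-(1 / 2)) 1 τ
  rw [Phi_neg, zpow_one, neg_one_mul] at h
  rw [← self_eq_neg, ← h]
  congr 1; push_cast; ring

lemma tsum_int_eq_sum_mod (n : ℕ) [NeZero n] {f : ℤ → ℂ} (hf : Summable f) :
    ∑' m : ℤ, f m = ∑ r : Fin n, ∑' p : ℤ, f (n * p + r) := by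
  have hs : Summable fun x : Fin n × ℤ => f (n * x.2 + x.1) := by
    refine (((Int.divModEquiv n).trans (Equiv.prodComm _ _)).symm.summable_iff.2 hf).congr
      fun x => ?_
    simp [Int.divModEquiv, mul_comm]
  rw [← tsum_fintype (L := .unconditional _), ← hs.tsum_prod,
    ← ((Int.divModEquiv n).trans (Equiv.prodComm _ _)).symm.tsum_eq]
  refine tsum_congr fun x => ?_
  simp [Int.divModEquiv, mul_comm]

/-- The equivalence `(m, j) ↦ (m + j, j)`. -/
def shearEquiv : ℤ × ℤ ≃ ℤ × ℤ where
  toFun p := (p.1 + p.2, p.2)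
  invFun p := (p.1 - p.2, p.2)
  left_inv p := by simp
  right_inv p := by simp

/-- With ν = x - z one has (5x² - 2z²)/2 = (3/2)(z + 5ν/3)² - 15(ν/3)². The sign and β see ν alone,
and (20/3)ν²y = 2(ν/3)²·30y, which explains the argument 30τ. The shift 5ν/3 modulo 1 depends on ν
modulo 3, hence the three classes r. The condition k + l = 1 makes the sign alternate along each
line of constant ν, as in `Phi`. -/
lemma Bt_eq_sum (a b : ℝ) (k l : ℕ) {τ : ℂ} (hτ : 0 < τ.im) (hkl : k + l = 1) :
    Bt a b k l τ = ∑ r : Fin 3, Phi (b + 5 / 3 * (a - b + (r : ℕ))) τ * ∑' p : ℤ,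
      ((Real.sign ((a - b + (r : ℕ)) / 3 + p) *
        beta (2 * ((a - b + (r : ℕ)) / 3 + p) ^ 2 * (30 * τ).im) : ℝ) : ℂ) *
      e (-15 * ((((a - b + (r : ℕ)) / 3 + p : ℝ) : ℂ)) ^ 2 * τ) *
        (-1) ^ ((k : ℤ) * (3 * p + r) + p) := by
  have h1 := shearEquiv.summable_iff.2 (summable_Bt a b k l hτ)
  have hkl' : (k : ℤ) + l = 1 := by exact_mod_cast hkl
  rw [Bt, ← shearEquiv.tsum_eq]
  simp only [Function.comp_def] at h1
  rw [h1.tsum_prod, tsum_int_eq_sum_mod 3 h1.prod]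
  refine Finset.sum_congr rfl fun r _ => ?_
  rw [← tsum_mul_left]
  refine tsum_congr fun p => ?_
  simp only [shearEquiv, Equiv.coe_fn_mk]
  rw [show Phi (b + 5 / 3 * (a - b + (r : ℕ))) τ = (-1) ^ (-(5 * p)) *
      Phi (b + 5 / 3 * (a - b + (((3 : ℕ) * p + (r : ℕ) : ℤ)))) τ by
    rw [← Phi_add_int]; congr 1; push_cast; ring]
  rw [Phi, mul_right_comm, mul_comm (_ * _) (∑' _, _), ← tsum_mul_right, ]
  refine tsum_congr fun j => ?_
  set ν : ℝ := a - b + ((3 : ℕ) * p + (r : ℕ) : ℤ) with hν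
  have hμ : (a - b + (r : ℕ)) / 3 + p = 1 / 3 * ν := by rw [hν]; push_cast; ring
  rw [hμ, sign_mul_of_pos _ (by norm_num), V]
  have e1 : a + (((3 : ℕ) * p + (r : ℕ) + j : ℤ) : ℝ) - (b + (j : ℤ)) = ν := by
    rw [hν]; push_cast; ring
  rw [e1, show 2 * (1 / 3 * ν) ^ 2 * (30 * τ).im = 20 / 3 * ν ^ 2 * τ.im by
    rw [show (30 * τ).im = 30 * τ.im by simp]; ring]
  have e2 : (-1 : ℂ) ^ ((k : ℤ) * ((3 : ℕ) * p + (r : ℕ) + j) + l * j) =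
      (-1) ^ (-(5 * p)) * ((-1) ^ j * (-1) ^ ((k : ℤ) * (3 * p + r) + p)) := by
    rw [← zpow_add₀ (by simp), ← zpow_add₀ (by simp)]
    refine neg_one_zpow_congr (j := 2 * p) ?_
    push_cast
    linear_combination j * hkl'
  rw [e2, show e ((5 * ((a + (((3 : ℕ) * p + (r : ℕ) + j : ℤ) : ℝ) : ℝ) : ℂ) ^ 2 -
      2 * ((b + (j : ℤ) : ℝ) : ℂ) ^ 2) / 2 * τ) =
      e (3 / 2 * ((b : ℂ) + 5 / 3 * (a - b + ((3 : ℕ) * p + (r : ℕ) : ℤ)) + j) ^ 2 * τ) *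
      e (-15 * ((1 / 3 * ν : ℝ) : ℂ) ^ 2 * τ) by
    rw [← e_add]
    congr 1
    rw [hν]; push_cast; ring]
  ring

/-- The leftover sign (-1)^p is the phase e(-5p/2); this produces the second parameter 5/2 of `R`,
and the constant in front undoes the phase at p = 0. -/
lemma Bt_zero_one (a b : ℝ) {τ : ℂ} (hτ : 0 < τ.im) :
    Bt a b 0 1 τ = ∑ r : Fin 3, Phi (b + 5 / 3 * (a - b + (r : ℕ))) τ *
      (e (5 / 2 * ((a - b + (r : ℕ)) / 3)) * R ((a - b + (r : ℕ)) / 3) (5 / 2) (30 * τ)) := by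
  rw [Bt_eq_sum a b 0 1 hτ rfl]
  refine Finset.sum_congr rfl fun r _ => ?_
  refine congrArg _ ?_
  rw [R, ← tsum_mul_left]
  refine tsum_congr fun p => ?_
  rw [mul_assoc, mul_left_comm (e _)]
  congr 1
  rw [neg_one_zpow_congr (n := p) (j := 0) (by simp), neg_one_zpow_eq_e, ← e_add,
    show ∀ x, Complex.exp x = e (x / (2 * Real.pi * I)) from fun x => by
      rw [e, mul_div_cancel₀ _ two_pi_I_ne_zero], ← e_add]
  refine e_eq_of_eq_add_int (3 * p) ?_
  have := two_pi_I_ne_zero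
  have := Real.pi_ne_zero
  push_cast
  field_simp
  ring

/-- The sign coming from the first index cancels the (-1)^p, so only (-1)^r survives and the second
parameter of `R` is 0. -/
lemma Bt_one_zero (a b : ℝ) {τ : ℂ} (hτ : 0 < τ.im) :
    Bt a b 1 0 τ = ∑ r : Fin 3, Phi (b + 5 / 3 * (a - b + (r : ℕ))) τ *
      ((-1) ^ (r : ℕ) * R ((a - b + (r : ℕ)) / 3) 0 (30 * τ)) := by
  rw [Bt_eq_sum a b 1 0 hτ rfl]
  refine Finset.sum_congr rfl fun r _ => ?_
  refine congrArg _ ?_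
  rw [R, ← tsum_mul_left]
  refine tsum_congr fun p => ?_
  rw [mul_assoc, mul_left_comm ((-1) ^ (r : ℕ))]
  congr 1
  rw [neg_one_zpow_congr (n := (r : ℕ)) (j := 2 * p) (by push_cast; ring), zpow_natCast, mul_comm,
    e]
  congr 2
  push_cast
  ring

lemma R_add_int (a b : ℝ) (n : ℤ) (τ : ℂ) : R (a + n) b τ = R a b τ := by
  conv_rhs => rw [R, ← (Equiv.addRight n).tsum_eq]
  refine tsum_congr fun j => ?_
  simp only [Equiv.coe_addRight]
  push_cast
  rw [show a + n + (j : ℝ) = a + (j + n) by ring, show (a : ℂ) + n + (j : ℂ) = a + (j + n) by ring]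

/-! ### The holomorphic parts are the mock theta functions -/

lemma sign_add_sign_eq_two {x z : ℝ} (h : |z| < x) : Real.sign (x - z) + Real.sign (x + z) = 2 := by
  obtain ⟨h1, h2⟩ := abs_lt.1 h
  rw [Real.sign_of_pos (by linarith), Real.sign_of_pos (by linarith)]; norm_num

lemma sign_add_sign_eq_neg_two {x z : ℝ} (h : |z| < -x) :
    Real.sign (x - z) + Real.sign (x + z) = -2 := by
  obtain ⟨h1, h2⟩ := abs_lt.1 h
  rw [Real.sign_of_neg (by linarith), Real.sign_of_neg (by linarith)]; norm_num

lemma sign_add_sign_eq_zero {x z : ℝ} (h : |x| < |z|) :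
    Real.sign (x - z) + Real.sign (x + z) = 0 := by
  rcases le_total 0 z with hz | hz
  · rw [abs_of_nonneg hz, abs_lt] at h
    rw [Real.sign_of_neg (by linarith), Real.sign_of_pos (by linarith)]; norm_num
  · rw [abs_of_nonpos hz, abs_lt] at h
    rw [Real.sign_of_pos (by linarith), Real.sign_of_neg (by linarith)]; norm_num

/-- The exponential part of the summand of `Th`. -/
def qTerm (a b : ℝ) (k l : ℕ) (τ : ℂ) (m j : ℤ) : ℂ :=
  e ((5 * ((a : ℂ) + m) ^ 2 - 2 * ((b : ℂ) + j) ^ 2) / 2 * τ) * (-1) ^ ((k : ℤ) * m + (l : ℤ) * j)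

lemma tsum_S_fiber {a b : ℝ} {k l : ℕ} {m : ℤ} {u : Finset ℤ} (c : ℝ) (τ : ℂ)
    (h1 : ∀ j ∈ u, Real.sign (a + m - (b + j)) + Real.sign (a + m + (b + j)) = c)
    (h0 : ∀ j : ℤ, j ∉ u → |a + m| < |b + j|) :
    ∑' j : ℤ, S (a + m) (b + j) τ * (-1) ^ ((k : ℤ) * m + (l : ℤ) * j) =
      c * ∑ j ∈ u, qTerm a b k l τ m j := by
  rw [tsum_eq_sum (s := u) fun j hj => by
    rw [S, sign_add_sign_eq_zero (h0 j hj), ofReal_zero, zero_mul, zero_mul], Finset.mul_sum]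
  refine Finset.sum_congr rfl fun j hj => ?_
  rw [S, h1 j hj, mul_assoc, qTerm]
  push_cast
  rfl

/-- Each row of the cone is finite, with sign sum +2 for m ≥ 0 and -2 for m < 0. Pairing the rows n
and -(n+1) prepares the factors 1 ± q^{...} of the Hecke sums. -/
lemma hasSum_S_nat {a b : ℝ} {k l : ℕ} (s t : ℕ → Finset ℤ) {τ : ℂ} (hτ : 0 < τ.im)
    (hs : ∀ n : ℕ, ∀ j ∈ s n, |b + j| < a + n)
    (hs' : ∀ n : ℕ, ∀ j : ℤ, j ∉ s n → |a + n| < |b + j|)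
    (ht : ∀ n : ℕ, ∀ j ∈ t n, |b + j| < -(a - (n + 1)))
    (ht' : ∀ n : ℕ, ∀ j : ℤ, j ∉ t n → |a - (n + 1)| < |b + j|) :
    HasSum (fun n : ℕ => 2 * (∑ j ∈ s n, qTerm a b k l τ n j -
      ∑ j ∈ t n, qTerm a b k l τ (-(n + 1)) j))
      (Th a b k l τ + Bt a b k l τ + Bt a (-b) k l τ) := by
  have h := hasSum_S a b k l hτ
  refine ((h.prod_fiberwise fun n =>
    (h.summable.prod_factor n).hasSum).nat_add_neg_add_one).congr_fun fun n => ?_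
  rw [tsum_S_fiber (u := s n) 2 τ (fun j hj => sign_add_sign_eq_two (by simpa using hs n j hj))
      (fun j hj => by simpa using hs' n j hj),
    tsum_S_fiber (u := t n) (-2) τ (fun j hj => sign_add_sign_eq_neg_two (by
      push_cast; rw [← sub_eq_add_neg]; exact ht n j hj))
      (fun j hj => by push_cast; rw [← sub_eq_add_neg]; exact ht' n j hj)]
  push_cast
  ring

/-- Triangular numbers of even index 2j and of odd index -2j - 1 (j negative) are both 2j² + j. -/
lemma sum_range_triangular (φ : ℤ → ℂ) (n : ℕ) :
    ∑ j ∈ Finset.range (2 * n + 1), φ ((j : ℤ) * (j + 1) / 2) =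
      ∑ j ∈ Finset.Icc (-(n : ℤ)) n, φ (2 * j ^ 2 + j) := by
  induction n with
  | zero => simp
  | succ n ih =>
    push_cast
    rw [Finset.Icc_succ_succ, Finset.sum_union (by simp), Finset.sum_pair (by lia), ← ih,
      show 2 * (n + 1) + 1 = 2 * n + 1 + 1 + 1 by ring, Finset.sum_range_succ,
      Finset.sum_range_succ, add_assoc]
    congr 3
    · push_cast
      rw [show ((2 * n + 1 : ℤ) * (2 * n + 1 + 1)) = 2 * (2 * (-(n + 1)) ^ 2 + -(n + 1)) by ring,
        Int.mul_ediv_cancel_left _ two_ne_zero]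
    · push_cast
      rw [show ((2 * n + 2 : ℤ) * (2 * n + 2 + 1)) = 2 * (2 * (n + 1) ^ 2 + (n + 1)) by ring,
        Int.mul_ediv_cancel_left _ two_ne_zero]

lemma abs_add_lt_of_mem_Icc {a b : ℝ} {n : ℕ} {j : ℤ} (h1 : b < a) (h2 : -b < a)
    (hj : j ∈ Finset.Icc (-(n : ℤ)) n) : |b + j| < a + n := by
  rw [Finset.mem_Icc] at hj
  have h3 : (-(n : ℝ)) ≤ j := by exact_mod_cast hj.1
  have h4 : (j : ℝ) ≤ n := by exact_mod_cast hj.2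
  rw [abs_lt]; constructor <;> linarith

lemma lt_abs_add_of_notMem_Icc {a b : ℝ} {n : ℕ} {j : ℤ} (h1 : a < b + 1) (h2 : a < 1 - b)
    (hj : j ∉ Finset.Icc (-(n : ℤ)) n) : a + n < |b + j| := by
  rw [Finset.mem_Icc, not_and_or, not_le, not_le] at hj
  rw [lt_abs]
  rcases hj with hj | hj
  · have h3 : (j : ℝ) + 1 ≤ -n := by exact_mod_cast hj
    right; linarith
  · have h3 : (n : ℝ) + 1 ≤ j := by exact_mod_cast hj
    left; linarith

/-- The inequalities on a and b say that the rows n and -(n+1), of half-widths n + a and n + 1 - a,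
both contain exactly the indices |j| ≤ n. -/
lemma hasSum_S_nat_Icc {a b : ℝ} {k l : ℕ} {τ : ℂ} (hτ : 0 < τ.im) (hb : 0 ≤ b) (ha : b < a)
    (hab : a + b < 1) :
    HasSum (fun n : ℕ => ∑ j ∈ Finset.Icc (-(n : ℤ)) n, 2 * (qTerm a b k l τ n j -
      qTerm a b k l τ (-(n + 1)) j)) (Th a b k l τ + Bt a b k l τ + Bt a (-b) k l τ) := by
  have habs (n : ℕ) : |a - (n + 1)| = 1 - a + n := by
    rw [abs_sub_comm, abs_of_pos]
    · ring
    · have : (0 : ℝ) ≤ n := n.cast_nonneg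
      linarith
  refine (hasSum_S_nat (fun n => Finset.Icc (-(n : ℤ)) n) (fun n => Finset.Icc (-(n : ℤ)) n) hτ
    (fun n j hj => abs_add_lt_of_mem_Icc ha (by linarith) hj) (fun n j hj => ?_)
    (fun n j hj => ?_) (fun n j hj => ?_)).congr_fun fun n => ?_
  · rw [abs_of_nonneg (by have : (0 : ℝ) ≤ n := n.cast_nonneg
                          linarith)]
    exact lt_abs_add_of_notMem_Icc (by linarith) (by linarith) hj
  · rw [show -(a - ((n : ℝ) + 1)) = 1 - a + n by ring]
    exact abs_add_lt_of_mem_Icc (by linarith) (by linarith) hj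
  · rw [habs]
    exact lt_abs_add_of_notMem_Icc (by linarith) (by linarith) hj
  · rw [← Finset.sum_sub_distrib, Finset.mul_sum]

lemma e_mul_zpow_mul_pow (c τ : ℂ) (m : ℤ) (n : ℕ) :
    e c * (e τ ^ m * e τ ^ n) = e (c + (m + n) * τ) := by
  rw [e_zpow, e_pow, ← e_add, ← e_add]; ring_nf

lemma e_mul_zpow (c τ : ℂ) (m : ℤ) : e c * e τ ^ m = e (c + m * τ) := by
  rw [e_zpow, ← e_add]

lemma holomorphic_part_one {τ : ℂ} (hτ : 0 < τ.im) :
    Th (1 / 10) 0 0 1 τ + Bt (1 / 10) 0 0 1 τ + Bt (1 / 10) (-0) 0 1 τ =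
      2 * e (τ / 40) * (qInf (e τ) * f0 (e τ)) := by
  rw [f0, mul_inv_cancel_left₀ (qInf_ne_zero (norm_e_lt_one hτ)), ← tsum_mul_left]
  refine ((hasSum_S_nat_Icc hτ le_rfl (by norm_num) (by norm_num)).congr_fun fun n => ?_).tsum_eq.symm
  rw [Finset.mul_sum]
  refine Finset.sum_congr rfl fun j _ => ?_
  obtain ⟨m, hm⟩ : ∃ m : ℤ, 5 * (n : ℤ) ^ 2 + n = 2 * m := by
    obtain ⟨i, hi⟩ := Int.even_mul_succ_self n
    exact ⟨2 * (n : ℤ) ^ 2 + i, by linear_combination hi⟩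
  have hm' : (5 * n ^ 2 + n : ℂ) = 2 * m := by exact_mod_cast hm
  rw [hm, Int.mul_ediv_cancel_left _ two_ne_zero, qTerm, qTerm]
  have h1 := e_mul_zpow (τ / 40) τ (m - j ^ 2)
  have h2 := e_mul_zpow_mul_pow (τ / 40) τ (m - j ^ 2) (4 * n + 2)
  have h3 : e ((5 * (((1 / 10 : ℝ) : ℂ) + (n : ℤ)) ^ 2 - 2 * (((0 : ℝ) : ℂ) + j) ^ 2) / 2 * τ) =
      e (τ / 40 + (m - j ^ 2 : ℤ) * τ) := by
    congr 1; push_cast; linear_combination τ / 2 * hm'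
  have h4 : e ((5 * (((1 / 10 : ℝ) : ℂ) + (-(n + 1) : ℤ)) ^ 2 - 2 * (((0 : ℝ) : ℂ) + j) ^ 2) / 2 * τ) =
      e (τ / 40 + ((m - j ^ 2 : ℤ) + (4 * n + 2 : ℕ)) * τ) := by
    congr 1; push_cast; linear_combination τ / 2 * hm'
  rw [h3, h4, ← h1, ← h2]
  simp only [Nat.cast_zero, zero_mul, zero_add, Nat.cast_one, one_mul]
  ring

lemma holomorphic_part_two {τ : ℂ} (hτ : 0 < τ.im) :
    Th (3 / 10) 0 0 1 τ + Bt (3 / 10) 0 0 1 τ + Bt (3 / 10) (-0) 0 1 τ =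
      2 * e (9 * τ / 40) * (qInf (e τ) * f1 (e τ)) := by
  rw [f1, mul_inv_cancel_left₀ (qInf_ne_zero (norm_e_lt_one hτ)), ← tsum_mul_left]
  refine ((hasSum_S_nat_Icc hτ le_rfl (by norm_num) (by norm_num)).congr_fun fun n => ?_).tsum_eq.symm
  rw [Finset.mul_sum]
  refine Finset.sum_congr rfl fun j _ => ?_
  obtain ⟨m, hm⟩ : ∃ m : ℤ, 5 * (n : ℤ) ^ 2 + 3 * n = 2 * m := by
    obtain ⟨i, hi⟩ := Int.even_mul_succ_self n
    exact ⟨(n : ℤ) ^ 2 + 3 * i, by linear_combination 3 * hi⟩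
  have hm' : (5 * n ^ 2 + 3 * n : ℂ) = 2 * m := by exact_mod_cast hm
  rw [hm, Int.mul_ediv_cancel_left _ two_ne_zero, qTerm, qTerm]
  have h1 := e_mul_zpow (9 * τ / 40) τ (m - j ^ 2)
  have h2 := e_mul_zpow_mul_pow (9 * τ / 40) τ (m - j ^ 2) (2 * n + 1)
  have h3 : e ((5 * (((3 / 10 : ℝ) : ℂ) + (n : ℤ)) ^ 2 - 2 * (((0 : ℝ) : ℂ) + j) ^ 2) / 2 * τ) =
      e (9 * τ / 40 + (m - j ^ 2 : ℤ) * τ) := by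
    congr 1; push_cast; linear_combination τ / 2 * hm'
  have h4 : e ((5 * (((3 / 10 : ℝ) : ℂ) + (-(n + 1) : ℤ)) ^ 2 - 2 * (((0 : ℝ) : ℂ) + j) ^ 2) / 2 * τ) =
      e (9 * τ / 40 + ((m - j ^ 2 : ℤ) + (2 * n + 1 : ℕ)) * τ) := by
    congr 1; push_cast; linear_combination τ / 2 * hm'
  rw [h3, h4, ← h1, ← h2]
  simp only [Nat.cast_zero, zero_mul, zero_add, Nat.cast_one, one_mul]
  ring

lemma e_half_sq (τ : ℂ) : e (τ / 2) ^ 2 = e τ := by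
  rw [e_pow]; congr 1; push_cast; ring

lemma neg_one_zpow_neg_succ (n : ℕ) : (-1 : ℂ) ^ (-((n : ℤ) + 1)) = -(-1) ^ n := by
  rw [neg_one_zpow_congr (n := n + 1) (j := -(n + 1)) (by ring)]
  exact_mod_cast pow_succ' (-1 : ℂ) n |>.trans (neg_one_mul _)

lemma holomorphic_part_four {τ : ℂ} (hτ : 0 < τ.im) :
    Th (2 / 5) (1 / 4) 1 0 τ + Bt (2 / 5) (1 / 4) 1 0 τ + Bt (2 / 5) (-(1 / 4)) 1 0 τ =
      2 * e (27 * τ / 80) * (qInf (e τ) * F1 (e (τ / 2))) := by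
  rw [F1, e_half_sq, mul_inv_cancel_left₀ (qInf_ne_zero (norm_e_lt_one hτ)), ← tsum_mul_left]
  refine ((hasSum_S_nat_Icc hτ (by norm_num) (by norm_num) (by norm_num)).congr_fun
    fun n => ?_).tsum_eq.symm
  rw [sum_range_triangular (fun t => (-1 : ℂ) ^ n * e (τ / 2) ^ (5 * (n : ℤ) ^ 2 + 4 * n - t) *
    (1 + e (τ / 2) ^ (2 * n + 1))), Finset.mul_sum]
  refine Finset.sum_congr rfl fun j _ => ?_
  rw [qTerm, qTerm]
  have h1 := e_mul_zpow (27 * τ / 80) (τ / 2) (5 * (n : ℤ) ^ 2 + 4 * n - (2 * j ^ 2 + j))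
  have h2 := e_mul_zpow_mul_pow (27 * τ / 80) (τ / 2)
    (5 * (n : ℤ) ^ 2 + 4 * n - (2 * j ^ 2 + j)) (2 * n + 1)
  rw [show e ((5 * (((2 / 5 : ℝ) : ℂ) + (n : ℤ)) ^ 2 - 2 * (((1 / 4 : ℝ) : ℂ) + j) ^ 2) / 2 * τ) =
      e (27 * τ / 80 + (5 * (n : ℤ) ^ 2 + 4 * n - (2 * j ^ 2 + j) : ℤ) * (τ / 2)) by
    congr 1; push_cast; ring, ← h1]
  rw [show e ((5 * (((2 / 5 : ℝ) : ℂ) + (-(n + 1) : ℤ)) ^ 2 -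
      2 * (((1 / 4 : ℝ) : ℂ) + j) ^ 2) / 2 * τ) =
      e (27 * τ / 80 + ((5 * (n : ℤ) ^ 2 + 4 * n - (2 * j ^ 2 + j) : ℤ) + (2 * n + 1 : ℕ)) *
        (τ / 2)) by congr 1; push_cast; ring, ← h2]
  simp only [Nat.cast_zero, zero_mul, add_zero, Nat.cast_one, one_mul]
  rw [neg_one_zpow_neg_succ, zpow_natCast]
  ring

/-- Here b = 1/4 exceeds a = 1/5, so compared with the Hecke sum of F₀ row n misses the diagonal
point j = n and row -(n+1) has the additional diagonal point j = -(n+1). Together these diagonal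
terms run over all of ℤ and sum to e(-τ/240)η(τ); this is the -1 in -1 + F₀. -/
lemma holomorphic_part_three {τ : ℂ} (hτ : 0 < τ.im) :
    Th (1 / 5) (1 / 4) 1 0 τ + Bt (1 / 5) (1 / 4) 1 0 τ + Bt (1 / 5) (-(1 / 4)) 1 0 τ +
      2 * e (-τ / 240) * ModularForm.eta τ =
      2 * e (3 * τ / 80) * (qInf (e τ) * F0 (e (τ / 2))) := by
  rw [F0, e_half_sq, mul_inv_cancel_left₀ (qInf_ne_zero (norm_e_lt_one hτ)), ← tsum_mul_left]
  have hη := (hasSum_eta hτ).nat_add_neg_add_one.mul_left (2 * e (-τ / 240))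
  have hS := hasSum_S_nat (a := 1 / 5) (b := 1 / 4) (k := 1) (l := 0)
    (fun n => Finset.Ico (-(n : ℤ)) n) (fun n => Finset.Icc (-(n : ℤ) - 1) n) hτ
    (fun n j hj => by
      rw [Finset.mem_Ico] at hj
      have h3 : (-(n : ℝ)) ≤ j := by exact_mod_cast hj.1
      have h4 : (j : ℝ) + 1 ≤ n := by exact_mod_cast hj.2
      rw [abs_lt]; constructor <;> linarith)
    (fun n j hj => by
      rw [Finset.mem_Ico, not_and_or, not_le, not_lt] at hj
      have : (0 : ℝ) ≤ n := n.cast_nonneg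
      rw [abs_of_nonneg (by linarith), lt_abs]
      rcases hj with hj | hj
      · have h3 : (j : ℝ) + 1 ≤ -n := by exact_mod_cast hj
        right; linarith
      · have h3 : (n : ℝ) ≤ j := by exact_mod_cast hj
        left; linarith)
    (fun n j hj => by
      rw [Finset.mem_Icc] at hj
      have h3 : (-(n : ℝ)) - 1 ≤ j := by exact_mod_cast hj.1
      have h4 : (j : ℝ) ≤ n := by exact_mod_cast hj.2
      rw [abs_lt]; constructor <;> linarith)
    (fun n j hj => by
      rw [Finset.mem_Icc, not_and_or, not_le, not_le] at hj
      have : (0 : ℝ) ≤ n := n.cast_nonneg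
      rw [abs_of_nonpos (by linarith), lt_abs]
      rcases hj with hj | hj
      · have h3 : (j : ℝ) + 1 ≤ -n - 1 := by exact_mod_cast hj
        right; linarith
      · have h3 : (n : ℝ) + 1 ≤ j := by exact_mod_cast hj
        left; linarith)
  refine ((hS.add hη).congr_fun fun n => ?_).tsum_eq.symm
  rw [sum_range_triangular (fun t => (-1 : ℂ) ^ n * e (τ / 2) ^ (5 * (n : ℤ) ^ 2 + 2 * n - t) *
    (1 + e (τ / 2) ^ (6 * n + 3))), Finset.mul_sum]
  have hn : -(n : ℤ) ≤ n := by lia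
  have g1 : ∑ j ∈ Finset.Ico (-(n : ℤ)) n, qTerm (1 / 5) (1 / 4) 1 0 τ n j =
      ∑ j ∈ Finset.Icc (-(n : ℤ)) n, qTerm (1 / 5) (1 / 4) 1 0 τ n j -
        qTerm (1 / 5) (1 / 4) 1 0 τ n n := by
    rw [← Finset.Ico_insert_right hn, Finset.sum_insert (by simp)]; ring
  have g2 : ∑ j ∈ Finset.Icc (-(n : ℤ) - 1) n, qTerm (1 / 5) (1 / 4) 1 0 τ (-(n + 1)) j =
      ∑ j ∈ Finset.Icc (-(n : ℤ)) n, qTerm (1 / 5) (1 / 4) 1 0 τ (-(n + 1)) j +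
        qTerm (1 / 5) (1 / 4) 1 0 τ (-(n + 1)) (-(n + 1)) := by
    rw [show Finset.Icc (-(n : ℤ) - 1) n = insert (-((n : ℤ) + 1)) (Finset.Icc (-(n : ℤ)) n) by
      ext; simp only [Finset.mem_insert, Finset.mem_Icc]; lia, Finset.sum_insert (by simp)]
    ring
  have g3 (m : ℤ) : qTerm (1 / 5) (1 / 4) 1 0 τ m m =
      e (-τ / 240) * ((-1) ^ m * e (3 / 2 * ((m : ℂ) + 1 / 6) ^ 2 * τ)) := by
    rw [qTerm, mul_left_comm, ← e_add, mul_comm]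
    simp only [Nat.cast_zero, zero_mul, add_zero, Nat.cast_one, one_mul]
    congr 2
    push_cast; ring
  rw [g1, g2, g3, g3]
  have g4 : ∀ j ∈ Finset.Icc (-(n : ℤ)) n, 2 * e (3 * τ / 80) * ((-1 : ℂ) ^ n *
      e (τ / 2) ^ (5 * (n : ℤ) ^ 2 + 2 * n - (2 * j ^ 2 + j)) * (1 + e (τ / 2) ^ (6 * n + 3))) =
      2 * (qTerm (1 / 5) (1 / 4) 1 0 τ n j - qTerm (1 / 5) (1 / 4) 1 0 τ (-(n + 1)) j) := by
    intro j _
    rw [qTerm, qTerm]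
    have h1 := e_mul_zpow (3 * τ / 80) (τ / 2) (5 * (n : ℤ) ^ 2 + 2 * n - (2 * j ^ 2 + j))
    have h2 := e_mul_zpow_mul_pow (3 * τ / 80) (τ / 2)
      (5 * (n : ℤ) ^ 2 + 2 * n - (2 * j ^ 2 + j)) (6 * n + 3)
    rw [show e ((5 * (((1 / 5 : ℝ) : ℂ) + (n : ℤ)) ^ 2 - 2 * (((1 / 4 : ℝ) : ℂ) + j) ^ 2) / 2 * τ) =
        e (3 * τ / 80 + (5 * (n : ℤ) ^ 2 + 2 * n - (2 * j ^ 2 + j) : ℤ) * (τ / 2)) by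
      congr 1; push_cast; ring, ← h1]
    rw [show e ((5 * (((1 / 5 : ℝ) : ℂ) + (-(n + 1) : ℤ)) ^ 2 -
        2 * (((1 / 4 : ℝ) : ℂ) + j) ^ 2) / 2 * τ) =
        e (3 * τ / 80 + ((5 * (n : ℤ) ^ 2 + 2 * n - (2 * j ^ 2 + j) : ℤ) + (6 * n + 3 : ℕ)) *
          (τ / 2)) by congr 1; push_cast; ring, ← h2]
    simp only [Nat.cast_zero, zero_mul, add_zero, Nat.cast_one, one_mul]
    rw [neg_one_zpow_neg_succ, zpow_natCast]
    ring
  rw [Finset.sum_congr rfl g4, ← Finset.mul_sum, Finset.sum_sub_distrib]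
  push_cast
  ring

/-! ### The decomposition -/

lemma Phi_of_eq_add {c τ : ℂ} (hτ : 0 < τ.im) (n : ℤ) (h : c = 1 / 6 + n) :
    Phi c τ = (-1) ^ n * ModularForm.eta τ := by
  rw [h, Phi_add_int, Phi_one_sixth hτ]

lemma Phi_of_eq_sub {c τ : ℂ} (hτ : 0 < τ.im) (n : ℤ) (h : c = -(1 / 6) + n) :
    Phi c τ = (-1) ^ n * ModularForm.eta τ := by
  rw [h, Phi_add_int, Phi_neg, Phi_one_sixth hτ]

lemma Phi_of_eq_half {c : ℂ} (τ : ℂ) (n : ℤ) (h : c = 1 / 2 + n) : Phi c τ = 0 := by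
  rw [h, Phi_add_int, Phi_half, mul_zero]

/-- Of the three classes in `Bt_zero_one`, two have unary shift ±1/6 modulo 1 and give a multiple of
η, and the third has shift 1/2 and vanishes. The same pattern holds for the next three components.
In this one c₁ and c₂ contribute equally because b = 0, whence the coefficients 2 in G. -/
lemma decomposition_zero {τ : ℂ} (hτ : 0 < τ.im) : F51 τ 0 = H51 τ 0 + G51 τ 0 := by
  have hη := eta_ne_zero hτ
  have hq := qInf_ne_zero (norm_e_lt_one hτ)
  have hB : Bt (1 / 10) 0 0 1 τ = ModularForm.eta τ *
      (e (1 / 12) * R (1 / 30) (5 / 2) (30 * τ) + e (-1 / 12) * R (11 / 30) (5 / 2) (30 * τ)) := by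
    rw [Bt_zero_one _ _ hτ, Fin.sum_univ_three,
      Phi_of_eq_add hτ 0 (by push_cast; norm_num), Phi_of_eq_sub hτ 2 (by push_cast; norm_num),
      Phi_of_eq_half τ 3 (by push_cast; norm_num),
      show (1 / 10 - 0 + ((0 : Fin 3) : ℕ) : ℝ) / 3 = 1 / 30 by norm_num,
      show (1 / 10 - 0 + ((1 : Fin 3) : ℕ) : ℝ) / 3 = 11 / 30 by norm_num,
      e_eq_of_eq_add_int (x := 5 / 2 * (_ / 3)) (y := 1 / 12) 0 (by push_cast; norm_num),
      e_eq_of_eq_add_int (x := 5 / 2 * (_ / 3)) (y := -1 / 12) 1 (by push_cast; norm_num)]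
    norm_num
    ring
  have h := holomorphic_part_one hτ
  rw [neg_zero, hB] at h
  have hT : Th (1 / 10) 0 0 1 τ = 2 * (ModularForm.eta τ * (e (-τ / 60) * f0 (e τ) -
      (e (1 / 12) * R (1 / 30) (5 / 2) (30 * τ) + e (-1 / 12) * R (11 / 30) (5 / 2) (30 * τ)))) := by
    have h1 : e (τ / 40) = e (τ / 24) * e (-τ / 60) := by rw [← e_add]; congr 1; ring
    rw [h1] at h
    have h2 := eta_eq τ
    linear_combination h - 2 * e (-τ / 60) * f0 (e τ) * h2
  rw [H51_eq, G51, G51aux, F51]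
  simp only [Pi.smul_apply, Matrix.cons_val_zero, smul_eq_mul, zeta]
  rw [hT]
  field_simp
  push_cast
  ring_nf

lemma decomposition_one {τ : ℂ} (hτ : 0 < τ.im) : F51 τ 1 = H51 τ 1 + G51 τ 1 := by
  have hη := eta_ne_zero hτ
  have hq := qInf_ne_zero (norm_e_lt_one hτ)
  have hB : Bt (3 / 10) 0 0 1 τ = ModularForm.eta τ *
      (e (1 / 12) * R (13 / 30) (5 / 2) (30 * τ) + e (-1 / 12) * R (23 / 30) (5 / 2) (30 * τ)) := by
    rw [Bt_zero_one _ _ hτ, Fin.sum_univ_three,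
      Phi_of_eq_half τ 0 (by push_cast; norm_num), Phi_of_eq_add hτ 2 (by push_cast; norm_num),
      Phi_of_eq_sub hτ 4 (by push_cast; norm_num),
      show (3 / 10 - 0 + ((1 : Fin 3) : ℕ) : ℝ) / 3 = 13 / 30 by norm_num,
      show (3 / 10 - 0 + ((2 : Fin 3) : ℕ) : ℝ) / 3 = 23 / 30 by norm_num,
      e_eq_of_eq_add_int (x := 5 / 2 * ((_ + (((1 : Fin 3) : ℕ) : ℂ)) / 3)) (y := 1 / 12) 1
        (by push_cast; norm_num),
      e_eq_of_eq_add_int (x := 5 / 2 * ((_ + (((2 : Fin 3) : ℕ) : ℂ)) / 3)) (y := -1 / 12) 2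
        (by push_cast; norm_num)]
    norm_num
    ring
  have h := holomorphic_part_two hτ
  rw [neg_zero, hB] at h
  have hT : Th (3 / 10) 0 0 1 τ = 2 * (ModularForm.eta τ * (e (11 * τ / 60) * f1 (e τ) -
      (e (1 / 12) * R (13 / 30) (5 / 2) (30 * τ) + e (-1 / 12) * R (23 / 30) (5 / 2) (30 * τ)))) := by
    have h1 : e (9 * τ / 40) = e (τ / 24) * e (11 * τ / 60) := by rw [← e_add]; congr 1; ring
    rw [h1] at h
    have h2 := eta_eq τ
    linear_combination h - 2 * e (11 * τ / 60) * f1 (e τ) * h2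
  rw [H51_eq, G51, G51aux, F51]
  simp only [Pi.smul_apply, Matrix.cons_val_one, Matrix.cons_val_zero, smul_eq_mul, zeta]
  rw [hT]
  field_simp
  push_cast
  ring_nf

lemma decomposition_two {τ : ℂ} (hτ : 0 < τ.im) : F51 τ 2 = H51 τ 2 + G51 τ 2 := by
  have hη := eta_ne_zero hτ
  have hq := qInf_ne_zero (norm_e_lt_one hτ)
  have hB : Bt (1 / 5) (1 / 4) 1 0 τ = ModularForm.eta τ *
      (R (59 / 60) 0 (30 * τ) - R (19 / 60) 0 (30 * τ)) := by
    rw [Bt_one_zero _ _ hτ, Fin.sum_univ_three,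
      Phi_of_eq_add hτ 0 (by push_cast; norm_num), Phi_of_eq_sub hτ 2 (by push_cast; norm_num),
      Phi_of_eq_half τ 3 (by push_cast; norm_num),
      show (1 / 5 - 1 / 4 + ((0 : Fin 3) : ℕ) : ℝ) / 3 = 59 / 60 + (-1 : ℤ) by norm_num,
      show (1 / 5 - 1 / 4 + ((1 : Fin 3) : ℕ) : ℝ) / 3 = 19 / 60 by norm_num, R_add_int]
    norm_num
    ring
  have hB' : Bt (1 / 5) (-(1 / 4)) 1 0 τ = ModularForm.eta τ *
      (R (49 / 60) 0 (30 * τ) - R (29 / 60) 0 (30 * τ)) := by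
    rw [Bt_one_zero _ _ hτ, Fin.sum_univ_three,
      Phi_of_eq_half τ 0 (by push_cast; norm_num), Phi_of_eq_add hτ 2 (by push_cast; norm_num),
      Phi_of_eq_sub hτ 4 (by push_cast; norm_num),
      show (1 / 5 - -(1 / 4) + ((1 : Fin 3) : ℕ) : ℝ) / 3 = 29 / 60 by norm_num,
      show (1 / 5 - -(1 / 4) + ((2 : Fin 3) : ℕ) : ℝ) / 3 = 49 / 60 by norm_num]
    norm_num
    ring
  have h := holomorphic_part_three hτ
  rw [hB, hB'] at h
  have hT : Th (1 / 5) (1 / 4) 1 0 τ = 2 * (ModularForm.eta τ * (e (-τ / 240) *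
      (-1 + F0 (e (τ / 2))) - (R (59 / 60) 0 (30 * τ) - R (19 / 60) 0 (30 * τ) +
      R (49 / 60) 0 (30 * τ) - R (29 / 60) 0 (30 * τ)) / 2)) := by
    have h1 : e (3 * τ / 80) = e (τ / 24) * e (-τ / 240) := by rw [← e_add]; congr 1; ring
    rw [h1] at h
    have h2 := eta_eq τ
    linear_combination h - 2 * e (-τ / 240) * F0 (e (τ / 2)) * h2
  rw [H51_eq, G51, G51aux, F51]
  simp only [Pi.smul_apply, Matrix.cons_val, smul_eq_mul]
  rw [hT]
  field_simp
  ring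

lemma decomposition_three {τ : ℂ} (hτ : 0 < τ.im) : F51 τ 3 = H51 τ 3 + G51 τ 3 := by
  have hη := eta_ne_zero hτ
  have hq := qInf_ne_zero (norm_e_lt_one hτ)
  have hB : Bt (2 / 5) (1 / 4) 1 0 τ = ModularForm.eta τ *
      (R (43 / 60) 0 (30 * τ) - R (23 / 60) 0 (30 * τ)) := by
    rw [Bt_one_zero _ _ hτ, Fin.sum_univ_three,
      Phi_of_eq_half τ 0 (by push_cast; norm_num), Phi_of_eq_add hτ 2 (by push_cast; norm_num),
      Phi_of_eq_sub hτ 4 (by push_cast; norm_num),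
      show (2 / 5 - 1 / 4 + ((1 : Fin 3) : ℕ) : ℝ) / 3 = 23 / 60 by norm_num,
      show (2 / 5 - 1 / 4 + ((2 : Fin 3) : ℕ) : ℝ) / 3 = 43 / 60 by norm_num]
    norm_num
    ring
  have hB' : Bt (2 / 5) (-(1 / 4)) 1 0 τ = ModularForm.eta τ *
      (R (53 / 60) 0 (30 * τ) - R (13 / 60) 0 (30 * τ)) := by
    rw [Bt_one_zero _ _ hτ, Fin.sum_univ_three,
      Phi_of_eq_sub hτ 1 (by push_cast; norm_num), Phi_of_eq_half τ 2 (by push_cast; norm_num),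
      Phi_of_eq_add hτ 4 (by push_cast; norm_num),
      show (2 / 5 - -(1 / 4) + ((0 : Fin 3) : ℕ) : ℝ) / 3 = 13 / 60 by norm_num,
      show (2 / 5 - -(1 / 4) + ((2 : Fin 3) : ℕ) : ℝ) / 3 = 53 / 60 by norm_num]
    norm_num
    ring
  have h := holomorphic_part_four hτ
  rw [hB, hB'] at h
  have hT : Th (2 / 5) (1 / 4) 1 0 τ = 2 * (ModularForm.eta τ * (e (71 * τ / 240) *
      F1 (e (τ / 2)) - (R (43 / 60) 0 (30 * τ) - R (23 / 60) 0 (30 * τ) +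
      R (53 / 60) 0 (30 * τ) - R (13 / 60) 0 (30 * τ)) / 2)) := by
    have h1 : e (27 * τ / 80) = e (τ / 24) * e (71 * τ / 240) := by rw [← e_add]; congr 1; ring
    rw [h1] at h
    have h2 := eta_eq τ
    linear_combination h - 2 * e (71 * τ / 240) * F1 (e (τ / 2)) * h2
  rw [H51_eq, G51, G51aux, F51]
  simp only [Pi.smul_apply, Matrix.cons_val, smul_eq_mul]
  rw [hT]
  field_simp
  ring

/-- For ν = k/60 + n with k odd, the additional phase -15ν² is -k²/240 - kn/2 modulo 1, and
(-1)^{kn} = (-1)^n is the phase -5n/2. Thus translation turns the second parameter 0 into 5/2. -/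
lemma R_add_thirty {a : ℝ} {k : ℤ} (hk : Odd k) (ha : a = k / 60) (τ : ℂ) :
    R a 0 (τ + 30) = e (-k * (k - 10) / 240) * R a (5 / 2) τ := by
  rw [R, R, ← tsum_mul_left]
  refine tsum_congr fun n => ?_
  rw [mul_left_comm, show (τ + 30).im = τ.im by simp]
  congr 1
  obtain ⟨i, rfl⟩ := hk
  have hexp (x : ℂ) : Complex.exp x = e (x / (2 * Real.pi * I)) := by
    rw [e, mul_div_cancel₀ _ two_pi_I_ne_zero]
  rw [hexp, hexp, ← e_add]
  obtain ⟨m, hm⟩ := Int.even_mul_succ_self n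
  refine e_eq_of_eq_add_int (2 * n - i * n - 15 * n ^ 2) ?_
  have := two_pi_I_ne_zero
  have := Real.pi_ne_zero
  rw [ha]
  push_cast
  field_simp
  ring

lemma F51_add_one_two (τ : ℂ) : F51 (τ + 1) 2 = zeta 240 (-1) * F51 τ 4 := by
  simp only [F51, Matrix.cons_val, zeta]
  rw [← mul_assoc, ← e_add, add_div τ, e_add_half]
  congr 2
  push_cast; ring_nf

lemma F51_add_one_three (τ : ℂ) : F51 (τ + 1) 3 = zeta 240 71 * F51 τ 5 := by
  simp only [F51, Matrix.cons_val, zeta]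
  rw [← mul_assoc, ← e_add, add_div τ, e_add_half]
  congr 2
  push_cast; ring_nf

lemma G51_add_one_two (τ : ℂ) : G51 (τ + 1) 2 = zeta 240 (-1) * G51 τ 4 := by
  simp only [G51, G51aux, Matrix.cons_val, zeta, Pi.smul_apply, smul_eq_mul, mul_add, mul_one]
  rw [R_add_thirty (k := 19) (by decide) (by norm_num),
    R_add_thirty (k := 29) (by decide) (by norm_num),
    R_add_thirty (k := 49) (by decide) (by norm_num),
    R_add_thirty (k := 59) (by decide) (by norm_num)]
  have h1 : e (-(19 : ℤ) * ((19 : ℤ) - 10) / 240) =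
      -(e (((-1 : ℤ) : ℂ) / (240 : ℕ)) * e (((-5 : ℤ) : ℂ) / (24 : ℕ))) := by
    rw [← e_add, ← e_add_half]; exact e_eq_of_eq_add_int (-1) (by push_cast; norm_num)
  have h2 : e (-(29 : ℤ) * ((29 : ℤ) - 10) / 240) =
      -(e (((-1 : ℤ) : ℂ) / (240 : ℕ)) * e (((5 : ℤ) : ℂ) / (24 : ℕ))) := by
    rw [← e_add, ← e_add_half]; exact e_eq_of_eq_add_int (-3) (by push_cast; norm_num)
  have h3 : e (-(49 : ℤ) * ((49 : ℤ) - 10) / 240) =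
      (e (((-1 : ℤ) : ℂ) / (240 : ℕ)) * e (((1 : ℤ) : ℂ) / (24 : ℕ))) := by
    rw [← e_add]; exact e_eq_of_eq_add_int (-8) (by push_cast; norm_num)
  have h4 : e (-(59 : ℤ) * ((59 : ℤ) - 10) / 240) =
      (e (((-1 : ℤ) : ℂ) / (240 : ℕ)) * e (((-1 : ℤ) : ℂ) / (24 : ℕ))) := by
    rw [← e_add]; exact e_eq_of_eq_add_int (-12) (by push_cast; norm_num)
  rw [h1, h2, h3, h4]
  ring

lemma G51_add_one_three (τ : ℂ) : G51 (τ + 1) 3 = zeta 240 71 * G51 τ 5 := by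
  simp only [G51, G51aux, Matrix.cons_val, zeta, Pi.smul_apply, smul_eq_mul, mul_add, mul_one]
  rw [R_add_thirty (k := 13) (by decide) (by norm_num),
    R_add_thirty (k := 23) (by decide) (by norm_num),
    R_add_thirty (k := 43) (by decide) (by norm_num),
    R_add_thirty (k := 53) (by decide) (by norm_num)]
  have h1 : e (-(13 : ℤ) * ((13 : ℤ) - 10) / 240) =
      -(e (((71 : ℤ) : ℂ) / (240 : ℕ)) * e (((1 : ℤ) : ℂ) / (24 : ℕ))) := by
    rw [← e_add, ← e_add_half]; exact e_eq_of_eq_add_int (-1) (by push_cast; norm_num)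
  have h2 : e (-(23 : ℤ) * ((23 : ℤ) - 10) / 240) =
      -(e (((71 : ℤ) : ℂ) / (240 : ℕ)) * e (((-1 : ℤ) : ℂ) / (24 : ℕ))) := by
    rw [← e_add, ← e_add_half]; exact e_eq_of_eq_add_int (-2) (by push_cast; norm_num)
  have h3 : e (-(43 : ℤ) * ((43 : ℤ) - 10) / 240) =
      (e (((71 : ℤ) : ℂ) / (240 : ℕ)) * e (((-5 : ℤ) : ℂ) / (24 : ℕ))) := by
    rw [← e_add]; exact e_eq_of_eq_add_int (-6) (by push_cast; norm_num)
  have h4 : e (-(53 : ℤ) * ((53 : ℤ) - 10) / 240) =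
      (e (((71 : ℤ) : ℂ) / (240 : ℕ)) * e (((5 : ℤ) : ℂ) / (24 : ℕ))) := by
    rw [← e_add]; exact e_eq_of_eq_add_int (-10) (by push_cast; norm_num)
  rw [h1, h2, h3, h4]
  ring

lemma H51_add_one_two (τ : ℂ) : H51 (τ + 1) 2 = zeta 240 (-1) * H51 τ 4 := by
  rw [H51_add_one]
  simp [T5, Matrix.mulVec, dotProduct, Fin.sum_univ_six]

lemma H51_add_one_three (τ : ℂ) : H51 (τ + 1) 3 = zeta 240 71 * H51 τ 5 := by
  rw [H51_add_one]
  simp [T5, Matrix.mulVec, dotProduct, Fin.sum_univ_six]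

lemma zeta_ne_zero (n : ℕ) (k : ℤ) : zeta n k ≠ 0 := e_ne_zero _

/-- Replacing τ by τ + 1 changes q^{1/2} to -q^{1/2}, so the last two identities are the third and
fourth at τ + 1, divided by a common root of unity. -/
theorem F51_eq_H51_add_G51 {τ : ℂ} (hτ : 0 < τ.im) : F51 τ = H51 τ + G51 τ := by
  have hτ' : 0 < (τ + 1).im := by simpa using hτ
  have h4 := decomposition_two hτ'
  have h5 := decomposition_three hτ'
  rw [F51_add_one_two, G51_add_one_two, H51_add_one_two, ← mul_add] at h4
  rw [F51_add_one_three, G51_add_one_three, H51_add_one_three, ← mul_add] at h5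
  funext i
  fin_cases i
  · exact decomposition_zero hτ
  · exact decomposition_one hτ
  · exact decomposition_two hτ
  · exact decomposition_three hτ
  · exact mul_left_cancel₀ (zeta_ne_zero _ _) h4
  · exact mul_left_cancel₀ (zeta_ne_zero _ _) h5

/-! ### Solving `∂P/∂τ̄ = φ(y) k(τ̄)` by a real-analytic function -/

/-- The Banach algebra of continuous functions on the unit interval. -/
abbrev CI : Type := C(unitInterval, ℂ)

/-- Superposition with an analytic function is analytic near a constant function. -/
lemma exists_analyticAt_superposition {f : ℂ → ℂ} {c : ℂ} (hf : AnalyticAt ℂ f c) :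
    ∃ F : CI → CI, AnalyticAt ℂ F (c • 1) ∧ ∀ᶠ X in 𝓝 (c • 1 : CI), ∀ s, F X s = f (X s) := by
  obtain ⟨p, r, hp⟩ := hf
  -- The Taylor coefficients of f serve as scalar coefficients of a power series in the Banach
  -- algebra; the norms, hence the radius, do not change.
  set q := FormalMultilinearSeries.ofScalars CI p.coeff with hq
  have hrad : q.radius = p.radius := by
    simp only [FormalMultilinearSeries.radius, hq, FormalMultilinearSeries.ofScalars_norm,
      FormalMultilinearSeries.norm_apply_eq_norm_coef]
  have hpos : 0 < q.radius := by rw [hrad]; exact hp.r_pos.trans_le hp.r_le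
  have hqs := (q.hasFPowerSeriesOnBall hpos).comp_sub (c • 1 : CI)
  rw [zero_add] at hqs
  refine ⟨_, hqs.analyticAt, ?_⟩
  filter_upwards [Metric.eball_mem_nhds (c • 1 : CI) hp.r_pos] with X hX s
  have hX' : X ∈ Metric.eball (c • 1 : CI) q.radius :=
    Metric.eball_subset_eball (hp.r_le.trans_eq hrad.symm) hX
  -- Evaluation at s is a continuous algebra homomorphism, so it carries this series to the Taylor
  -- series of f at X s.
  have h1 := (hqs.hasSum_sub hX').map (ContinuousMap.evalAlgHom ℂ ℂ s) (continuous_eval_const s)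
  have hs : X s ∈ Metric.eball c r := by
    refine lt_of_le_of_lt ?_ (Metric.mem_eball.1 hX)
    rw [edist_nndist, edist_nndist, ENNReal.coe_le_coe]
    have := ContinuousMap.dist_apply_le_dist (f := X) (g := c • 1) s
    rw [← NNReal.coe_le_coe]
    simpa using this
  have h2 := hp.hasSum_sub hs
  refine h1.unique (h2.congr_fun fun n => ?_)
  simp [hq, FormalMultilinearSeries.ofScalars_apply_eq, mul_comm]

/-- Integration over the unit interval. -/
def integralCI : CI →L[ℂ] ℂ :=
  LinearMap.mkContinuous
    { toFun := fun f => ∫ s in (0 : ℝ)..1, f (Set.projIcc 0 1 zero_le_one s)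
      map_add' := fun f g => by
        simp only [ContinuousMap.add_apply]
        rw [intervalIntegral.integral_add]
        · exact (f.continuous.comp continuous_projIcc).intervalIntegrable _ _
        · exact (g.continuous.comp continuous_projIcc).intervalIntegrable _ _
      map_smul' := fun c f => by
        simp only [ContinuousMap.smul_apply, RingHom.id_apply]
        rw [intervalIntegral.integral_smul] } 1 fun f => by
    have := intervalIntegral.norm_integral_le_of_norm_le_const (a := 0) (b := 1)
      (f := fun s => f (Set.projIcc 0 1 zero_le_one s)) (C := ‖f‖) fun s _ => f.norm_coe_le_norm _
    simpa using this

lemma integralCI_apply (f : CI) :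
    integralCI f = ∫ s in (0 : ℝ)..1, f (Set.projIcc 0 1 zero_le_one s) := rfl

/-- The inclusion of the unit interval. -/
def incl : CI := ⟨fun s => ((s : ℝ) : ℂ), by fun_prop⟩

/-- P is the integral of φ((z' - u)/2i)k(u) along the segment from w to w'. Joint analyticity in
(z', w') follows by treating the integrand as an element of C([0,1]): the arguments of φ and k on
the segment, X and Y, depend polynomially on the parameters, superposition is analytic, and
integration is continuous and linear. -/
lemma exists_primitive_snd {φ k : ℂ → ℂ} {z w : ℂ} (hφ : AnalyticAt ℂ φ ((z - w) / (2 * I)))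
    (hk : AnalyticAt ℂ k w) :
    ∃ P : ℂ × ℂ → ℂ, AnalyticAt ℂ P (z, w) ∧ ∀ᶠ p in 𝓝 (z, w),
      HasDerivAt (fun u => P (p.1, u)) (φ ((p.1 - p.2) / (2 * I)) * k p.2) p.2 := by
  obtain ⟨Fφ, hFφ, eφ⟩ := exists_analyticAt_superposition hφ
  obtain ⟨Fk, hFk, ek⟩ := exists_analyticAt_superposition hk
  set X : ℂ × ℂ → CI := fun p => ((p.1 - w) / (2 * I)) • 1 - ((p.2 - w) / (2 * I)) • incl with hX
  set Y : ℂ × ℂ → CI := fun p => w • 1 + (p.2 - w) • incl with hY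
  have hX0 : X (z, w) = ((z - w) / (2 * I)) • 1 := by
    ext s; simp [hX]
  have hY0 : Y (z, w) = w • 1 := by
    ext s; simp [hY]
  have aX : AnalyticAt ℂ X (z, w) := by
    have h1 : AnalyticAt ℂ (fun p : ℂ × ℂ => (p.1 - w) / (2 * I)) (z, w) :=
      (analyticAt_fst.sub analyticAt_const).mul (analyticAt_const (v := (2 * I)⁻¹))
    have h2 : AnalyticAt ℂ (fun p : ℂ × ℂ => (p.2 - w) / (2 * I)) (z, w) :=
      (analyticAt_snd.sub analyticAt_const).mul (analyticAt_const (v := (2 * I)⁻¹))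
    exact (h1.smul analyticAt_const).sub (h2.smul analyticAt_const)
  have aY : AnalyticAt ℂ Y (z, w) :=
    analyticAt_const.add ((analyticAt_snd.sub analyticAt_const).smul analyticAt_const)
  refine ⟨fun p => (p.2 - w) * integralCI (Fφ (X p) * Fk (Y p)), ?_, ?_⟩
  · refine (analyticAt_snd.sub analyticAt_const).mul ((integralCI.analyticAt _).comp ?_)
    rw [← hX0] at hFφ
    rw [← hY0] at hFk
    exact (hFφ.comp aX).mul (hFk.comp aY)
  rw [← hX0] at eφ
  rw [← hY0] at ek
  have d1 : ∀ᶠ p : ℂ × ℂ in 𝓝 (z, w), DifferentiableAt ℂ φ ((p.1 - p.2) / (2 * I)) := by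
    have hc : ContinuousAt (fun p : ℂ × ℂ => (p.1 - p.2) / (2 * I)) (z, w) := by fun_prop
    filter_upwards [hc.eventually hφ.eventually_analyticAt] with p hp using hp.differentiableAt
  have d2 : ∀ᶠ p : ℂ × ℂ in 𝓝 (z, w), DifferentiableAt ℂ k p.2 := by
    have hc : ContinuousAt (fun p : ℂ × ℂ => p.2) (z, w) := by fun_prop
    filter_upwards [hc.eventually hk.eventually_analyticAt] with p hp using hp.differentiableAt
  have hev := ((aX.continuousAt.eventually eφ).and (aY.continuousAt.eventually ek)).and (d1.and d2)
  obtain ⟨δ, hδ, hball⟩ := Metric.eventually_nhds_iff_ball.1 hev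
  filter_upwards [Metric.ball_mem_nhds (z, w) hδ] with p hp
  rw [← ball_prod_same] at hp hball
  obtain ⟨hp1, hp2⟩ := hp
  set g : ℂ → ℂ := fun u => φ ((p.1 - u) / (2 * I)) * k u with hg
  have hgd : DifferentiableOn ℂ g (Metric.ball w δ) := fun u hu => by
    obtain ⟨-, h1, h2⟩ := hball (p.1, u) ⟨hp1, hu⟩
    have h3 : DifferentiableAt ℂ (fun u : ℂ => (p.1 - u) / (2 * I)) u := by fun_prop
    exact ((DifferentiableAt.comp u h1 h3).mul h2).differentiableWithinAt
  -- For fixed first variable the integrand has a primitive Γ on the ball, so the segment integral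
  -- is Γ(u) - Γ(w).
  obtain ⟨Γ, hΓ⟩ := hgd.isExactOn_ball
  refine ((hΓ p.2 hp2).sub_const (Γ w)).congr_of_eventuallyEq ?_
  filter_upwards [Metric.isOpen_ball.mem_nhds hp2] with u hu
  obtain ⟨⟨h1, h2⟩, -⟩ := hball (p.1, u) ⟨hp1, hu⟩
  have hseg (s : ℝ) (hs : s ∈ Set.uIcc (0 : ℝ) 1) : w + s * (u - w) ∈ Metric.ball w δ := by
    rw [Set.uIcc_of_le zero_le_one] at hs
    rw [Metric.mem_ball, dist_eq_norm, add_sub_cancel_left, norm_mul, norm_real, Real.norm_eq_abs,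
      abs_of_nonneg hs.1, ← dist_eq_norm]
    exact (mul_le_of_le_one_left dist_nonneg hs.2).trans_lt hu
  rw [integralCI_apply, ← intervalIntegral.integral_const_mul]
  have hderiv (s : ℝ) (hs : s ∈ Set.uIcc (0 : ℝ) 1) :
      HasDerivAt (fun s : ℝ => Γ (w + s * (u - w))) ((u - w) * g (w + s * (u - w))) s := by
    have h3 : HasDerivAt (fun s : ℝ => w + (s : ℂ) * (u - w)) (u - w) s := by
      simpa using ((ofRealCLM.hasDerivAt (x := s)).mul_const (u - w)).const_add w
    exact ((hΓ _ (hseg s hs)).comp s h3).congr_deriv (mul_comm _ _)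
  have hcont : ContinuousOn (fun s : ℝ => (u - w) * g (w + s * (u - w))) (Set.uIcc 0 1) :=
    continuousOn_const.mul (hgd.continuousOn.comp (by fun_prop) hseg)
  have := intervalIntegral.integral_eq_sub_of_hasDerivAt hderiv hcont.intervalIntegrable
  simp only [ofReal_one, one_mul, add_sub_cancel, ofReal_zero, zero_mul, add_zero] at this
  rw [← this]
  refine intervalIntegral.integral_congr fun s hs => ?_
  have hs' := hs
  rw [Set.uIcc_of_le zero_le_one] at hs'
  simp only [ContinuousMap.mul_apply]
  rw [h1, h2, Set.projIcc_of_mem _ hs']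
  simp only [hX, hY, hg, incl, ContinuousMap.sub_apply, ContinuousMap.add_apply,
    ContinuousMap.smul_apply, ContinuousMap.one_apply, ContinuousMap.coe_mk, smul_eq_mul]
  congr 3
  · ring
  · ring

/-- A real-differentiable function with `∂h/∂τ̄ = φ((τ - τ̄) / 2i) k(τ̄)` is real-analytic. -/
lemma analyticAt_of_dbar {h φ k : ℂ → ℂ} {z : ℂ}
    (hφ : AnalyticAt ℂ φ ((z - conj z) / (2 * I))) (hk : AnalyticAt ℂ k (conj z))
    (hd : ∀ᶠ τ in 𝓝 z, DifferentiableAt ℝ h τ ∧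
      fderiv ℝ h τ 1 + I * fderiv ℝ h τ I = φ ((τ - conj τ) / (2 * I)) * k (conj τ)) :
    AnalyticAt ℝ h z := by
  obtain ⟨P, hP, hP'⟩ := exists_primitive_snd hφ hk
  set D : ℂ → ℂ × ℂ := fun τ => (τ, conj τ) with hD
  have hDc : Continuous D := by fun_prop
  set L : ℂ →L[ℝ] ℂ × ℂ := (ContinuousLinearMap.id ℝ ℂ).prod conjCLE.toContinuousLinearMap with hL
  have hDd (τ : ℂ) : HasFDerivAt D L τ := L.hasFDerivAt
  have aD : AnalyticAt ℝ D z := L.analyticAt z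
  have aP : AnalyticAt ℝ (fun τ => P (D τ)) z := AnalyticAt.comp (f := D) (hP.restrictScalars (𝕜 := ℝ)) aD
  -- The hypothesis prescribes 2∂h/∂τ̄, so half of P(τ, τ̄) has the same ∂̄-derivative as h, and the
  -- difference is holomorphic.
  suffices hs : AnalyticAt ℂ (fun τ => h τ - 1 / 2 * P (D τ)) z by
    have := (hs.restrictScalars (𝕜 := ℝ)).add (analyticAt_const (v := (1 / 2 : ℂ)) |>.mul aP)
    refine this.congr (Eventually.of_forall fun τ => ?_)
    simp
  rw [analyticAt_iff_eventually_differentiableAt]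
  have e1 := (hDc.continuousAt (x := z)).eventually hP.eventually_analyticAt
  have e2 := (hDc.continuousAt (x := z)).eventually hP'
  filter_upwards [hd, e1, e2] with τ h0 h1 h2
  have hPd : HasFDerivAt (fun τ => P (D τ))
      (((fderiv ℂ P (D τ)).restrictScalars ℝ).comp L) τ :=
    (h1.differentiableAt.hasFDerivAt.restrictScalars ℝ).comp τ (hDd τ)
  have hsnd : fderiv ℂ P (D τ) (0, 1) = φ ((τ - conj τ) / (2 * I)) * k (conj τ) := by
    have h3 : HasDerivAt (fun u : ℂ => (τ, u)) ((0, 1) : ℂ × ℂ) (conj τ) :=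
      (hasDerivAt_const _ _).prodMk (hasDerivAt_id _)
    exact (HasFDerivAt.comp_hasDerivAt (conj τ) h1.differentiableAt.hasFDerivAt h3).unique h2
  have hfd : HasFDerivAt (fun τ => h τ - 1 / 2 * P (D τ)) _ τ := h0.1.hasFDerivAt.sub (hPd.const_mul (1 / 2 : ℂ))
  rw [differentiableAt_complex_iff_differentiableAt_real]
  refine ⟨hfd.differentiableAt, ?_⟩
  rw [hfd.fderiv]
  have l1 : L 1 = (1, 0) + (0, 1) := by simp [hL]
  have l2 : L I = I • ((1, 0) : ℂ × ℂ) - I • (0, 1) := by simp [hL]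
  simp only [sub_apply, smul_apply,
    ContinuousLinearMap.comp_apply, l1, l2, ContinuousLinearMap.coe_restrictScalars', map_add,
    map_sub, map_smul, hsnd, smul_eq_mul]
  linear_combination (-I) * h0.2 + fderiv ℝ h τ I * I_sq

/-! ### Shadows -/

/-- `h` is real-differentiable on the upper half-plane, and `2 ∂h/∂τ̄ = y^{-1/2} k(τ̄)` with `k`
holomorphic on the lower half-plane. -/
structure HasShadow (h k : ℂ → ℂ) : Prop where
  holo : DifferentiableOn ℂ k {w | w.im < 0}
  diff : ∀ τ : ℂ, 0 < τ.im → DifferentiableAt ℝ h τ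
  dbar : ∀ τ : ℂ, 0 < τ.im →
    fderiv ℝ h τ 1 + I * fderiv ℝ h τ I = ((√τ.im)⁻¹ : ℝ) * k (conj τ)

lemma isOpen_im_pos : IsOpen {τ : ℂ | 0 < τ.im} := isOpen_lt continuous_const continuous_im

namespace HasShadow

variable {h k h₁ k₁ h₂ k₂ : ℂ → ℂ}

lemma add (H₁ : HasShadow h₁ k₁) (H₂ : HasShadow h₂ k₂) :
    HasShadow (fun τ => h₁ τ + h₂ τ) (fun w => k₁ w + k₂ w) where
  holo := H₁.holo.add H₂.holo
  diff τ hτ := (H₁.diff τ hτ).add (H₂.diff τ hτ)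
  dbar τ hτ := by
    rw [fderiv_fun_add (H₁.diff τ hτ) (H₂.diff τ hτ), add_apply, add_apply]
    linear_combination H₁.dbar τ hτ + H₂.dbar τ hτ

lemma const_mul (H : HasShadow h k) (c : ℂ) :
    HasShadow (fun τ => c * h τ) (fun w => c * k w) where
  holo := H.holo.const_mul c
  diff τ hτ := (H.diff τ hτ).const_mul c
  dbar τ hτ := by
    rw [fderiv_const_mul (H.diff τ hτ), smul_apply, smul_apply, smul_eq_mul, smul_eq_mul]
    linear_combination c * H.dbar τ hτ

lemma sub (H₁ : HasShadow h₁ k₁) (H₂ : HasShadow h₂ k₂) :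
    HasShadow (fun τ => h₁ τ - h₂ τ) (fun w => k₁ w + -1 * k₂ w) := by
  have := H₁.add (H₂.const_mul (-1))
  simpa only [neg_one_mul, ← sub_eq_add_neg] using this

lemma congr (H : HasShadow h k) (hh : ∀ τ : ℂ, 0 < τ.im → h₁ τ = h τ) : HasShadow h₁ k := by
  have he (τ : ℂ) (hτ : 0 < τ.im) : h₁ =ᶠ[𝓝 τ] h := by
    filter_upwards [isOpen_im_pos.mem_nhds hτ] with z hz using hh z hz
  exact ⟨H.holo, fun τ hτ => (H.diff τ hτ).congr_of_eventuallyEq (he τ hτ),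
    fun τ hτ => by rw [(he τ hτ).fderiv_eq, H.dbar τ hτ]⟩

lemma of_differentiableOn (hh : DifferentiableOn ℂ h {τ | 0 < τ.im}) :
    HasShadow h fun _ => 0 where
  holo := differentiableOn_const 0
  diff τ hτ := (hh.differentiableAt (isOpen_im_pos.mem_nhds hτ)).restrictScalars ℝ
  dbar τ hτ := by
    have := (differentiableAt_complex_iff_differentiableAt_real.1
      (hh.differentiableAt (isOpen_im_pos.mem_nhds hτ))).2
    rw [this, smul_eq_mul, mul_zero]
    linear_combination fderiv ℝ h τ 1 * I_sq

lemma comp_mul (H : HasShadow h k) {c : ℝ} (hc : 0 < c) :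
    HasShadow (fun τ => h (c * τ)) (fun w => √c * k (c * w)) where
  holo := by
    refine (H.holo.comp (by fun_prop : DifferentiableOn ℂ (fun w : ℂ => c * w) _)
      fun w hw => ?_).const_mul _
    simpa using mul_neg_of_pos_of_neg hc hw
  diff τ hτ := by
    have h1 : 0 < ((c : ℂ) * τ).im := by simpa using mul_pos hc hτ
    exact (H.diff _ h1).comp τ (by fun_prop)
  dbar τ hτ := by
    have h1 : 0 < ((c : ℂ) * τ).im := by simpa using mul_pos hc hτ
    have h2 : HasFDerivAt (fun τ : ℂ => (c : ℂ) * τ) ((c : ℂ) • ContinuousLinearMap.id ℝ ℂ) τ :=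
      (hasFDerivAt_id τ).const_mul _
    have h3 : fderiv ℝ (fun τ => h (c * τ)) τ =
        (fderiv ℝ h (c * τ)).comp ((c : ℂ) • ContinuousLinearMap.id ℝ ℂ) :=
      ((H.diff _ h1).hasFDerivAt.comp τ h2).fderiv
    have h4 := H.dbar _ h1
    have h5 (v : ℂ) : fderiv ℝ h (c * τ) ((c : ℂ) * v) = c * fderiv ℝ h (c * τ) v := by
      have := (fderiv ℝ h (c * τ)).map_smul c v
      simpa using this
    rw [h3]
    simp only [ContinuousLinearMap.comp_apply, smul_apply, ContinuousLinearMap.id_apply,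
      smul_eq_mul, h5]
    rw [show ((c : ℂ) * τ).im = c * τ.im by simp, Real.sqrt_mul hc.le, map_mul, conj_ofReal] at h4
    have hsq : (√c : ℂ) ^ 2 = c := by exact_mod_cast Real.sq_sqrt hc.le
    have h0 : (√c : ℂ) ≠ 0 := by exact_mod_cast (Real.sqrt_pos.2 hc).ne'
    have h0' : (√τ.im : ℂ) ≠ 0 := by exact_mod_cast (Real.sqrt_pos.2 hτ).ne'
    push_cast at h4 ⊢
    have : (c : ℂ) * (((√c : ℂ) * √τ.im)⁻¹) = (√τ.im : ℂ)⁻¹ * √c := by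
      rw [← hsq]; field_simp
    linear_combination c * h4 + k (c * conj τ) * this

lemma analyticAt (H : HasShadow h k) {τ : ℂ} (hτ : 0 < τ.im) : AnalyticAt ℝ h τ := by
  have hy (z : ℂ) : (z - conj z) / (2 * I) = z.im := by
    rw [Complex.sub_conj]
    push_cast
    field_simp
  refine analyticAt_of_dbar (φ := fun u => u ^ (-(1 / 2) : ℂ)) (k := k) ?_ ?_ ?_
  · rw [hy]
    exact analyticAt_id.cpow analyticAt_const (ofReal_mem_slitPlane.2 hτ)
  · have ho : IsOpen {w : ℂ | w.im < 0} := isOpen_lt continuous_im continuous_const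
    exact H.holo.analyticAt (ho.mem_nhds (by simpa using hτ))
  · filter_upwards [isOpen_im_pos.mem_nhds hτ] with z hz
    have hz : 0 < z.im := hz
    refine ⟨H.diff z hz, ?_⟩
    rw [H.dbar z hz, hy, cpow_neg, Real.sqrt_eq_rpow, ofReal_inv, ofReal_cpow hz.le]
    norm_num

end HasShadow

lemma hasFDerivAt_sqrt_im_inv {τ : ℂ} (hτ : 0 < τ.im) :
    HasFDerivAt (fun τ : ℂ => (((√τ.im)⁻¹ : ℝ) : ℂ))
      ((((-(√τ.im)⁻¹ / (2 * τ.im) : ℝ)) : ℂ) • (ofRealCLM.comp imCLM)) τ := by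
  have h1 : HasDerivAt (fun y : ℝ => (√y)⁻¹) (-(√τ.im)⁻¹ / (2 * τ.im)) τ.im := by
    refine ((Real.hasDerivAt_sqrt hτ.ne').inv (Real.sqrt_pos.2 hτ).ne').congr_deriv ?_
    have := Real.sq_sqrt hτ.le
    have h0 := (Real.sqrt_pos.2 hτ).ne'
    rw [this]; field_simp
  have h2 := ofRealCLM.hasFDerivAt.comp τ (h1.comp_hasFDerivAt τ imCLM.hasFDerivAt)
  refine h2.congr_fderiv ?_
  ext v; simp

/-- Since k(τ̄) is antiholomorphic, ∂/∂τ acts on y^{-1/2} only and gives (i/4)y^{-3/2}. Then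
-4y²·(i/4)y^{-3/2} cancels iy·y^{-1/2}, and only the constant 3/16 is left. -/
lemma casimir_of_hasShadow {n : ℕ} {f k : ℂ → Fin n → ℂ}
    (H : ∀ i, HasShadow (fun τ => f τ i) (fun w => k w i)) {τ : ℂ} (hτ : 0 < τ.im) :
    casimir f τ = (3 / 16 : ℂ) • f τ := by
  have hbar (z : ℂ) (hz : 0 < z.im) :
      dTauBar f z = fun i => 1 / 2 * ((((√z.im)⁻¹ : ℝ) : ℂ) * k (conj z) i) := by
    have hd : fderiv ℝ f z = ContinuousLinearMap.pi fun i => fderiv ℝ (fun τ => f τ i) z :=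
      fderiv_pi fun i => (H i).diff z hz
    funext i
    rw [dTauBar, hd]
    simp only [Pi.smul_apply, Pi.add_apply, ContinuousLinearMap.coe_pi', smul_eq_mul]
    rw [(H i).dbar z hz]
  have hT (i : Fin n) : HasFDerivAt (fun z => 1 / 2 * ((((√z.im)⁻¹ : ℝ) : ℂ) * k (conj z) i))
      ((1 / 2 : ℂ) • ((((√τ.im)⁻¹ : ℝ) : ℂ) • ((deriv (fun w => k w i) (conj τ)) •
        (conjCLE : ℂ →L[ℝ] ℂ)) + k (conj τ) i •
        ((((-(√τ.im)⁻¹ / (2 * τ.im) : ℝ)) : ℂ) • (ofRealCLM.comp imCLM)))) τ := by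
    have ho : IsOpen {w : ℂ | w.im < 0} := isOpen_lt continuous_im continuous_const
    have h1 : HasDerivAt (fun w => k w i) (deriv (fun w => k w i) (conj τ)) (conj τ) :=
      ((H i).holo.differentiableAt (ho.mem_nhds (by simpa using hτ))).hasDerivAt
    have h2 : HasFDerivAt (fun z => k (conj z) i) (deriv (fun w => k w i) (conj τ) •
        (conjCLE : ℂ →L[ℝ] ℂ)) τ := by
      refine ((h1.hasFDerivAt.restrictScalars ℝ).comp τ
        (conjCLE : ℂ →L[ℝ] ℂ).hasFDerivAt).congr_fderiv ?_
      ext v; simp [mul_comm]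
    exact ((hasFDerivAt_sqrt_im_inv hτ).mul h2).const_mul _
  have hev : dTauBar f =ᶠ[𝓝 τ] fun z i => 1 / 2 * ((((√z.im)⁻¹ : ℝ) : ℂ) * k (conj z) i) := by
    filter_upwards [isOpen_im_pos.mem_nhds hτ] with z hz using hbar z hz
  have hd2 := (hasFDerivAt_pi.2 hT).fderiv
  rw [casimir, dTau, hev.fderiv_eq, hd2, hbar τ hτ]
  funext i
  simp only [Pi.add_apply, Pi.smul_apply, Pi.sub_apply, ContinuousLinearMap.coe_pi', smul_apply,
    add_apply, smul_eq_mul, ContinuousLinearMap.comp_apply, imCLM_apply, ofRealCLM_apply,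
    ContinuousLinearEquiv.coe_coe, conjCLE_apply, map_one, conj_I, one_im, I_im, ofReal_one,
    ofReal_zero]
  have hy : (τ.im : ℂ) ≠ 0 := by exact_mod_cast hτ.ne'
  push_cast
  field_simp
  linear_combination
    (-128 * (τ.im : ℂ) ^ 2 * (√τ.im : ℂ)⁻¹ * deriv (fun w => k w i) (conj τ)) * I_sq

/-! ### The series `R` -/

/-- The summand of `R`. -/
def rTerm (b ν : ℝ) (τ : ℂ) : ℂ :=
  ((Real.sign ν * beta (2 * ν ^ 2 * τ.im) : ℝ) : ℂ) *
    Complex.exp (-(Real.pi : ℂ) * I * (ν : ℂ) ^ 2 * τ - 2 * (Real.pi : ℂ) * I * (ν : ℂ) * (b : ℂ))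

lemma R_eq (a b : ℝ) (τ : ℂ) : R a b τ = ∑' n : ℤ, rTerm b (a + n) τ := by
  refine tsum_congr fun n => ?_
  rw [rTerm]
  push_cast
  rfl

lemma norm_exp_rTerm (b ν : ℝ) (τ : ℂ) :
    ‖Complex.exp (-(Real.pi : ℂ) * I * (ν : ℂ) ^ 2 * τ - 2 * (Real.pi : ℂ) * I * (ν : ℂ) * (b : ℂ))‖ =
      Real.exp (Real.pi * ν ^ 2 * τ.im) := by
  rw [Complex.norm_exp]
  congr 1
  simp [← ofReal_pow]

lemma norm_rTerm_le (b ν : ℝ) {τ : ℂ} (hτ : 0 < τ.im) :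
    ‖rTerm b ν τ‖ ≤ Real.exp (-Real.pi * τ.im * ν ^ 2) := by
  have h0 : 0 ≤ 2 * ν ^ 2 * τ.im := by positivity
  rw [rTerm, norm_mul, norm_exp_rTerm, norm_real, Real.norm_eq_abs, abs_mul,
    abs_of_nonneg (beta_nonneg h0)]
  calc _ ≤ 1 * Real.exp (-Real.pi * (2 * ν ^ 2 * τ.im)) * Real.exp (Real.pi * ν ^ 2 * τ.im) := by
        have := beta_nonneg h0
        gcongr
        · exact abs_sign_le _
        · exact beta_le h0
    _ = _ := by rw [one_mul, ← Real.exp_add]; ring_nf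

lemma gaussSummable_shift_int (a : ℝ) :
    GaussSummable (fun n : ℤ => a + n) (fun _ : ℤ => 0) := fun c hc => by
  refine Summable.of_nonneg_of_le (fun _ => (Real.exp_pos _).le) (fun n => Real.exp_le_exp.2 ?_)
    (summable_exp_neg_sq_add_abs hc (2 * c * |a|))
  have h1 := sq_sub_le_sq_add a n
  nlinarith

lemma summable_one_add_sq_mul_exp (a : ℝ) {c : ℝ} (hc : 0 < c) :
    Summable fun n : ℤ => (1 + (a + n) ^ 2) * Real.exp (-c * (a + n) ^ 2) := by
  simpa using (gaussSummable_shift_int a).one_add hc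

lemma summable_exp_neg_sq_shift_int (a : ℝ) {c : ℝ} (hc : 0 < c) :
    Summable fun n : ℤ => Real.exp (-c * (a + n) ^ 2) := by
  simpa using gaussSummable_shift_int a c hc

/-- The coefficient of `dy` in the derivative of the summand of `R`. -/
def rTermIm (b ν : ℝ) (τ : ℂ) : ℂ :=
  ((-(√2 * ν * (√τ.im)⁻¹ * Real.exp (-2 * Real.pi * ν ^ 2 * τ.im)) : ℝ) : ℂ) *
    Complex.exp (-(Real.pi : ℂ) * I * (ν : ℂ) ^ 2 * τ - 2 * (Real.pi : ℂ) * I * (ν : ℂ) * (b : ℂ))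

/-- The real derivative of the summand of `R`. -/
def rTermDeriv (b ν : ℝ) (τ : ℂ) : ℂ →L[ℝ] ℂ :=
  rTermIm b ν τ • (ofRealCLM.comp imCLM) +
    (-(Real.pi : ℂ) * I * (ν : ℂ) ^ 2 * rTerm b ν τ) • ContinuousLinearMap.id ℝ ℂ

/-- In the y-derivative of sgn(ν)β(2ν²y) the sign meets ν²/|ν| and becomes ν. The case ν = 0 is
separate since β is not differentiable at 0; there the sign makes the term vanish. -/
lemma hasFDerivAt_rTerm (b ν : ℝ) {τ : ℂ} (hτ : 0 < τ.im) :
    HasFDerivAt (rTerm b ν) (rTermDeriv b ν τ) τ := by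
  rcases eq_or_ne ν 0 with rfl | hν
  · have h1 : rTerm b 0 = fun _ => 0 := by funext z; simp [rTerm]
    have h2 : rTermDeriv b 0 τ = 0 := by ext v; simp [rTermDeriv, rTermIm]
    rw [h1, h2]
    exact hasFDerivAt_const 0 τ
  have hx : 0 < 2 * ν ^ 2 * τ.im := by positivity
  have h1 : HasDerivAt (fun y : ℝ => Real.sign ν * beta (2 * ν ^ 2 * y))
      (-(√2 * ν * (√τ.im)⁻¹ * Real.exp (-2 * Real.pi * ν ^ 2 * τ.im))) τ.im := by
    have h2 : HasDerivAt (fun y : ℝ => 2 * ν ^ 2 * y) (2 * ν ^ 2) τ.im := by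
      simpa using (hasDerivAt_id τ.im).const_mul (2 * ν ^ 2)
    refine (((hasDerivAt_beta hx).comp τ.im h2).const_mul (Real.sign ν)).congr_deriv ?_
    have hs : (2 * ν ^ 2 * τ.im) ^ (-(1 / 2) : ℝ) = (√2)⁻¹ * |ν|⁻¹ * (√τ.im)⁻¹ := by
      rw [Real.rpow_neg hx.le, ← Real.sqrt_eq_rpow, Real.sqrt_mul (by positivity),
        Real.sqrt_mul (by norm_num), Real.sqrt_sq_eq_abs, mul_inv, mul_inv]
    have hsν : Real.sign ν * |ν|⁻¹ * ν ^ 2 = ν := by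
      rcases lt_or_gt_of_ne hν with h | h
      · rw [Real.sign_of_neg h, abs_of_neg h]; field_simp
      · rw [Real.sign_of_pos h, abs_of_pos h]; field_simp
    have h22 : (√2)⁻¹ * 2 = √2 := by
      rw [inv_mul_eq_div, div_eq_iff (by positivity)]
      exact (Real.mul_self_sqrt (by norm_num)).symm
    rw [hs, show -Real.pi * (2 * ν ^ 2 * τ.im) = -2 * Real.pi * ν ^ 2 * τ.im by ring]
    linear_combination (-(√τ.im)⁻¹ * Real.exp (-2 * Real.pi * ν ^ 2 * τ.im)) *
      ((√2)⁻¹ * 2 * hsν + ν * h22)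
  have h3 := ofRealCLM.hasFDerivAt.comp τ (h1.comp_hasFDerivAt τ imCLM.hasFDerivAt)
  have h4 : HasDerivAt (fun z : ℂ => -(Real.pi : ℂ) * I * (ν : ℂ) ^ 2 * z -
      2 * (Real.pi : ℂ) * I * (ν : ℂ) * (b : ℂ)) (-(Real.pi : ℂ) * I * (ν : ℂ) ^ 2) τ := by
    exact (((hasDerivAt_id τ).const_mul (-(Real.pi : ℂ) * I * (ν : ℂ) ^ 2)).sub_const
      (2 * (Real.pi : ℂ) * I * (ν : ℂ) * (b : ℂ))).congr_deriv (mul_one _)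
  have h5 := h4.cexp.hasFDerivAt.restrictScalars ℝ
  refine (h3.mul h5).congr_fderiv ?_
  ext v
  simp [rTermDeriv, rTermIm, rTerm]
  ring

lemma norm_rTermDeriv_le (b ν : ℝ) {δ : ℝ} (hδ : 0 < δ) {τ : ℂ} (hτ : δ < τ.im) :
    ‖rTermDeriv b ν τ‖ ≤ (√2 * (√δ)⁻¹ + Real.pi) * ((1 + ν ^ 2) *
      Real.exp (-(Real.pi * δ) * ν ^ 2)) := by
  have hτ0 : 0 < τ.im := hδ.trans hτ
  have hexp : Real.exp (-Real.pi * τ.im * ν ^ 2) ≤ Real.exp (-(Real.pi * δ) * ν ^ 2) := by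
    rw [Real.exp_le_exp]
    have : Real.pi * δ * ν ^ 2 ≤ Real.pi * τ.im * ν ^ 2 := by gcongr
    linarith
  have hA : ‖rTermIm b ν τ‖ ≤ √2 * (√δ)⁻¹ * ((1 + ν ^ 2) * Real.exp (-(Real.pi * δ) * ν ^ 2)) := by
    rw [rTermIm, norm_mul, norm_exp_rTerm, norm_real, norm_neg, Real.norm_eq_abs, abs_mul, abs_mul,
      abs_mul, abs_of_nonneg (Real.sqrt_nonneg 2), Real.abs_exp,
      abs_of_nonneg (inv_nonneg.2 (Real.sqrt_nonneg _))]
    have hν : |ν| ≤ 1 + ν ^ 2 := by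
      rw [abs_le]; constructor <;> nlinarith [sq_nonneg (ν - 1), sq_nonneg (ν + 1)]
    calc _ = √2 * |ν| * (√τ.im)⁻¹ * Real.exp (-Real.pi * τ.im * ν ^ 2) := by
          rw [mul_assoc _ (Real.exp _), ← Real.exp_add]; ring_nf
      _ ≤ √2 * (1 + ν ^ 2) * (√δ)⁻¹ * Real.exp (-(Real.pi * δ) * ν ^ 2) := by
          gcongr
      _ = _ := by ring
  have hB : ‖-(Real.pi : ℂ) * I * (ν : ℂ) ^ 2 * rTerm b ν τ‖ ≤
      Real.pi * ((1 + ν ^ 2) * Real.exp (-(Real.pi * δ) * ν ^ 2)) := by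
    have h := norm_rTerm_le b ν hτ0
    rw [norm_mul, norm_mul, norm_mul, norm_neg, norm_real, norm_I, norm_pow, norm_real,
      Real.norm_eq_abs, Real.norm_eq_abs, sq_abs, abs_of_pos Real.pi_pos, mul_one, mul_assoc]
    gcongr
    · linarith
    · exact h.trans hexp
  have hof : ‖ofRealCLM.comp imCLM‖ ≤ 1 := by
    refine ContinuousLinearMap.opNorm_le_bound _ zero_le_one fun v => ?_
    rw [one_mul]
    simpa using abs_im_le_norm v
  rw [rTermDeriv, add_mul]
  refine (norm_add_le _ _).trans (add_le_add ?_ ?_)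
  · rw [norm_smul]
    exact (mul_le_of_le_one_right (norm_nonneg _) hof).trans hA
  · rw [norm_smul]
    exact (mul_le_of_le_one_right (norm_nonneg _) ContinuousLinearMap.norm_id_le).trans hB

/-- The shadow of `R`. -/
def rShadow (a b : ℝ) (w : ℂ) : ℂ :=
  ∑' n : ℤ, -I * √2 * ((a + n : ℝ) : ℂ) * Complex.exp (-(Real.pi : ℂ) * I * ((a + n : ℝ) : ℂ) ^ 2 * w -
    2 * (Real.pi : ℂ) * I * ((a + n : ℝ) : ℂ) * (b : ℂ))

/-- Twice the operator `∂/∂τ̄` on real-linear maps. -/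
def dbarCLM : (ℂ →L[ℝ] ℂ) →L[ℝ] ℂ :=
  ContinuousLinearMap.apply ℝ ℂ 1 + I • ContinuousLinearMap.apply ℝ ℂ I

lemma dbarCLM_apply (D : ℂ →L[ℝ] ℂ) : dbarCLM D = D 1 + I * D I := by simp [dbarCLM]

lemma summable_rTerm (a b : ℝ) {τ : ℂ} (hτ : 0 < τ.im) :
    Summable fun n : ℤ => rTerm b (a + n) τ := by
  refine Summable.of_norm_bounded (summable_exp_neg_sq_shift_int a
    (mul_pos Real.pi_pos hτ)) fun n => (norm_rTerm_le _ _ hτ).trans_eq ?_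
  ring_nf

/-- ∂/∂τ̄ annihilates the exponential, so it acts on β only. The Gaussian exp(-2πν²y) thus produced
turns exp(-πiν²τ) into exp(-πiν²τ̄), leaving y^{-1/2} times a weight 3/2 unary theta series in τ̄.
-/
lemma hasShadow_R (a b : ℝ) : HasShadow (R a b) (rShadow a b) := by
  have hfd (τ : ℂ) (hτ : 0 < τ.im) :
      HasFDerivAt (R a b) (∑' n : ℤ, rTermDeriv b (a + n) τ) τ ∧
        Summable fun n : ℤ => rTermDeriv b (a + n) τ := by
    have hδ : 0 < τ.im / 2 := half_pos hτ
    have hδτ : τ.im / 2 < τ.im := half_lt_self hτ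
    have hu := ((summable_one_add_sq_mul_exp a (mul_pos Real.pi_pos hδ)).mul_left
      (√2 * (√(τ.im / 2))⁻¹ + Real.pi))
    refine ⟨?_, Summable.of_norm_bounded hu fun n => norm_rTermDeriv_le b _ hδ hδτ⟩
    have := hasFDerivAt_tsum_of_isPreconnected (s := {z : ℂ | τ.im / 2 < z.im}) (x := τ) (x₀ := τ)
      (f := fun (n : ℤ) z => rTerm b (a + n) z) hu
      (isOpen_lt continuous_const continuous_im)
      (convex_halfSpace_im_gt _).isPreconnected
      (fun n z hz => hasFDerivAt_rTerm b (a + n) (hδ.trans hz))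
      (fun n z hz => norm_rTermDeriv_le b (a + n) hδ hz) hδτ (summable_rTerm a b hτ) hδτ
    exact this.congr_of_eventuallyEq (Eventually.of_forall fun z => R_eq a b z)
  refine ⟨fun w hw => ?_, fun τ hτ => (hfd τ hτ).1.differentiableAt, fun τ hτ => ?_⟩
  · have hw : w.im < 0 := hw
    have hδ : 0 < -w.im / 2 := by linarith
    have ho : IsOpen {z : ℂ | z.im < w.im / 2} := isOpen_lt continuous_im continuous_const
    have := differentiableOn_tsum_of_summable_norm (U := {z : ℂ | z.im < w.im / 2})
      (F := fun (n : ℤ) (w : ℂ) => -I * √2 * ((a + n : ℝ) : ℂ) * Complex.exp (-(Real.pi : ℂ) * I *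
        ((a + n : ℝ) : ℂ) ^ 2 * w - 2 * (Real.pi : ℂ) * I * ((a + n : ℝ) : ℂ) * (b : ℂ)))
      ((summable_one_add_sq_mul_exp a (mul_pos Real.pi_pos hδ)).mul_left (√2))
      (fun n => by fun_prop) ho (fun n z hz => ?_)
    · exact (this.differentiableAt (ho.mem_nhds (by simp; linarith))).differentiableWithinAt
    · have hz : z.im < w.im / 2 := hz
      rw [norm_mul, norm_exp_rTerm, norm_mul, norm_mul, norm_neg, norm_I, one_mul, norm_real,
        norm_real, Real.norm_eq_abs, Real.norm_eq_abs, abs_of_nonneg (Real.sqrt_nonneg 2), mul_assoc]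
      set ν := a + (n : ℝ)
      have hν : |ν| ≤ 1 + ν ^ 2 := by
        rw [abs_le]; constructor <;> nlinarith [sq_nonneg (ν - 1), sq_nonneg (ν + 1)]
      have : Real.pi * ν ^ 2 * z.im ≤ Real.pi * ν ^ 2 * (w.im / 2) := by gcongr
      exact mul_le_mul_of_nonneg_left (mul_le_mul hν (Real.exp_le_exp.2 (by linarith))
        (Real.exp_pos _).le (by positivity)) (Real.sqrt_nonneg 2)
  · obtain ⟨h1, h2⟩ := hfd τ hτ
    rw [h1.fderiv, ← dbarCLM_apply, dbarCLM.map_tsum h2, rShadow, ← tsum_mul_left]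
    refine tsum_congr fun n => ?_
    set ν := a + (n : ℝ)
    rw [dbarCLM_apply, rTermDeriv]
    simp only [add_apply, smul_apply, ContinuousLinearMap.comp_apply, imCLM_apply, ofRealCLM_apply,
      ContinuousLinearMap.id_apply, one_im, I_im, ofReal_zero, ofReal_one, smul_eq_mul, mul_zero,
      mul_one, zero_add]
    have hconj : (conj τ : ℂ) = τ - 2 * τ.im * I := by
      have := Complex.sub_conj τ
      push_cast at this
      linear_combination -this
    have he : Complex.exp (-(Real.pi : ℂ) * I * (ν : ℂ) ^ 2 * conj τ -
        2 * (Real.pi : ℂ) * I * (ν : ℂ) * (b : ℂ)) =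
        ((Real.exp (-2 * Real.pi * ν ^ 2 * τ.im) : ℝ) : ℂ) * Complex.exp (-(Real.pi : ℂ) * I *
          (ν : ℂ) ^ 2 * τ - 2 * (Real.pi : ℂ) * I * (ν : ℂ) * (b : ℂ)) := by
      rw [ofReal_exp, ← Complex.exp_add, hconj]
      congr 1
      push_cast
      linear_combination (2 * Real.pi * (ν : ℂ) ^ 2 * τ.im) * I_sq
    rw [he, rTermIm]
    push_cast
    linear_combination (-(Real.pi : ℂ) * I * (ν : ℂ) ^ 2 * rTerm b ν τ) * I_sq

/-! ### Holomorphy and growth -/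

lemma differentiableOn_qInf : DifferentiableOn ℂ qInf (Metric.ball 0 1) := by
  refine (ModularForm.differentiableOn_tprod_one_sub_pow).congr fun q hq => ?_
  rfl

/-- Row n has at most 2n + 1 terms, each with exponent at least n, so on |q| < r < 1 it is dominated
by (2n+1)·2rⁿ. The lower bound on exponents also gives holomorphy at q = 0, which the behaviour at
i∞ needs. -/
lemma differentiableOn_hecke {ι : Type*} {s : ℕ → Finset ι} {c : ℕ → ι → ℂ} {m : ℕ → ι → ℤ}
    {d : ℕ → ℂ → ℂ} (hs : ∀ n, (s n).card ≤ 2 * n + 1) (hc : ∀ n j, ‖c n j‖ ≤ 1)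
    (hm : ∀ n, ∀ j ∈ s n, (n : ℤ) ≤ m n j) (hd : ∀ n, Differentiable ℂ (d n))
    (hd2 : ∀ n q, ‖q‖ < 1 → ‖d n q‖ ≤ 2) :
    DifferentiableOn ℂ (fun q => ∑' n, ∑ j ∈ s n, c n j * q ^ m n j * d n q)
      (Metric.ball 0 1) := by
  intro q hq
  rw [mem_ball_zero_iff] at hq
  obtain ⟨r, hqr, hr1⟩ := exists_between hq
  have hr0 : 0 < r := (norm_nonneg q).trans_lt hqr
  have hu : Summable fun n : ℕ => ((2 * n + 1 : ℕ) : ℝ) * (2 * r ^ n) := by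
    have h1 := summable_pow_mul_geometric_of_norm_lt_one 1
      (r := r) (by rwa [Real.norm_eq_abs, abs_of_pos hr0])
    have h2 := summable_geometric_of_lt_one hr0.le hr1
    refine ((h1.mul_left 4).add (h2.mul_left 2)).congr fun n => ?_
    push_cast; ring
  have h := differentiableOn_tsum_of_summable_norm (U := Metric.ball (0 : ℂ) r)
    (F := fun n q => ∑ j ∈ s n, c n j * q ^ m n j * d n q) hu (fun n => ?_)
    Metric.isOpen_ball (fun n w hw => ?_)
  · exact (h.differentiableAt (Metric.isOpen_ball.mem_nhds (by simpa using hqr))).differentiableWithinAt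
  · refine DifferentiableOn.fun_sum fun j hj => ?_
    refine DifferentiableOn.mul (DifferentiableOn.const_mul (fun w _ => ?_) _)
      (hd n).differentiableOn
    exact (differentiableAt_zpow.2 (Or.inr (by have := hm n j hj; lia))).differentiableWithinAt
  · rw [mem_ball_zero_iff] at hw
    refine (norm_sum_le _ _).trans ?_
    have : ∀ j ∈ s n, ‖c n j * w ^ m n j * d n w‖ ≤ 2 * r ^ n := fun j hj => by
      have hmj := hm n j hj
      obtain ⟨k, hk⟩ : ∃ k : ℕ, m n j = k := ⟨(m n j).toNat, by lia⟩
      have hk' : n ≤ k := by lia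
      rw [norm_mul, norm_mul, hk, zpow_natCast, norm_pow]
      calc _ ≤ 1 * r ^ n * 2 := by
            gcongr
            · exact hc n j
            · exact (pow_le_pow_left₀ (norm_nonneg w) hw.le k).trans
                (pow_le_pow_of_le_one hr0.le hr1.le hk')
            · exact hd2 n w (hw.trans hr1)
        _ = _ := by ring
    refine (Finset.sum_le_card_nsmul _ _ _ this).trans ?_
    rw [nsmul_eq_mul]
    gcongr
    exact hs n

lemma norm_one_sub_pow_le (q : ℂ) (hq : ‖q‖ < 1) (n : ℕ) : ‖1 - q ^ n‖ ≤ 2 := by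
  refine (norm_sub_le _ _).trans ?_
  rw [norm_one, norm_pow]
  linarith [pow_le_one₀ (n := n) (norm_nonneg q) hq.le]

lemma norm_one_add_pow_le (q : ℂ) (hq : ‖q‖ < 1) (n : ℕ) : ‖1 + q ^ n‖ ≤ 2 := by
  refine (norm_add_le _ _).trans ?_
  rw [norm_one, norm_pow]
  linarith [pow_le_one₀ (n := n) (norm_nonneg q) hq.le]

lemma triangular_le {n j : ℕ} (hj : j ∈ Finset.range (2 * n + 1)) :
    (j : ℤ) * (j + 1) / 2 ≤ 2 * n ^ 2 + n := by
  rw [Finset.mem_range] at hj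
  refine Int.ediv_le_of_le_mul (by norm_num) ?_
  have : (j : ℤ) ≤ 2 * n := by lia
  nlinarith

lemma card_Icc_neg (n : ℕ) : (Finset.Icc (-(n : ℤ)) n).card ≤ 2 * n + 1 := by
  rw [Int.card_Icc]; lia

lemma differentiableOn_qInf_inv :
    DifferentiableOn ℂ (fun q => (qInf q)⁻¹) (Metric.ball 0 1) :=
  differentiableOn_qInf.inv fun q hq => qInf_ne_zero (by simpa using hq)

lemma sq_le_of_mem_Icc {n : ℕ} {j : ℤ} (hj : j ∈ Finset.Icc (-(n : ℤ)) n) : j ^ 2 ≤ (n : ℤ) ^ 2 := by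
  rw [Finset.mem_Icc] at hj
  exact sq_le_sq' hj.1 hj.2

lemma differentiableOn_f0 : DifferentiableOn ℂ f0 (Metric.ball 0 1) := by
  refine differentiableOn_qInf_inv.mul (differentiableOn_hecke (fun n => card_Icc_neg n)
    (fun n j => (norm_neg_one_zpow j).le) (fun n j hj => ?_) (fun n => by fun_prop)
    fun n q hq => norm_one_sub_pow_le q hq _)
  have h1 := sq_le_of_mem_Icc hj
  have h2 : (n : ℤ) + n ^ 2 ≤ (5 * (n : ℤ) ^ 2 + n) / 2 := by
    rw [Int.le_ediv_iff_mul_le (by norm_num)]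
    have : (n : ℤ) ≤ n ^ 2 := by exact_mod_cast Nat.le_self_pow two_ne_zero n
    nlinarith
  linarith

lemma differentiableOn_f1 : DifferentiableOn ℂ f1 (Metric.ball 0 1) := by
  refine differentiableOn_qInf_inv.mul (differentiableOn_hecke (fun n => card_Icc_neg n)
    (fun n j => (norm_neg_one_zpow j).le) (fun n j hj => ?_) (fun n => by fun_prop)
    fun n q hq => norm_one_sub_pow_le q hq _)
  have h1 := sq_le_of_mem_Icc hj
  have h2 : (n : ℤ) + n ^ 2 ≤ (5 * (n : ℤ) ^ 2 + 3 * n) / 2 := by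
    rw [Int.le_ediv_iff_mul_le (by norm_num)]
    have : (n : ℤ) ≤ n ^ 2 := by exact_mod_cast Nat.le_self_pow two_ne_zero n
    nlinarith
  linarith

lemma differentiableOn_qInf_sq_inv :
    DifferentiableOn ℂ (fun q => (qInf (q ^ 2))⁻¹) (Metric.ball 0 1) := by
  refine differentiableOn_qInf_inv.comp (f := fun q => q ^ 2) (by fun_prop) fun q hq => ?_
  rw [mem_ball_zero_iff] at hq ⊢
  rw [norm_pow]
  exact pow_lt_one₀ (norm_nonneg q) hq two_ne_zero

lemma differentiableOn_F0 : DifferentiableOn ℂ F0 (Metric.ball 0 1) := by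
  refine differentiableOn_qInf_sq_inv.mul (differentiableOn_hecke
    (c := fun n _ => (-1) ^ n) (fun n => (Finset.card_range _).le)
    (fun n j => by simp) (fun n j hj => ?_) (fun n => by fun_prop)
    fun n q hq => norm_one_add_pow_le q hq _)
  have h1 := triangular_le hj
  nlinarith [sq_nonneg (n : ℤ)]

lemma differentiableOn_F1 : DifferentiableOn ℂ F1 (Metric.ball 0 1) := by
  refine differentiableOn_qInf_sq_inv.mul (differentiableOn_hecke
    (c := fun n _ => (-1) ^ n) (fun n => (Finset.card_range _).le)
    (fun n j => by simp) (fun n j hj => ?_) (fun n => by fun_prop)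
    fun n q hq => norm_one_add_pow_le q hq _)
  have h1 := triangular_le hj
  nlinarith [sq_nonneg (n : ℤ)]

/-- The leading coefficient at i∞, used to show that `H51` is not identically zero. -/
lemma f0_zero : f0 0 = 1 := by
  have h1 : qInf 0 = 1 := by simp [qInf]
  rw [f0, h1, inv_one, one_mul, tsum_eq_single 0 fun n hn => ?_]
  · simp
  · refine Finset.sum_eq_zero fun j hj => ?_
    have h1 := sq_le_of_mem_Icc hj
    have h2 : (n : ℤ) + n ^ 2 ≤ (5 * (n : ℤ) ^ 2 + n) / 2 := by
      rw [Int.le_ediv_iff_mul_le (by norm_num)]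
      have : (n : ℤ) ≤ n ^ 2 := by exact_mod_cast Nat.le_self_pow two_ne_zero n
      nlinarith
    rw [zero_zpow _ (by lia), mul_zero, zero_mul]

lemma differentiable_e : Differentiable ℂ e := by
  unfold e; fun_prop

lemma e_mem_ball {τ : ℂ} (hτ : 0 < τ.im) : e τ ∈ Metric.ball (0 : ℂ) 1 := by
  simpa using norm_e_lt_one hτ

lemma e_half_mem_ball {τ : ℂ} (hτ : 0 < τ.im) : e (τ / 2) ∈ Metric.ball (0 : ℂ) 1 :=
  e_mem_ball (by simpa using hτ)

lemma differentiableOn_F51 (i : Fin 6) :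
    DifferentiableOn ℂ (fun τ => F51 τ i) {τ | 0 < τ.im} := by
  have he (c : ℂ) : Differentiable ℂ fun τ => e (c * τ) := differentiable_e.comp (by fun_prop)
  have h1 : DifferentiableOn ℂ e {τ | 0 < τ.im} := differentiable_e.differentiableOn
  have h2 : DifferentiableOn ℂ (fun τ => e (τ / 2)) {τ | 0 < τ.im} :=
    (differentiable_e.comp (by fun_prop : Differentiable ℂ fun τ : ℂ => τ / 2)).differentiableOn
  have m1 : Set.MapsTo e {τ | 0 < τ.im} (Metric.ball 0 1) := fun τ hτ => e_mem_ball hτ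
  have m2 : Set.MapsTo (fun τ => e (τ / 2)) {τ | 0 < τ.im} (Metric.ball 0 1) :=
    fun τ hτ => e_half_mem_ball hτ
  have m3 : Set.MapsTo (fun τ => -e (τ / 2)) {τ | 0 < τ.im} (Metric.ball 0 1) :=
    fun τ hτ => by simpa using e_half_mem_ball hτ
  have d (g : ℂ → ℂ) (hg : Differentiable ℂ g) : DifferentiableOn ℂ (fun τ => e (g τ))
      {τ | 0 < τ.im} := (differentiable_e.comp hg).differentiableOn
  fin_cases i
  · exact (d _ (by fun_prop)).mul (differentiableOn_f0.comp h1 m1)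
  · exact (d _ (by fun_prop)).mul (differentiableOn_f1.comp h1 m1)
  · exact (d _ (by fun_prop)).mul ((differentiableOn_F0.comp h2 m2).const_add _)
  · exact (d _ (by fun_prop)).mul (differentiableOn_F1.comp h2 m2)
  · exact (d _ (by fun_prop)).mul ((differentiableOn_F0.comp h2.neg m3).const_add _)
  · exact (d _ (by fun_prop)).mul (differentiableOn_F1.comp h2.neg m3)

lemma exists_shadow_G51 (i : Fin 6) : ∃ k, HasShadow (fun τ => G51 τ i) k := by
  have hR (a b : ℝ) : ∃ k, HasShadow (fun τ => R a b (30 * τ)) k :=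
    ⟨_, by simpa using (hasShadow_R a b).comp_mul (c := 30) (by norm_num)⟩
  have hc {h : ℂ → ℂ} (c : ℂ) : (∃ k, HasShadow h k) → ∃ k, HasShadow (fun τ => c * h τ) k :=
    fun ⟨_, hk⟩ => ⟨_, hk.const_mul c⟩
  have ha {h₁ h₂ : ℂ → ℂ} : (∃ k, HasShadow h₁ k) → (∃ k, HasShadow h₂ k) →
      ∃ k, HasShadow (fun τ => h₁ τ + h₂ τ) k := fun ⟨_, hk₁⟩ ⟨_, hk₂⟩ => ⟨_, hk₁.add hk₂⟩
  have hs {h₁ h₂ : ℂ → ℂ} : (∃ k, HasShadow h₁ k) → (∃ k, HasShadow h₂ k) →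
      ∃ k, HasShadow (fun τ => h₁ τ - h₂ τ) k := fun ⟨_, hk₁⟩ ⟨_, hk₂⟩ => ⟨_, hk₁.sub hk₂⟩
  have hn {h : ℂ → ℂ} : (∃ k, HasShadow h k) → ∃ k, HasShadow (fun τ => -h τ) k :=
    fun hk => by simpa only [neg_one_mul] using hc (-1) hk
  fin_cases i
  · exact hc _ (ha (hc _ (hR _ _)) (hc _ (hR _ _)))
  · exact hc _ (ha (hc _ (hR _ _)) (hc _ (hR _ _)))
  · exact hc _ (ha (ha (hs (hn (hR _ _)) (hR _ _)) (hR _ _)) (hR _ _))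
  · exact hc _ (ha (ha (hs (hn (hR _ _)) (hR _ _)) (hR _ _)) (hR _ _))
  · exact hc _ (ha (ha (ha (hc _ (hR _ _)) (hc _ (hR _ _))) (hc _ (hR _ _))) (hc _ (hR _ _)))
  · exact hc _ (ha (ha (ha (hc _ (hR _ _)) (hc _ (hR _ _))) (hc _ (hR _ _))) (hc _ (hR _ _)))

lemma exists_shadow_H51 (i : Fin 6) : ∃ k, HasShadow (fun τ => H51 τ i) k := by
  obtain ⟨k, hk⟩ := exists_shadow_G51 i
  refine ⟨_, ((HasShadow.of_differentiableOn (differentiableOn_F51 i)).sub hk).congr fun τ hτ => ?_⟩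
  rw [F51_eq_H51_add_G51 hτ, Pi.add_apply, add_sub_cancel_right]

lemma casimir_H51 {τ : ℂ} (hτ : 0 < τ.im) : casimir H51 τ = (3 / 16 : ℂ) • H51 τ := by
  choose k hk using exists_shadow_H51
  exact casimir_of_hasShadow (k := fun w i => k i w) hk hτ

lemma analyticOnNhd_H51 : AnalyticOnNhd ℝ H51 {τ : ℂ | 0 < τ.im} := fun τ hτ => by
  choose k hk using exists_shadow_H51
  exact analyticAt_pi_iff.2 fun i => (hk i).analyticAt hτ

/-- The filter is left free so that one reduction to `R` serves both the half-plane y ≥ 1 and the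
vertical approach to a rational point. -/
lemma G51_isBigO {l : Filter ℂ} (hR : ∀ a b : ℚ, 0 ≤ a → a ≤ 1 →
    (fun τ => R a b (30 * τ)) =O[l] fun _ => (1 : ℝ)) (i : Fin 6) :
    (fun τ => G51 τ i) =O[l] fun _ => (1 : ℝ) := by
  have h {a b : ℝ} (a' b' : ℚ) (ha : (a' : ℝ) = a) (hb : (b' : ℝ) = b) (h0 : 0 ≤ a') (h1 : a' ≤ 1) :
      (fun τ => R a b (30 * τ)) =O[l] fun _ => (1 : ℝ) := by
    rw [← ha, ← hb]; exact hR a' b' h0 h1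
  have h0 {a : ℝ} (k : ℚ) (ha : (k : ℝ) = a) (h0 : 0 ≤ k) (h1 : k ≤ 1) :=
    h k 0 ha Rat.cast_zero h0 h1
  have h1 {a : ℝ} (k : ℚ) (ha : (k : ℝ) = a) (h0 : 0 ≤ k) (h1 : k ≤ 1) :=
    h (b := 5 / 2) k (5 / 2) ha (by norm_num) h0 h1
  fin_cases i
  · exact (((h1 (1 / 30) (by norm_num) (by norm_num) (by norm_num)).const_mul_left _).add
      ((h1 (11 / 30) (by norm_num) (by norm_num) (by norm_num)).const_mul_left _)).const_mul_left _
  · exact (((h1 (13 / 30) (by norm_num) (by norm_num) (by norm_num)).const_mul_left _).add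
      ((h1 (23 / 30) (by norm_num) (by norm_num) (by norm_num)).const_mul_left _)).const_mul_left _
  · exact (((((h0 (19 / 60) (by norm_num) (by norm_num) (by norm_num)).neg_left).sub
      (h0 (29 / 60) (by norm_num) (by norm_num) (by norm_num))).add
      (h0 (49 / 60) (by norm_num) (by norm_num) (by norm_num))).add
      (h0 (59 / 60) (by norm_num) (by norm_num) (by norm_num))).const_mul_left _
  · exact (((((h0 (13 / 60) (by norm_num) (by norm_num) (by norm_num)).neg_left).sub
      (h0 (23 / 60) (by norm_num) (by norm_num) (by norm_num))).add
      (h0 (43 / 60) (by norm_num) (by norm_num) (by norm_num))).add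
      (h0 (53 / 60) (by norm_num) (by norm_num) (by norm_num))).const_mul_left _
  · exact (((((h1 (19 / 60) (by norm_num) (by norm_num) (by norm_num)).const_mul_left _).add
      ((h1 (29 / 60) (by norm_num) (by norm_num) (by norm_num)).const_mul_left _)).add
      ((h1 (49 / 60) (by norm_num) (by norm_num) (by norm_num)).const_mul_left _)).add
      ((h1 (59 / 60) (by norm_num) (by norm_num) (by norm_num)).const_mul_left _)).const_mul_left _
  · exact (((((h1 (13 / 60) (by norm_num) (by norm_num) (by norm_num)).const_mul_left _).add
      ((h1 (23 / 60) (by norm_num) (by norm_num) (by norm_num)).const_mul_left _)).add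
      ((h1 (43 / 60) (by norm_num) (by norm_num) (by norm_num)).const_mul_left _)).add
      ((h1 (53 / 60) (by norm_num) (by norm_num) (by norm_num)).const_mul_left _)).const_mul_left _

lemma isBigO_R_im_ge (a b : ℝ) :
    (fun τ => R a b (30 * τ)) =O[𝓟 {τ : ℂ | 1 ≤ τ.im}] fun _ => (1 : ℝ) := by
  refine Asymptotics.IsBigO.of_bound (∑' n : ℤ, Real.exp (-Real.pi * (a + n) ^ 2)) ?_
  rw [eventually_principal]
  intro τ hτ
  have hτ : 1 ≤ (30 * τ).im := by
    have : 1 ≤ τ.im := hτ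
    simp; linarith
  rw [norm_one, mul_one, R_eq]
  refine tsum_of_norm_bounded (summable_exp_neg_sq_shift_int a Real.pi_pos).hasSum fun n => ?_
  refine (norm_rTerm_le _ _ (by linarith)).trans (Real.exp_le_exp.2 ?_)
  have : Real.pi * (a + n) ^ 2 * 1 ≤ Real.pi * (a + n) ^ 2 * (30 * τ).im := by gcongr
  linarith

lemma isBigO_of_differentiableOn_ball {f : ℂ → ℂ} (hf : DifferentiableOn ℂ f (Metric.ball 0 1))
    {g : ℂ → ℂ} (hg : ∀ τ : ℂ, 1 ≤ τ.im → ‖g τ‖ ≤ Real.exp (-1)) :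
    (fun τ => f (g τ)) =O[𝓟 {τ : ℂ | 1 ≤ τ.im}] fun _ => (1 : ℝ) := by
  have hsub : Metric.closedBall (0 : ℂ) (Real.exp (-1)) ⊆ Metric.ball 0 1 :=
    Metric.closedBall_subset_ball (by rw [Real.exp_lt_one_iff]; norm_num)
  obtain ⟨C, hC⟩ := (isCompact_closedBall (0 : ℂ) (Real.exp (-1))).exists_bound_of_continuousOn
    (hf.continuousOn.mono hsub)
  refine Asymptotics.IsBigO.of_bound C ?_
  rw [eventually_principal]
  intro τ hτ
  rw [norm_one, mul_one]
  exact hC _ (by simpa using hg τ hτ)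

lemma F51_isBigO (i : Fin 6) : (fun τ => F51 τ i) =O[𝓟 {τ : ℂ | 1 ≤ τ.im}]
    fun τ => Real.exp τ.im := by
  have hπ := Real.pi_gt_three
  have hπ' := Real.pi_lt_four
  -- The threshold -1/8 suffices because 2π/8 < 1, by π < 4.
  have he {g : ℂ → ℂ} (c : ℝ) (hg : ∀ τ, g τ = c * τ) (hc : -1 / 8 ≤ c) :
      (fun τ => e (g τ)) =O[𝓟 {τ : ℂ | 1 ≤ τ.im}] fun τ => Real.exp τ.im := by
    refine Asymptotics.IsBigO.of_bound 1 ?_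
    rw [eventually_principal]
    intro τ hτ
    have hτ : 1 ≤ τ.im := hτ
    rw [hg, norm_e, Real.norm_eq_abs, Real.abs_exp, one_mul, Real.exp_le_exp, im_ofReal_mul]
    nlinarith [mul_le_mul_of_nonneg_right hc (by positivity : 0 ≤ Real.pi * τ.im)]
  have hq (τ : ℂ) (hτ : 1 ≤ τ.im) : ‖e τ‖ ≤ Real.exp (-1) := by
    rw [norm_e, Real.exp_le_exp]; nlinarith
  have hq2 (τ : ℂ) (hτ : 1 ≤ τ.im) : ‖e (τ / 2)‖ ≤ Real.exp (-1) := by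
    rw [norm_e, Real.exp_le_exp, show (τ / 2).im = τ.im / 2 by simp]; nlinarith
  have hq3 (τ : ℂ) (hτ : 1 ≤ τ.im) : ‖-e (τ / 2)‖ ≤ Real.exp (-1) := by
    rw [norm_neg]; exact hq2 τ hτ
  have hm {g u : ℂ → ℂ} (hg : g =O[𝓟 {τ : ℂ | 1 ≤ τ.im}] fun τ => Real.exp τ.im)
      (hu : u =O[𝓟 {τ : ℂ | 1 ≤ τ.im}] fun _ => (1 : ℝ)) :
      (fun τ => g τ * u τ) =O[𝓟 {τ : ℂ | 1 ≤ τ.im}] fun τ => Real.exp τ.im := by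
    simpa using hg.mul hu
  have h1 : (fun _ : ℂ => (-1 : ℂ)) =O[𝓟 {τ : ℂ | 1 ≤ τ.im}] fun _ => (1 : ℝ) :=
    Asymptotics.isBigO_const_const _ one_ne_zero _
  fin_cases i
  · exact hm (he (-1 / 60) (fun τ => by push_cast; ring) (by norm_num))
      (isBigO_of_differentiableOn_ball differentiableOn_f0 hq)
  · exact hm (he (11 / 60) (fun τ => by push_cast; ring) (by norm_num))
      (isBigO_of_differentiableOn_ball differentiableOn_f1 hq)
  · exact hm (he (-1 / 240) (fun τ => by push_cast; ring) (by norm_num))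
      (h1.add (isBigO_of_differentiableOn_ball differentiableOn_F0 hq2))
  · exact hm (he (71 / 240) (fun τ => by push_cast; ring) (by norm_num))
      (isBigO_of_differentiableOn_ball differentiableOn_F1 hq2)
  · exact hm (he (-1 / 240) (fun τ => by push_cast; ring) (by norm_num))
      (h1.add (isBigO_of_differentiableOn_ball differentiableOn_F0 hq3))
  · exact hm (he (71 / 240) (fun τ => by push_cast; ring) (by norm_num))
      (isBigO_of_differentiableOn_ball differentiableOn_F1 hq3)

lemma growth_H51 : ∃ C : ℝ, ∀ τ : ℂ, 1 ≤ τ.im → ‖H51 τ‖ ≤ C * Real.exp (C * τ.im) := by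
  have hG : G51 =O[𝓟 {τ : ℂ | 1 ≤ τ.im}] fun τ => Real.exp τ.im := by
    refine Asymptotics.isBigO_pi.2 fun i =>
      (G51_isBigO (fun a b _ _ => isBigO_R_im_ge a b) i).trans ?_
    refine Asymptotics.IsBigO.of_bound 1 ?_
    rw [eventually_principal]
    intro τ hτ
    have hτ : 1 ≤ τ.im := hτ
    rw [norm_one, Real.norm_eq_abs, Real.abs_exp, one_mul, Real.one_le_exp_iff]
    linarith
  obtain ⟨C, hC⟩ := ((Asymptotics.isBigO_pi.2 F51_isBigO).sub hG).bound
  rw [eventually_principal] at hC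
  refine ⟨max C 1, fun τ hτ => ?_⟩
  have h := hC τ hτ
  have hτ0 : 0 < τ.im := by linarith
  rw [F51_eq_H51_add_G51 hτ0, add_sub_cancel_right, Real.norm_eq_abs, Real.abs_exp] at h
  refine h.trans ?_
  gcongr
  · exact le_max_left _ _
  · exact le_mul_of_one_le_left hτ0.le (le_max_right _ _)

/-- If H vanished, F would equal G, which is bounded for y ≥ 1; but at iy the first component of F
has norm e^{πy/30}|f₀(q)| with f₀(q) → 1. -/
lemma exists_H51_ne_zero : ∃ τ : ℂ, 0 < τ.im ∧ H51 τ ≠ 0 := by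
  by_contra! h
  obtain ⟨C, hC⟩ := (G51_isBigO (fun a b _ _ => isBigO_R_im_ge a b) 0).bound
  rw [eventually_principal] at hC
  have hlim : Tendsto (fun y : ℝ => e (y * I)) atTop (𝓝 0) := by
    rw [tendsto_zero_iff_norm_tendsto_zero]
    simp only [norm_e, mul_im, ofReal_re, I_im, mul_one, ofReal_im, I_re, mul_zero, add_zero]
    exact Real.tendsto_exp_atBot.comp
      (tendsto_id.const_mul_atTop_of_neg (by linarith [Real.pi_pos]))
  have hf : Tendsto (fun y : ℝ => ‖f0 (e (y * I))‖) atTop (𝓝 1) := by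
    have h1 : ContinuousAt f0 0 := (differentiableOn_f0.differentiableAt
      (Metric.ball_mem_nhds 0 one_pos)).continuousAt
    have h2 := (h1.tendsto.comp hlim).norm
    rw [f0_zero, norm_one] at h2
    exact h2
  have hexp : Tendsto (fun y : ℝ => Real.exp (Real.pi / 30 * y)) atTop atTop :=
    Real.tendsto_exp_atTop.comp (tendsto_id.const_mul_atTop (by positivity))
  obtain ⟨y, h1, h2, h3⟩ := ((eventually_ge_atTop 1).and ((hf.eventually
    (lt_mem_nhds (by norm_num : (1 / 2 : ℝ) < 1))).and (hexp.eventually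
      (eventually_gt_atTop (2 * C))))).exists
  have him : ((y : ℂ) * I).im = y := by simp
  have hpos : 0 < ((y : ℂ) * I).im := by rw [him]; linarith
  have h4 := hC ((y : ℂ) * I) (by simpa using h1)
  have h5 := congrFun (F51_eq_H51_add_G51 hpos) 0
  rw [h _ hpos, zero_add] at h5
  rw [← h5, norm_one, mul_one] at h4
  have h6 : ‖F51 (y * I) 0‖ = Real.exp (Real.pi / 30 * y) * ‖f0 (e (y * I))‖ := by
    rw [F51, Matrix.cons_val_zero, norm_mul, norm_e]
    congr 2
    rw [show (-(y * I) / 60 : ℂ) = ((-y / 60 : ℝ) : ℂ) * I by push_cast; ring]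
    simp
    ring
  rw [h6] at h4
  nlinarith [Real.exp_pos (Real.pi / 30 * y)]

/-! ### Behaviour at rational numbers -/

/-- For 0 ≤ x ≤ N the points x + N(n+1) and N - x + N(n+1) of the two tails interlace once one tail
is shifted by a step. By monotonicity the tails therefore differ by at most the first term, at most
1, and p = 0 and p = -1 add at most 1 each. -/
lemma abs_tsum_odd_le {H : ℝ → ℝ} (h0 : ∀ u, 0 ≤ H u) (h1 : ∀ u, H u ≤ 1)
    (hanti : ∀ u v, |u| ≤ |v| → H v ≤ H u) {N x : ℝ} (hx : 0 ≤ x) (hxN : x ≤ N) (hN : 0 < N)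
    (hs : Summable fun p : ℤ => Real.sign (x + N * p) * H (x + N * p)) :
    |∑' p : ℤ, Real.sign (x + N * p) * H (x + N * p)| ≤ 3 := by
  set f : ℤ → ℝ := fun p => Real.sign (x + N * p) * H (x + N * p) with hf
  have sA : Summable fun n : ℕ => f n := hs.comp_injective Nat.cast_injective
  have sB : Summable fun n : ℕ => f (-((n : ℤ) + 1)) :=
    hs.comp_injective fun m n h => by simpa using h
  have hle (p : ℤ) : |f p| ≤ 1 := by
    rw [hf, abs_mul, abs_of_nonneg (h0 _)]
    exact mul_le_one₀ (abs_sign_le _) (h0 _) (h1 _)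
  have hpos (n : ℕ) : f (n + 1) = H (x + N * (n + 1)) := by
    have : 0 < x + N * ((n : ℝ) + 1) := by positivity
    simp only [hf]
    push_cast
    rw [Real.sign_of_pos this, one_mul]
  have hneg (n : ℕ) : f (-((n : ℤ) + 1 + 1)) = -H (N - x + N * (n + 1)) := by
    have : 0 < N - x + N * ((n : ℝ) + 1) := by
      have : 0 ≤ N - x := by linarith
      positivity
    have h2 : x + N * ((-((n : ℤ) + 1 + 1) : ℤ) : ℝ) = -(N - x + N * (n + 1)) := by
      push_cast; ring
    simp only [hf]
    rw [h2, Real.sign_of_neg (by linarith), neg_one_mul]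
    congr 1
    exact le_antisymm (hanti _ _ (by rw [abs_neg])) (hanti _ _ (by rw [abs_neg]))
  have sa : Summable fun n : ℕ => H (x + N * (n + 1)) :=
    ((summable_nat_add_iff 1).2 sA).congr fun n => by rw [← hpos]; push_cast; rfl
  have sb : Summable fun n : ℕ => H (N - x + N * (n + 1)) :=
    ((summable_nat_add_iff 1).2 sB).neg.congr fun n => by
      rw [neg_eq_iff_eq_neg, ← hneg]; push_cast; rfl
  have tA : ∑' n : ℕ, f n = f 0 + ∑' n : ℕ, H (x + N * (n + 1)) := by
    rw [sA.tsum_eq_zero_add]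
    exact congrArg₂ _ rfl (tsum_congr fun n => by rw [← hpos]; push_cast; rfl)
  have tB : ∑' n : ℕ, f (-((n : ℤ) + 1)) = f (-1) - ∑' n : ℕ, H (N - x + N * (n + 1)) := by
    rw [sB.tsum_eq_zero_add, sub_eq_add_neg, ← tsum_neg]
    exact congrArg₂ _ rfl (tsum_congr fun n => by rw [← hneg]; push_cast; rfl)
  have c1 : ∑' n : ℕ, H (x + N * (n + 1)) ≤ 1 + ∑' n : ℕ, H (N - x + N * (n + 1)) := by
    rw [sa.tsum_eq_zero_add]
    refine add_le_add (h1 _) (((summable_nat_add_iff 1).2 sa).tsum_le_tsum (fun n => ?_) sb)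
    have hn : 0 ≤ N * n := by positivity
    refine hanti _ _ ?_
    rw [abs_of_nonneg (by linarith), abs_of_nonneg (by push_cast; linarith)]
    push_cast; linarith
  have c2 : ∑' n : ℕ, H (N - x + N * (n + 1)) ≤ 1 + ∑' n : ℕ, H (x + N * (n + 1)) := by
    rw [sb.tsum_eq_zero_add]
    refine add_le_add (h1 _) (((summable_nat_add_iff 1).2 sb).tsum_le_tsum (fun n => ?_) sa)
    have hn : 0 ≤ N * n := by positivity
    refine hanti _ _ ?_
    rw [abs_of_nonneg (by linarith), abs_of_nonneg (by push_cast; linarith)]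
    push_cast; linarith
  rw [tsum_of_nat_of_neg_add_one sA sB, tA, tB, abs_le]
  obtain ⟨h3, h4⟩ := abs_le.1 (hle 0)
  obtain ⟨h5, h6⟩ := abs_le.1 (hle (-1))
  constructor <;> linarith

/-- `β(2 u² y) exp(π u² y)`. -/
def betaExp (y u : ℝ) : ℝ := beta (2 * u ^ 2 * y) * Real.exp (Real.pi * u ^ 2 * y)

lemma betaExp_nonneg {y : ℝ} (hy : 0 < y) (u : ℝ) : 0 ≤ betaExp y u :=
  mul_nonneg (beta_nonneg (by positivity)) (Real.exp_pos _).le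

lemma betaExp_le_one {y : ℝ} (hy : 0 < y) (u : ℝ) : betaExp y u ≤ 1 := by
  refine (mul_le_mul_of_nonneg_right (beta_le (by positivity)) (Real.exp_pos _).le).trans ?_
  rw [← Real.exp_add, Real.exp_le_one_iff]
  have : 0 ≤ Real.pi * u ^ 2 * y := by have := Real.pi_pos; positivity
  linarith

/-- With X = 2u²y the function is (β(X)e^{πX})·e^{-πX/2}, a product of two nonnegative decreasing
functions of |u|. -/
lemma betaExp_anti {y : ℝ} (hy : 0 < y) (u v : ℝ) (h : |u| ≤ |v|) : betaExp y v ≤ betaExp y u := by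
  have hsq : u ^ 2 ≤ v ^ 2 := sq_le_sq.2 h
  have h2 : 2 * u ^ 2 * y ≤ 2 * v ^ 2 * y := by gcongr
  have hb := beta_mul_exp_antitoneOn (Set.mem_Ici.2 (by positivity : 0 ≤ 2 * u ^ 2 * y))
    (Set.mem_Ici.2 (by positivity : 0 ≤ 2 * v ^ 2 * y)) h2
  have he (u : ℝ) : betaExp y u = beta (2 * u ^ 2 * y) * Real.exp (Real.pi * (2 * u ^ 2 * y)) *
      Real.exp (-(Real.pi * u ^ 2 * y)) := by
    rw [betaExp, mul_assoc (beta _), ← Real.exp_add]; ring_nf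
  rw [he, he]
  have hπ := Real.pi_pos
  refine mul_le_mul hb (Real.exp_le_exp.2 ?_) (Real.exp_pos _).le ?_
  · gcongr
  · exact mul_nonneg (beta_nonneg (by positivity)) (Real.exp_pos _).le

lemma rTerm_eq (b ν ξ y : ℝ) :
    rTerm b ν (ξ + y * I) = ((Real.sign ν * betaExp y ν : ℝ) : ℂ) *
      e (-((ν ^ 2 * ξ / 2 + ν * b : ℝ) : ℂ)) := by
  have him : ((ξ : ℂ) + y * I).im = y := by simp
  rw [rTerm, betaExp, him, ofReal_mul, ofReal_mul, ofReal_mul, ofReal_exp, ← mul_assoc,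
    mul_assoc (_ * _) (Complex.exp _), e, ← Complex.exp_add]
  congr 2
  push_cast
  linear_combination (-(Real.pi : ℂ) * ν ^ 2 * y) * I_sq

/-- At ξ + iy each term is a real amplitude times a phase that does not depend on y. On a residue
class modulo N the phase is constant, and `abs_tsum_odd_le` bounds the remaining real sum by 3
uniformly in y. -/
lemma norm_R_le (a b ξ : ℚ) (h0 : 0 ≤ a) (h1 : a ≤ 1) : ∃ C : ℝ, ∀ y : ℝ, 0 < y →
    ‖R a b (ξ + y * I)‖ ≤ C := by
  -- Under ν ↦ ν + Np the phase ν²ξ/2 + νb changes by νNpξ + N²p²ξ/2 + Npb. The denominators make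
  -- this an integer for ν = a + r, the factor 2 taking care of the half in the quadratic term.
  set N : ℕ := 2 * (a.den * b.den * ξ.den) with hN
  have hN0 : 0 < N := by have := a.den_pos; have := b.den_pos; have := ξ.den_pos; positivity
  have : NeZero N := ⟨hN0.ne'⟩
  refine ⟨N * 3, fun y hy => ?_⟩
  have him : 0 < ((ξ : ℂ) + y * I).im := by simpa using hy
  have hs := summable_rTerm a b him
  rw [R_eq, tsum_int_eq_sum_mod N hs]
  refine (norm_sum_le _ _).trans ?_
  have hcard : (N : ℝ) * 3 = ∑ _r : Fin N, (3 : ℝ) := by simp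
  rw [hcard]
  refine Finset.sum_le_sum fun r _ => ?_
  have hr : ((r : ℕ) : ℝ) + 1 ≤ N := by exact_mod_cast r.2
  have ha0 : (0 : ℝ) ≤ a := by exact_mod_cast h0
  have ha1 : (a : ℝ) ≤ 1 := by exact_mod_cast h1
  have hterm (p : ℤ) : rTerm b (a + ((N * p + r : ℤ) : ℝ)) (ξ + y * I) =
      ((Real.sign (a + r + N * p) * betaExp y (a + r + N * p) : ℝ) : ℂ) *
        e (-(((a + r : ℝ) ^ 2 * ξ / 2 + (a + r) * b : ℝ) : ℂ)) := by
    rw [show (a : ℝ) + ((N * p + r : ℤ) : ℝ) = a + r + N * p by push_cast; ring]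
    have := rTerm_eq b (a + r + N * p) ξ y
    rw [show (((ξ : ℝ)) : ℂ) = (ξ : ℂ) by push_cast; rfl] at this
    rw [this]
    congr 1
    have e1 : (N : ℝ) * a * ξ = (2 * b.den * a.num * ξ.num : ℤ) := by
      have g1 : (a.den : ℝ) * a = a.num := by exact_mod_cast Rat.den_mul_eq_num a
      have g2 : (ξ.den : ℝ) * ξ = ξ.num := by exact_mod_cast Rat.den_mul_eq_num ξ
      rw [hN]; push_cast; rw [← g1, ← g2]; ring
    have e2 : (N : ℝ) * ξ = (2 * (a.den * b.den * ξ.num) : ℤ) := by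
      have g2 : (ξ.den : ℝ) * ξ = ξ.num := by exact_mod_cast Rat.den_mul_eq_num ξ
      rw [hN]; push_cast; rw [← g2]; ring
    have e3 : (N : ℝ) * b = (2 * a.den * b.num * ξ.den : ℤ) := by
      have g2 : (b.den : ℝ) * b = b.num := by exact_mod_cast Rat.den_mul_eq_num b
      rw [hN]; push_cast; rw [← g2]; ring
    refine e_eq_of_eq_add_int (-((2 * b.den * a.num * ξ.num) * p +
      (2 * (a.den * b.den * ξ.num)) * r * p + N * (a.den * b.den * ξ.num) * p ^ 2 +
      (2 * a.den * b.num * ξ.den) * p)) ?_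
    have e1' : (N : ℂ) * a * ξ = (2 * b.den * a.num * ξ.num : ℤ) := by exact_mod_cast e1
    have e2' : (N : ℂ) * ξ = (2 * (a.den * b.den * ξ.num) : ℤ) := by exact_mod_cast e2
    have e3' : (N : ℂ) * b = (2 * a.den * b.num * ξ.den : ℤ) := by exact_mod_cast e3
    push_cast at e1' e2' e3' ⊢
    linear_combination (-(p : ℂ)) * e1' - (r * p + N * p ^ 2 / 2 : ℂ) * e2' - p * e3'
  have hsr : Summable fun p : ℤ =>
      Real.sign ((a : ℝ) + r + N * p) * betaExp y (a + r + N * p) := by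
    have h2 : Summable fun p : ℤ => rTerm b (a + ((N * p + r : ℤ) : ℝ)) (ξ + y * I) :=
      hs.comp_injective (i := fun p : ℤ => (N * p + r : ℤ)) fun p q hpq => by
        simpa [hN0.ne'] using hpq
    simp only [hterm] at h2
    rw [summable_mul_right_iff (e_ne_zero _)] at h2
    exact Complex.summable_ofReal.1 h2
  simp only [hterm]
  rw [tsum_mul_right, ← ofReal_tsum, norm_mul, ← ofReal_neg, norm_e_real, mul_one, norm_real,
    Real.norm_eq_abs]
  exact abs_tsum_odd_le (betaExp_nonneg hy) (betaExp_le_one hy) (betaExp_anti hy) (by positivity)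
    (by linarith) (by exact_mod_cast hN0) hsr

lemma G51_bounded_at_rat (ξ : ℚ) : ∃ C : ℝ, ∀ᶠ y : ℝ in 𝓝[>] 0,
    ‖G51 ((ξ : ℂ) + (y : ℂ) * I)‖ ≤ C := by
  have h : G51 =O[map (fun y : ℝ => (ξ : ℂ) + (y : ℂ) * I) (𝓝[>] 0)] fun _ => (1 : ℝ) := by
    refine Asymptotics.isBigO_pi.2 (G51_isBigO fun a b h0 h1 => ?_)
    obtain ⟨C, hC⟩ := norm_R_le a b (30 * ξ) h0 h1
    refine Asymptotics.IsBigO.of_bound C ?_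
    rw [eventually_map]
    filter_upwards [self_mem_nhdsWithin] with y hy
    have := hC (30 * y) (mul_pos (by norm_num) hy)
    rw [norm_one, mul_one]
    convert this using 2
    push_cast
    ring_nf
  obtain ⟨C, hC⟩ := h.bound
  refine ⟨C, ?_⟩
  rw [eventually_map] at hC
  simpa using hC

/-! ### Modularity for the full modular group -/

local notation "SL2Z" => Matrix.SpecialLinearGroup (Fin 2) ℤ

/-- The automorphy factor `c τ + d`. -/
def den (γ : SL2Z) (τ : ℂ) : ℂ := (γ 1 0 : ℤ) * τ + (γ 1 1 : ℤ)

/-- The Möbius transformation of `γ`. -/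
def moeb (γ : SL2Z) (τ : ℂ) : ℂ := ((γ 0 0 : ℤ) * τ + (γ 0 1 : ℤ)) / den γ τ

lemma det_eq (γ : SL2Z) : (γ 0 0 : ℂ) * γ 1 1 - γ 0 1 * γ 1 0 = 1 := by
  have := γ.det_coe
  rw [Matrix.det_fin_two] at this
  exact_mod_cast this

lemma den_im (γ : SL2Z) (τ : ℂ) : (den γ τ).im = γ 1 0 * τ.im := by simp [den]

lemma den_ne_zero (γ : SL2Z) {τ : ℂ} (hτ : 0 < τ.im) : den γ τ ≠ 0 := fun h => by
  have h1 := den_im γ τ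
  rw [h, zero_im, eq_comm, mul_eq_zero, or_iff_left hτ.ne'] at h1
  have h1' : (γ 1 0 : ℤ) = 0 := by exact_mod_cast h1
  have h2 := det_eq γ
  rw [den, h1'] at h
  rw [h1'] at h2
  simp at h h2
  simp [h] at h2

lemma moeb_im (γ : SL2Z) (τ : ℂ) :
    (moeb γ τ).im = τ.im / normSq (den γ τ) := by
  have h := det_eq γ
  have h' : (γ 0 0 : ℝ) * γ 1 1 - γ 0 1 * γ 1 0 = 1 := by exact_mod_cast h
  rw [moeb, Complex.div_im, div_sub_div_same]
  congr 1
  simp [den]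
  linear_combination τ.im * h'

lemma moeb_im_pos (γ : SL2Z) {τ : ℂ} (hτ : 0 < τ.im) : 0 < (moeb γ τ).im := by
  rw [moeb_im γ]
  exact div_pos hτ (normSq_pos.2 (den_ne_zero γ hτ))

lemma den_mul (γ δ : SL2Z) {τ : ℂ} (hτ : 0 < τ.im) :
    den (γ * δ) τ = den γ (moeb δ τ) * den δ τ := by
  have h := den_ne_zero δ hτ
  have h1 : moeb δ τ * den δ τ = (δ 0 0 : ℤ) * τ + (δ 0 1 : ℤ) := div_mul_cancel₀ _ h
  rw [den, den, add_mul, mul_assoc, h1, den]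
  simp [Matrix.mul_apply, Fin.sum_univ_two]
  ring

lemma moeb_mul (γ δ : SL2Z) {τ : ℂ} (hτ : 0 < τ.im) : moeb (γ * δ) τ = moeb γ (moeb δ τ) := by
  have h := den_ne_zero δ hτ
  have h1 : moeb δ τ * den δ τ = (δ 0 0 : ℤ) * τ + (δ 0 1 : ℤ) := div_mul_cancel₀ _ h
  conv_rhs => rw [moeb, ← mul_div_mul_right _ _ h, ← den_mul γ δ hτ, add_mul, mul_assoc, h1]
  rw [moeb]
  congr 1
  simp [den, Matrix.mul_apply, Fin.sum_univ_two]
  ring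

lemma den_one (τ : ℂ) : den 1 τ = 1 := by simp [den]

lemma moeb_one (τ : ℂ) : moeb 1 τ = τ := by simp [moeb, den]

/-- If c ≠ 0, then cτ + d is never real and avoids the cut; if c = 0 it is constant, possibly on the
cut, which does no harm. -/
lemma continuousOn_den_cpow (γ : SL2Z) :
    ContinuousOn (fun τ => den γ τ ^ (1 / 2 : ℂ)) {τ : ℂ | 0 < τ.im} := by
  rcases eq_or_ne (γ 1 0) 0 with h | h
  · have : (fun τ => den γ τ ^ (1 / 2 : ℂ)) = fun _ => ((γ 1 1 : ℤ) : ℂ) ^ (1 / 2 : ℂ) := by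
      funext τ; rw [den, h]; simp
    rw [this]
    exact continuousOn_const
  · refine ContinuousOn.cpow_const (by unfold den; fun_prop) fun τ hτ => ?_
    refine Or.inr ?_
    rw [den_im]
    exact mul_ne_zero (by exact_mod_cast h) (ne_of_gt hτ)

lemma continuousOn_moeb (γ : SL2Z) : ContinuousOn (moeb γ) {τ : ℂ | 0 < τ.im} :=
  ContinuousOn.div (by fun_prop) (by unfold den; fun_prop) fun _ hτ => den_ne_zero γ hτ

lemma cpow_half_sq (z : ℂ) : (z ^ (1 / 2 : ℂ)) ^ 2 = z := by
  rw [← cpow_nat_mul]; norm_num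

lemma cpow_half_ne_zero {z : ℂ} (hz : z ≠ 0) : z ^ (1 / 2 : ℂ) ≠ 0 := fun h => by
  have := cpow_half_sq z
  rw [h] at this
  exact hz (by simpa using this.symm)

lemma exists_sign_of_sq_eq {f g : ℂ → ℂ} (hf : ContinuousOn f {τ : ℂ | 0 < τ.im})
    (hg : ContinuousOn g {τ : ℂ | 0 < τ.im}) (h : ∀ τ : ℂ, 0 < τ.im → f τ ^ 2 = g τ ^ 2)
    (h0 : ∀ τ : ℂ, 0 < τ.im → g τ ≠ 0) :
    ∃ ε : ℂˣ, ∀ τ : ℂ, 0 < τ.im → f τ = ε * g τ := by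
  rcases IsPreconnected.eq_or_eq_neg_of_sq_eq (convex_halfSpace_im_gt 0).isPreconnected hf hg
    (fun τ hτ => h τ hτ) (fun {τ} hτ => h0 τ hτ) with h | h
  · exact ⟨1, fun τ hτ => by simpa using h hτ⟩
  · exact ⟨-1, fun τ hτ => by simpa using h hτ⟩

/-- Both sides have the same square, so their quotient is a continuous function with values ±1 on
the connected half-plane, hence constant. The sign is absorbed into the matrices. -/
lemma exists_cocycle (γ δ : SL2Z) : ∃ ε : ℂˣ, ∀ τ : ℂ, 0 < τ.im →
    den (γ * δ) τ ^ (1 / 2 : ℂ) =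
      ε * (den γ (moeb δ τ) ^ (1 / 2 : ℂ) * den δ τ ^ (1 / 2 : ℂ)) := by
  refine exists_sign_of_sq_eq (continuousOn_den_cpow _)
    (((continuousOn_den_cpow γ).comp (continuousOn_moeb δ) fun τ hτ => moeb_im_pos δ hτ).mul
      (continuousOn_den_cpow δ)) (fun τ hτ => ?_) fun τ hτ => ?_
  · rw [mul_pow, cpow_half_sq, cpow_half_sq, cpow_half_sq, den_mul γ δ hτ]
  · exact mul_ne_zero (cpow_half_ne_zero (den_ne_zero γ (moeb_im_pos δ hτ)))
      (cpow_half_ne_zero (den_ne_zero δ hτ))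

/-- `f` transforms under `γ` with weight `1/2` and a constant invertible matrix. -/
def IsModularAt {n : ℕ} (f : ℂ → Fin n → ℂ) (γ : SL2Z) : Prop :=
  ∃ M : Matrix (Fin n) (Fin n) ℂ, IsUnit M ∧ ∀ τ : ℂ, 0 < τ.im →
    f (moeb γ τ) = (den γ τ ^ (1 / 2 : ℂ)) • M.mulVec (f τ)

variable {n : ℕ} {f : ℂ → Fin n → ℂ} {γ δ : SL2Z}

lemma IsModularAt.one : IsModularAt f 1 :=
  ⟨1, isUnit_one, fun τ _ => by rw [moeb_one, den_one]; simp⟩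

lemma isUnit_units_smul {M : Matrix (Fin n) (Fin n) ℂ} (hM : IsUnit M) (ε : ℂˣ) :
    IsUnit ((ε : ℂ) • M) := by
  obtain ⟨u, rfl⟩ := hM
  exact ⟨ε • u, rfl⟩

lemma IsModularAt.mul (hγ : IsModularAt f γ) (hδ : IsModularAt f δ) : IsModularAt f (γ * δ) := by
  obtain ⟨M, hM, h1⟩ := hγ
  obtain ⟨N, hN, h2⟩ := hδ
  obtain ⟨ε, hε⟩ := exists_cocycle γ δ
  refine ⟨((ε⁻¹ : ℂˣ) : ℂ) • (M * N), isUnit_units_smul (hM.mul hN) _, fun τ hτ => ?_⟩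
  rw [moeb_mul γ δ hτ, h1 _ (moeb_im_pos δ hτ), h2 τ hτ, hε τ hτ, Matrix.mulVec_smul, smul_smul,
    Matrix.smul_mulVec, smul_smul, Matrix.mulVec_mulVec]
  congr 1
  rw [mul_right_comm, Units.mul_inv, one_mul]

lemma IsModularAt.inv (hγ : IsModularAt f γ) : IsModularAt f γ⁻¹ := by
  obtain ⟨M, ⟨u, rfl⟩, h1⟩ := hγ
  obtain ⟨ε, hε⟩ := exists_cocycle γ γ⁻¹
  refine ⟨(ε : ℂ) • ((u⁻¹ : (Matrix (Fin n) (Fin n) ℂ)ˣ) : Matrix (Fin n) (Fin n) ℂ),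
    isUnit_units_smul (Units.isUnit _) _, fun τ hτ => ?_⟩
  have h2 := h1 _ (moeb_im_pos γ⁻¹ hτ)
  have h3 := hε τ hτ
  rw [← moeb_mul _ _ hτ, mul_inv_cancel, moeb_one] at h2
  rw [mul_inv_cancel, den_one, one_cpow] at h3
  rw [h2, Matrix.mulVec_smul, smul_smul, Matrix.smul_mulVec, smul_smul, Matrix.mulVec_mulVec,
    Units.inv_mul, Matrix.one_mulVec,
    show den γ⁻¹ τ ^ (1 / 2 : ℂ) * den γ (moeb γ⁻¹ τ) ^ (1 / 2 : ℂ) * ε = 1 by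
      linear_combination -h3,
    one_smul]

lemma isModularAt_of_generators (hS : IsModularAt f ModularGroup.S)
    (hT : IsModularAt f ModularGroup.T) (γ : SL2Z) : IsModularAt f γ := by
  have hγ : γ ∈ Subgroup.closure {ModularGroup.S, ModularGroup.T} := by
    rw [SpecialLinearGroup.SL2Z_generators]; exact Subgroup.mem_top γ
  induction hγ using Subgroup.closure_induction with
  | mem x hx =>
    rcases hx with rfl | rfl
    · exact hS
    · exact hT
  | one => exact IsModularAt.one
  | mul x y _ _ hx hy => exact hx.mul hy
  | inv x _ hx => exact hx.inv

/-! ### Invertibility of the two matrices and modularity at the generators. -/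

lemma isUnit_T5 : IsUnit T5 := by
  have h (n : ℕ) (k : ℤ) : zeta n k * zeta n (-k) = 1 := by
    rw [zeta, zeta, ← e_add]
    exact (congrArg e (by push_cast; ring)).trans e_zero
  have h1 := h 60 (-1)
  have h2 := h 60 11
  have h3 := h 240 (-1)
  have h4 := h 240 71
  rw [neg_neg] at h1 h3
  refine IsUnit.of_mul_eq_one (a := T5)
    !![zeta 60 1, 0, 0, 0, 0, 0;
       0, zeta 60 (-11), 0, 0, 0, 0;
       0, 0, 0, 0, zeta 240 1, 0;
       0, 0, 0, 0, 0, zeta 240 (-71);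
       0, 0, zeta 240 1, 0, 0, 0;
       0, 0, 0, zeta 240 (-71), 0, 0] ?_
  ext i j
  fin_cases i <;> fin_cases j <;>
    simp [T5, Matrix.mul_apply, Fin.sum_univ_six, h1, h2, h3, h4]

/-- The square of M₅ is the scalar sin²(π/5) + sin²(2π/5), so its inverse is a multiple of itself.
-/
lemma isUnit_M5 : IsUnit M5 := by
  have hs : 0 < Real.sin (Real.pi / 5) :=
    Real.sin_pos_of_pos_of_lt_pi (by positivity) (by linarith [Real.pi_pos])
  obtain ⟨s, hsdef⟩ : ∃ s, s = Real.sin (Real.pi / 5) ^ 2 + Real.sin (2 * Real.pi / 5) ^ 2 :=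
    ⟨_, rfl⟩
  have hs0 : s ≠ 0 := by rw [hsdef]; positivity
  have h2 : (√2)⁻¹ * √2 = 1 := inv_mul_cancel₀ (by positivity)
  have hmul : M5real * (s⁻¹ • M5real) = 1 := by
    rw [Matrix.mul_smul, inv_smul_eq_iff₀ hs0]
    ext i j
    generalize hS₁ : Real.sin (Real.pi / 5) = S₁ at *
    generalize hS₂ : Real.sin (2 * Real.pi / 5) = S₂ at *
    subst hsdef
    fin_cases i <;> fin_cases j <;>
      simp [M5real, Matrix.mul_apply, Fin.sum_univ_six, hS₁, hS₂] <;>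
      first
        | ring1
        | linear_combination (S₁ ^ 2 + S₂ ^ 2) * h2
  refine IsUnit.of_mul_eq_one ((s⁻¹ • M5real).map ofRealHom) ?_
  have := congrArg (fun A => A.map ofRealHom) hmul
  simp only [Matrix.map_mul] at this
  rw [Matrix.map_one _ (map_zero _) (map_one _)] at this
  exact this

lemma isModularAt_T : IsModularAt H51 ModularGroup.T := by
  refine ⟨T5, isUnit_T5, fun τ hτ => ?_⟩
  have h1 : den ModularGroup.T τ = 1 := by simp [den, ModularGroup.T]
  have h2 : moeb ModularGroup.T τ = τ + 1 := by rw [moeb, h1]; simp [ModularGroup.T]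
  rw [h1, h2, one_cpow, one_smul, H51_add_one]

lemma isModularAt_S : IsModularAt H51 ModularGroup.S := by
  have h1 (τ : ℂ) : den ModularGroup.S τ = τ := by simp [den, ModularGroup.S]
  have h2 (τ : ℂ) : moeb ModularGroup.S τ = -1 / τ := by rw [moeb, h1]; simp [ModularGroup.S]
  -- The roots √(-Iτ) and e(-1/8)√τ have equal squares, so they agree up to a constant sign, whose
  -- value is irrelevant here.
  obtain ⟨ε, hε⟩ := exists_sign_of_sq_eq (f := fun τ => (-I * τ) ^ (1 / 2 : ℂ))
    (g := fun τ => e (-1 / 8) * den ModularGroup.S τ ^ (1 / 2 : ℂ))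
    (ContinuousOn.cpow_const (by fun_prop) fun τ hτ => Or.inl (by simpa using hτ))
    (continuousOn_const.mul (continuousOn_den_cpow _))
    (fun τ hτ => by
      rw [mul_pow, cpow_half_sq, cpow_half_sq, h1, e_pow, ← e_neg_quarter]
      congr 2; push_cast; ring)
    (fun τ hτ => mul_ne_zero (e_ne_zero _) (cpow_half_ne_zero (den_ne_zero _ hτ)))
  have hc : (ε : ℂ) * e (-1 / 8) * (2 / (√5 : ℝ)) ≠ 0 := by
    refine mul_ne_zero (mul_ne_zero ε.ne_zero (e_ne_zero _)) (div_ne_zero two_ne_zero ?_)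
    exact_mod_cast (Real.sqrt_pos.2 (by norm_num : (0 : ℝ) < 5)).ne'
  refine ⟨((ε : ℂ) * e (-1 / 8) * (2 / (√5 : ℝ))) • M5,
    isUnit_units_smul isUnit_M5 (Units.mk0 _ hc), fun τ hτ => ?_⟩
  rw [h2, H51_neg_one_div hτ, hε τ hτ, Matrix.smul_mulVec, smul_smul]
  congr 1
  ring

theorem isRealAnalyticModularForm_H51 : IsRealAnalyticModularForm H51 where
  analytic := analyticOnNhd_H51
  modular γ := by
    obtain ⟨M, ⟨u, rfl⟩, h⟩ := isModularAt_of_generators isModularAt_S isModularAt_T γ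
    exact ⟨u, h⟩
  eigen := ⟨3 / 16, exists_H51_ne_zero, fun _ hτ => casimir_H51 hτ⟩
  growth := growth_H51

end MockTheta

end

theorem mainTheorem5 :
    -- the decomposition
    (∀ τ : ℂ, 0 < τ.im → MockTheta.F51 τ = MockTheta.H51 τ + MockTheta.G51 τ) ∧
    -- modularity of the first summand
    MockTheta.IsRealAnalyticModularForm MockTheta.H51 ∧
    (∀ τ : ℂ, 0 < τ.im →
      MockTheta.H51 (τ + 1) = MockTheta.T5.mulVec (MockTheta.H51 τ)) ∧
    (∀ τ : ℂ, 0 < τ.im →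
      MockTheta.H51 (-1 / τ) =
        ((-Complex.I * τ) ^ (1 / 2 : ℂ) * (2 / (√5 : ℝ) : ℂ)) •
          MockTheta.M5.mulVec (MockTheta.H51 τ)) ∧
    MockTheta.IsCasimirEigenfunction MockTheta.H51 (3 / 16) ∧
    -- the second summand is bounded as `τ` tends vertically to a rational number
    (∀ ξ : ℚ, ∃ C : ℝ, ∀ᶠ y : ℝ in 𝓝[>] 0,
      ‖MockTheta.G51 ((ξ : ℂ) + (y : ℂ) * Complex.I)‖ ≤ C) := by
  exact ⟨fun _ hτ => MockTheta.F51_eq_H51_add_G51 hτ, MockTheta.isRealAnalyticModularForm_H51,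
    fun τ _ => MockTheta.H51_add_one τ, fun _ hτ => MockTheta.H51_neg_one_div hτ,
    ⟨MockTheta.exists_H51_ne_zero, fun _ hτ => MockTheta.casimir_H51 hτ⟩,
    MockTheta.G51_bounded_at_rat⟩
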